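/- Let $k,m,s,t\ge 1$ be integers with $t\le k$ and $s\le m$, put $n=k+m$ and $\lambda=(s,1^{t-1})$, so that the hook $\lambda$ fits in a $k\times(n-k)$ rectangle. Let $\mathcal E_n$ be the Fomin–Kirillov algebra: the associative $\mathbb C$-algebra generated by $x_{ij}$ ($1\le i<j\le n$) with the relations $x_{ij}^2=0$; $x_{ij}x_{jl}=x_{il}x_{ij}+x_{jl}x_{il}$ and $x_{jl}x_{ij}=x_{ij}x_{il}+x_{il}x_{jl}$ for $i<j<l$; and $x_{ij}x_{pl}=x_{pl}x_{ij}$ for distinct $i,j,p,l$ with $i<j$, $p<l$. Let $\theta_i=-\sum_{j<i}x_{ji}+\sum_{j>i}x_{ij}$ be its (pairwise commuting) Dunkl elements, and let $\mathcal E_n^+$ be the cone of nonnegative real linear combinations of monomials in the generators $x_{ij}$, $i<j$. Let $w(\lambda,k)\in S_n$ be the permutation with $w(\lambda,k)_i=\lambda_{k+1-i}+i$ for $1\le i\le k$ (with $\lambda_j=0$ for $j>t$) and $w(\lambda,k)_{k+1}<\dots<w(\lambda,k)_n$. Let $\mathfrak S_w$ denote the Schubert polynomial of $w$ and $s_\lambda$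 the Schur polynomial. Consider the rectangle with rows indexed by $1,\dots,k$ and columns indexed by $k+1,\dots,n$. A diagram $D$ is a set of boxes $(i,j)$ of this rectangle; $\mathrm{row}(D)$ and $\mathrm{col}(D)$ are the numbers of rows and columns that contain a box of $D$. $D$ is a forest if the graph on its boxes, in which two boxes are joined when they lie in the same row or the same column with no box of $D$ directly between them, is acyclic. A labeling $L$ of $D$ assigns the numbers $1,\dots,|D|$ bijectively to the boxes; if number $p$ is assigned to the box $(i_p,j_p)$, put $x^{D_L}=x_{i_1j_1}x_{i_2j_2}\cdots x_{i_{|D|}j_{|D|}}$. Two labelings of $D$ are equivalent if their monomials can be transformed into each other using only the relations $x_{ij}x_{pl}=x_{pl}x_{ij}$ ($i,j,p,l$ distinct); the equivalence classes are the classes of labelings. A labeling of $D$ is with respect to $\lambda$ if $|D|=s+t-1$, $\mathrm{row}(D)\ge t$, $\mathrm{col}(D)\ge s$, and for $l=t$ or for $l=t-1$: $i_1,\dots,i_l$ are distinct, $j_1\le\dots\le j_l$, $j_{l+1},\dots,j_{|D|}$ are distinct and $i_{l+1}\le\dots\le i_{|D|}$. A class of labelings is with respect to $\lambda$ if it contains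 a labeling with respect to $\lambda$. For every diagram $D$ let $\mathcal L(D,\lambda)$ consist of one arbitrarily chosen representative of each class of labelings of $D$ with respect to $\lambda$. Then, for every choice of the representatives, $$\mathfrak S_{w(\lambda,k)}(\theta_1,\dots,\theta_n)=s_\lambda(\theta_1,\dots,\theta_k)=\sum_{D}c_D^\lambda\sum_{D_L\in\mathcal L(D,\lambda)}x^{D_L},$$ where $D$ runs over the forests in the $k\times(n-k)$ rectangle and $$c_D^\lambda=\binom{\mathrm{row}(D)-t+\mathrm{col}(D)-s}{\mathrm{col}(D)-s}$$ if $\mathrm{row}(D)\ge t$ and $\mathrm{col}(D)\ge s$, and $c_D^\lambda=0$ otherwise. In particular $\mathfrak S_{w(\lambda,k)}(\theta_1,\dots,\theta_n)\in\mathcal E_n^+$. -/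

import Mathlib

namespace FominKirillov

/-! ## The Fomin–Kirillov algebra and its Dunkl elements -/

section Algebra

/-- The index set of the generators `x_{ij}`, `i < j`. -/
abbrev GenIndex (n : ℕ) : Type := {p : Fin n × Fin n // p.1 < p.2}

/-- The free generator `x_{ij}`, `i < j`, of the free associative algebra over `ℂ`. -/
noncomputable abbrev freeGen {n : ℕ} (i j : Fin n) (h : i < j) : FreeAlgebra ℂ (GenIndex n) :=
  FreeAlgebra.ι ℂ (⟨(i, j), h⟩ : GenIndex n)

/-- The defining relations of the Fomin–Kirillov algebra. -/
inductive Rel (n : ℕ) : FreeAlgebra ℂ (GenIndex n) → FreeAlgebra ℂ (GenIndex n) → Prop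
  | square (i j : Fin n) (hij : i < j) : Rel n (freeGen i j hij * freeGen i j hij) 0
  | triple (i j k : Fin n) (hij : i < j) (hjk : j < k) :
      Rel n (freeGen i j hij * freeGen j k hjk)
        (freeGen i k (hij.trans hjk) * freeGen i j hij
          + freeGen j k hjk * freeGen i k (hij.trans hjk))
  | triple' (i j k : Fin n) (hij : i < j) (hjk : j < k) :
      Rel n (freeGen j k hjk * freeGen i j hij)
        (freeGen i j hij * freeGen i k (hij.trans hjk)
          + freeGen i k (hij.trans hjk) * freeGen j k hjk)
  | comm (i j k l : Fin n) (hij : i < j) (hkl : k < l)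
      (hik : i ≠ k) (hil : i ≠ l) (hjk : j ≠ k) (hjl : j ≠ l) :
      Rel n (freeGen i j hij * freeGen k l hkl) (freeGen k l hkl * freeGen i j hij)

/-- The Fomin–Kirillov algebra `ℰ_n` over `ℂ`. -/
def FKAlgebra (n : ℕ) : Type := RingQuot (Rel n)

noncomputable instance (n : ℕ) : Ring (FKAlgebra n) := inferInstanceAs (Ring (RingQuot (Rel n)))

noncomputable instance (n : ℕ) : Algebra ℂ (FKAlgebra n) :=
  inferInstanceAs (Algebra ℂ (RingQuot (Rel n)))

/-- The quotient map from the free algebra. -/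
noncomputable def quotMap (n : ℕ) : FreeAlgebra ℂ (GenIndex n) →ₐ[ℂ] FKAlgebra n :=
  RingQuot.mkAlgHom ℂ (Rel n)

theorem quotMap_rel {n : ℕ} {a b : FreeAlgebra ℂ (GenIndex n)} (h : Rel n a b) :
    quotMap n a = quotMap n b := RingQuot.mkAlgHom_rel ℂ h

/-- The generator `x_{ij}` of `ℰ_n` for `i < j` (with the convention `0` if `i ≥ j`). -/
noncomputable def gen {n : ℕ} (i j : Fin n) : FKAlgebra n :=
  if h : i < j then quotMap n (freeGen i j h) else 0

/-- The Dunkl element `θ_i = - ∑_{j < i} x_{ji} + ∑_{k > i} x_{ik}`. -/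
noncomputable def dunkl {n : ℕ} (i : Fin n) : FKAlgebra n :=
  - (∑ j ∈ Finset.univ.filter (fun j => j < i), gen j i)
    + ∑ k ∈ Finset.univ.filter (fun k => i < k), gen i k

/-- The generators extended antisymmetrically to all pairs of indices. -/
noncomputable def skewGen {n : ℕ} (i j : Fin n) : FKAlgebra n := gen i j - gen j i

theorem gen_of_not_lt {n : ℕ} {i j : Fin n} (h : ¬ i < j) : gen i j = 0 := dif_neg h

theorem gen_of_lt {n : ℕ} {i j : Fin n} (h : i < j) :
    gen i j = quotMap n (freeGen i j h) := dif_pos h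

theorem skewGen_symm {n : ℕ} (i j : Fin n) : skewGen j i = - skewGen i j := by
  simp [skewGen]

theorem skewGen_self {n : ℕ} (i : Fin n) : skewGen i i = 0 := by
  simp [skewGen]

theorem skewGen_of_lt {n : ℕ} {i j : Fin n} (h : i < j) : skewGen i j = gen i j := by
  simp [skewGen, gen_of_not_lt h.le.not_gt]

theorem dunkl_eq_sum_skewGen {n : ℕ} (i : Fin n) : dunkl i = ∑ j, skewGen i j := by
  have h1 : ∑ j ∈ Finset.univ.filter (fun j => j < i), gen j i = ∑ j, gen j i := by
    apply Finset.sum_subset (Finset.filter_subset _ _)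
    intro j _ hj
    exact gen_of_not_lt (by simpa using hj)
  have h2 : ∑ k ∈ Finset.univ.filter (fun k => i < k), gen i k = ∑ k, gen i k := by
    apply Finset.sum_subset (Finset.filter_subset _ _)
    intro j _ hj
    exact gen_of_not_lt (by simpa using hj)
  rw [dunkl, h1, h2]
  simp only [skewGen, Finset.sum_sub_distrib]
  abel

theorem gen_triple {n : ℕ} {i j k : Fin n} (hij : i < j) (hjk : j < k) :
    gen i j * gen j k = gen i k * gen i j + gen j k * gen i k := by
  rw [gen_of_lt hij, gen_of_lt hjk, gen_of_lt (hij.trans hjk)]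
  simpa using quotMap_rel (Rel.triple i j k hij hjk)

theorem gen_triple' {n : ℕ} {i j k : Fin n} (hij : i < j) (hjk : j < k) :
    gen j k * gen i j = gen i j * gen i k + gen i k * gen j k := by
  rw [gen_of_lt hij, gen_of_lt hjk, gen_of_lt (hij.trans hjk)]
  simpa using quotMap_rel (Rel.triple' i j k hij hjk)

theorem gen_comm {n : ℕ} (i j k l : Fin n)
    (hik : i ≠ k) (hil : i ≠ l) (hjk : j ≠ k) (hjl : j ≠ l) :
    gen i j * gen k l = gen k l * gen i j := by
  by_cases hij : i < j
  · by_cases hkl : k < l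
    · rw [gen_of_lt hij, gen_of_lt hkl]
      simpa using quotMap_rel (Rel.comm i j k l hij hkl hik hil hjk hjl)
    · simp [gen_of_not_lt hkl]
  · simp [gen_of_not_lt hij]

theorem skewGen_comm {n : ℕ} (i j k l : Fin n)
    (hik : i ≠ k) (hil : i ≠ l) (hjk : j ≠ k) (hjl : j ≠ l) :
    skewGen i j * skewGen k l = skewGen k l * skewGen i j := by
  simp only [skewGen, sub_mul, mul_sub]
  rw [gen_comm i j k l hik hil hjk hjl, gen_comm i j l k hil hik hjl hjk,
    gen_comm j i k l hjk hjl hik hil, gen_comm j i l k hjl hjk hil hik]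
  abel

theorem skewGen_triple {n : ℕ} (i j k : Fin n) (hij : i ≠ j) (hjk : j ≠ k) (hik : i ≠ k) :
    skewGen i j * skewGen j k + skewGen j k * skewGen k i + skewGen k i * skewGen i j = 0 := by
  rcases lt_or_gt_of_ne hij with a | a <;> rcases lt_or_gt_of_ne hjk with b | b <;>
    rcases lt_or_gt_of_ne hik with c | c
  · have := gen_triple a b
    rw [skewGen_symm i k, skewGen_of_lt a, skewGen_of_lt b, skewGen_of_lt c]
    simp only [mul_neg, neg_mul]; rw [this]; abel
  · exact absurd (a.trans b) c.not_gt
  · have := gen_triple' c b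
    rw [skewGen_symm i k, skewGen_symm k j, skewGen_of_lt a, skewGen_of_lt b, skewGen_of_lt c]
    simp only [mul_neg, neg_mul, neg_neg]; rw [this]; abel
  · have := gen_triple c a
    rw [skewGen_symm k j, skewGen_of_lt a, skewGen_of_lt b, skewGen_of_lt c]
    simp only [mul_neg, neg_mul]; rw [this]; abel
  · have := gen_triple' a c
    rw [skewGen_symm i k, skewGen_symm j i, skewGen_of_lt a, skewGen_of_lt b, skewGen_of_lt c]
    simp only [mul_neg, neg_mul, neg_neg]; rw [this]; abel
  · have := gen_triple b c
    rw [skewGen_symm j i, skewGen_of_lt a, skewGen_of_lt b, skewGen_of_lt c]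
    simp only [mul_neg, neg_mul]; rw [this]; abel
  · exact absurd (b.trans a) c.not_gt
  · have := gen_triple' b a
    rw [skewGen_symm j i, skewGen_symm k j, skewGen_of_lt a, skewGen_of_lt b, skewGen_of_lt c]
    simp only [mul_neg, neg_mul, neg_neg]; rw [this]; abel

/-- The Dunkl elements commute pairwise. -/
theorem dunkl_comm {n : ℕ} (i j : Fin n) : dunkl i * dunkl j = dunkl j * dunkl i := by
  rcases eq_or_ne i j with rfl | hij
  · rfl
  rw [dunkl_eq_sum_skewGen, dunkl_eq_sum_skewGen, ← sub_eq_zero, Finset.sum_mul_sum,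
    Finset.sum_mul_sum, Finset.sum_comm (f := fun a b => skewGen j a * skewGen i b)]
  simp only [← Finset.sum_sub_distrib]
  set F : Fin n → Fin n → FKAlgebra n :=
    fun a b => skewGen i a * skewGen j b - skewGen j b * skewGen i a with hF
  have hFi : ∀ b, F i b = 0 := fun b => by simp [hF, skewGen_self]
  have hFj : ∀ a, F a j = 0 := fun a => by simp [hF, skewGen_self]
  have hFji : F j i = 0 := by simp [hF, skewGen_symm i j]
  have key : ∀ a b, F a b = (if a = b then F a a else 0) + (if a = j then F j b else 0)
      + (if b = i then F a i else 0) := by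
    intro a b
    by_cases hai : a = i
    · subst hai; simp [hFi, hij]
    by_cases hbj : b = j
    · subst hbj; by_cases hab : a = b
      · subst hab; simp [hFj, hai]
      · simp [hFj, hab, hij.symm]
    by_cases haj : a = j
    · subst haj; by_cases hbi : b = i
      · subst hbi; simp [hFji, hai]
      · simp [hbi, Ne.symm hbj]
    by_cases hbi : b = i
    · subst hbi; simp [hai, haj]
    by_cases hab : a = b
    · subst hab; simp [haj, hbi]
    · simp only [hab, haj, hbi, if_false, add_zero, hF]
      rw [skewGen_comm i a j b hij (Ne.symm hbi) haj hab, sub_self]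
  have h3 : ∀ c, F c c + F j c + F c i = 0 := by
    intro c
    by_cases hci : c = i
    · subst hci; simp [hFi, hFji]
    by_cases hcj : c = j
    · subst hcj; simp [hFj, hFji]
    have r1 := skewGen_triple i j c hij (Ne.symm hcj) (Ne.symm hci)
    have r2 := skewGen_triple j i c hij.symm (Ne.symm hci) (Ne.symm hcj)
    rw [skewGen_symm i c] at r1
    rw [skewGen_symm i j, skewGen_symm j c] at r2
    simp only [hF]
    rw [skewGen_symm i j]
    simp only [mul_neg, neg_mul, neg_neg] at r1 r2 ⊢
    rw [← sub_eq_zero_of_eq (r1.trans r2.symm)]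
    abel
  change ∑ a, ∑ b, F a b = 0
  rw [Finset.sum_congr rfl fun a _ => Finset.sum_congr rfl fun b _ => key a b]
  simp only [Finset.sum_add_distrib, Finset.sum_ite_eq, Finset.sum_ite_eq', Finset.mem_univ,
    if_true]
  rw [Finset.sum_comm]
  simp only [Finset.sum_ite_eq', Finset.mem_univ, if_true]
  rw [← Finset.sum_add_distrib, ← Finset.sum_add_distrib]
  exact Finset.sum_eq_zero fun c _ => h3 c

/-- The subalgebra of `ℰ_n` generated by the Dunkl elements. -/
noncomputable abbrev dunklSubalgebra (n : ℕ) : Subalgebra ℂ (FKAlgebra n) :=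
  Algebra.adjoin ℂ (Set.range (dunkl (n := n)))

/-- The subalgebra generated by the Dunkl elements is commutative. -/
noncomputable instance dunklSubalgebraCommRing (n : ℕ) : CommRing (dunklSubalgebra n) where
  mul_comm :=
    haveI : IsMulCommutative (dunklSubalgebra n) := Algebra.isMulCommutative_adjoin ℂ (by
      rintro _ ⟨i, rfl⟩ _ ⟨j, rfl⟩
      exact dunkl_comm i j)
    mul_comm'

/-- Evaluation `f ↦ f(θ_1, …, θ_n)` of polynomials at the (commuting) Dunkl elements. -/
noncomputable def dunklEval {n : ℕ} : MvPolynomial (Fin n) ℂ →ₐ[ℂ] FKAlgebra n :=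
  (dunklSubalgebra n).val.comp
    (MvPolynomial.aeval fun i =>
      (⟨dunkl i, Algebra.subset_adjoin ⟨i, rfl⟩⟩ : dunklSubalgebra n))

theorem dunklEval_X {n : ℕ} (i : Fin n) : dunklEval (MvPolynomial.X i) = dunkl i := by
  simp [dunklEval]

/-- The cone `ℰ_n^+` of nonnegative linear combinations of monomials in the generators
`x_{ij}`, `i < j`. -/
noncomputable def nonnegCone (n : ℕ) : AddSubmonoid (FKAlgebra n) :=
  AddSubmonoid.closure
    {a | ∃ c : ℝ, 0 ≤ c ∧ ∃ l : List (GenIndex n),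
      a = (c : ℂ) • (l.map fun p => gen p.1.1 p.1.2).prod}

end Algebra

/-! ## Schubert polynomials -/

section Schubert

open MvPolynomial

theorem exists_divDiff {σ : Type*} [DecidableEq σ] (i j : σ) (f : MvPolynomial σ ℂ) :
    ∃ g : MvPolynomial σ ℂ, (X i - X j) * g = f - rename (Equiv.swap i j) f := by
  suffices h : (X i - X j : MvPolynomial σ ℂ) ∣ f - rename (Equiv.swap i j) f by
    obtain ⟨g, hg⟩ := h
    exact ⟨g, hg.symm⟩
  induction f using MvPolynomial.induction_on with
  | C a => simp
  | add p q hp hq =>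
    rw [map_add, add_sub_add_comm]
    exact dvd_add hp hq
  | mul_X p l hp =>
    have h : p * X l - rename (Equiv.swap i j) (p * X l)
        = (p - rename (Equiv.swap i j) p) * X l
          + rename (Equiv.swap i j) p * (X l - X (Equiv.swap i j l)) := by
      rw [map_mul, rename_X]; ring
    rw [h]
    refine dvd_add (hp.mul_right _) (Dvd.dvd.mul_left ?_ _)
    by_cases hi : l = i
    · subst hi; simp
    by_cases hj : l = j
    · subst hj
      rw [Equiv.swap_apply_right]
      exact (dvd_neg.2 dvd_rfl).trans (by rw [neg_sub])
    · simp [Equiv.swap_apply_of_ne_of_ne hi hj]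

/-- The divided difference `(f - s_{ij} f) / (x_i - x_j)`, where `s_{ij}` exchanges the
variables `x_i` and `x_j`. -/
noncomputable def divDiff {σ : Type*} [DecidableEq σ] (i j : σ) (f : MvPolynomial σ ℂ) :
    MvPolynomial σ ℂ :=
  Classical.choose (exists_divDiff i j f)

theorem divDiff_spec {σ : Type*} [DecidableEq σ] (i j : σ) (f : MvPolynomial σ ℂ) :
    (X i - X j) * divDiff i j f = f - rename (Equiv.swap i j) f :=
  Classical.choose_spec (exists_divDiff i j f)

/-- `w` has an ascent at the (zero-based) position `i`. -/
def HasAscentAt {n : ℕ} (w : Equiv.Perm (Fin n)) (i : ℕ) : Prop :=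
  ∃ hi : i + 1 < n, w ⟨i, Nat.lt_of_succ_lt hi⟩ < w ⟨i + 1, hi⟩

theorem sum_mul_swap_lt {n : ℕ} (w : Equiv.Perm (Fin n)) (a b : Fin n) (hab : a < b)
    (h : w a < w b) :
    ∑ x : Fin n, (x : ℕ) * ((w * Equiv.swap a b) x : ℕ) < ∑ x : Fin n, (x : ℕ) * (w x : ℕ) := by
  have hb : b ∈ (Finset.univ.erase a : Finset (Fin n)) := by simp [hab.ne']
  rw [← Finset.add_sum_erase _ _ (Finset.mem_univ a), ← Finset.add_sum_erase _ _ hb,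
    ← Finset.add_sum_erase _ (fun x : Fin n => (x : ℕ) * (w x : ℕ)) (Finset.mem_univ a),
    ← Finset.add_sum_erase _ (fun x : Fin n => (x : ℕ) * (w x : ℕ)) hb]
  have hrest : ∑ x ∈ (Finset.univ.erase a).erase b, (x : ℕ) * ((w * Equiv.swap a b) x : ℕ)
      = ∑ x ∈ (Finset.univ.erase a).erase b, (x : ℕ) * (w x : ℕ) := by
    refine Finset.sum_congr rfl fun x hx => ?_
    simp only [Finset.mem_erase, Finset.mem_univ, and_true] at hx
    simp [Equiv.swap_apply_of_ne_of_ne hx.2 hx.1]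
  rw [hrest]
  simp only [Equiv.Perm.mul_apply, Equiv.swap_apply_left, Equiv.swap_apply_right]
  have h1 : (a : ℕ) < b := hab
  have h2 : (w a : ℕ) < w b := h
  nlinarith

open Classical in
/-- The Schubert polynomial `𝔖_w ∈ ℂ[x_1, …, x_n]` of `w ∈ S_n`.
For the longest permutation (the only one without ascents) it is
`x_1^{n-1} x_2^{n-2} ⋯ x_{n-1}`; otherwise `𝔖_w = ∂_i 𝔖_{w s_i}` where `i` is an ascent of `w`.
By the braid relations for the `∂_i` the result does not depend on the ascent chosen at
each step; for definiteness the first ascent is used. -/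
noncomputable def schubert {n : ℕ} (w : Equiv.Perm (Fin n)) : MvPolynomial (Fin n) ℂ :=
  if h : ∃ i, HasAscentAt w i then
    divDiff (⟨Nat.find h, Nat.lt_of_succ_lt (Nat.find_spec h).1⟩ : Fin n)
      ⟨Nat.find h + 1, (Nat.find_spec h).1⟩
      (schubert (w * Equiv.swap ⟨Nat.find h, Nat.lt_of_succ_lt (Nat.find_spec h).1⟩
        ⟨Nat.find h + 1, (Nat.find_spec h).1⟩))
  else ∏ i : Fin n, X i ^ (n - 1 - (i : ℕ))
termination_by ∑ x : Fin n, (x : ℕ) * (w x : ℕ)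
decreasing_by
  exact sum_mul_swap_lt w _ _ (Fin.mk_lt_mk.2 (Nat.lt_succ_self _)) (Nat.find_spec h).2

end Schubert

/-! ## Schur polynomials, hooks and Grassmannian permutations -/

section Schur

open MvPolynomial

/-- A filling of the boxes of `μ` is semistandard if it weakly increases along rows and strictly
increases down columns. -/
def IsSemistandard {k : ℕ} (μ : YoungDiagram) (T : μ.cells → Fin k) : Prop :=
  (∀ a b : μ.cells, a.1.1 = b.1.1 → a.1.2 < b.1.2 → T a ≤ T b) ∧
    (∀ a b : μ.cells, a.1.2 = b.1.2 → a.1.1 < b.1.1 → T a < T b)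

open Classical in
/-- The Schur polynomial `s_μ(x_1, …, x_k)`. -/
noncomputable def schur (μ : YoungDiagram) (k : ℕ) : MvPolynomial (Fin k) ℂ :=
  ∑ T ∈ (Finset.univ : Finset (μ.cells → Fin k)).filter (IsSemistandard μ), ∏ a, X (T a)

/-- The hook `(s, 1^{t-1})` with `s` columns and `t` rows (`s, t ≥ 1`). -/
def hookShape (s t : ℕ) : YoungDiagram where
  cells := (Finset.range s).image (fun j => (0, j)) ∪ (Finset.range t).image (fun i => (i, 0))
  isLowerSet := by
    rintro ⟨a, b⟩ ⟨c, d⟩ h hab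
    obtain ⟨h1, h2⟩ := Prod.mk_le_mk.1 h
    simp only [Finset.coe_union, Finset.coe_image, Finset.coe_range, Set.mem_union, Set.mem_image,
      Set.mem_Iio, Prod.mk.injEq] at hab ⊢
    rcases hab with ⟨j, hj, rfl, rfl⟩ | ⟨i, hi, rfl, rfl⟩
    · exact Or.inl ⟨d, by omega, by omega, rfl⟩
    · exact Or.inr ⟨c, by omega, rfl, by omega⟩

theorem mem_hookShape {s t i j : ℕ} :
    (i, j) ∈ hookShape s t ↔ (i = 0 ∧ j < s) ∨ (j = 0 ∧ i < t) := by
  rw [← YoungDiagram.mem_cells]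
  simp only [hookShape, Finset.mem_union, Finset.mem_image, Finset.mem_range, Prod.mk.injEq]
  constructor
  · rintro (⟨a, h, rfl, rfl⟩ | ⟨a, h, rfl, rfl⟩) <;> simp [h]
  · rintro (⟨rfl, h⟩ | ⟨rfl, h⟩)
    · exact Or.inl ⟨j, h, rfl, rfl⟩
    · exact Or.inr ⟨i, h, rfl, rfl⟩

theorem rowLen_hookShape {s t : ℕ} (hs : 1 ≤ s) (ht : 1 ≤ t) (i : ℕ) :
    (hookShape s t).rowLen i = if i = 0 then s else if i < t then 1 else 0 := by
  have h : ∀ j, j < (hookShape s t).rowLen i ↔ (i = 0 ∧ j < s) ∨ (j = 0 ∧ i < t) := fun j => by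
    rw [← YoungDiagram.mem_iff_lt_rowLen, mem_hookShape]
  refine eq_of_forall_lt_iff fun j => ?_
  rw [h]
  split_ifs <;> omega

/-- The set of the values `w_1, …, w_k` of the Grassmannian permutation `w(μ, k)`:
one-based these are `μ_{k+1-i} + i` for `1 ≤ i ≤ k`. -/
def grassmannianSet (n k : ℕ) (μ : YoungDiagram) : Finset (Fin n) :=
  Finset.univ.filter fun v => ∃ i < k, (v : ℕ) = μ.rowLen (k - 1 - i) + i

/-- The Grassmannian permutation `w(μ, k) ∈ S_n`: its word lists the values `μ_{k+1-i} + i`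
(`1 ≤ i ≤ k`) in increasing order, followed by the remaining elements of `[n]` in increasing
order. It is used for `μ` contained in a `k × (n - k)` rectangle. -/
def grassmannianPerm (n k : ℕ) (μ : YoungDiagram) : Equiv.Perm (Fin n) :=
  ((finCongr (((Finset.card_add_card_compl (grassmannianSet n k μ)).trans
    (Fintype.card_fin n)).symm)).trans finSumFinEquiv.symm).trans
    (finSumEquivOfFinset (s := grassmannianSet n k μ) rfl rfl)

theorem grassmannianSet_card {n k : ℕ} {μ : YoungDiagram} (hk : k ≤ n)
    (hμ : μ.rowLen 0 ≤ n - k) : (grassmannianSet n k μ).card = k := by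
  have hlt : ∀ i : Fin k, μ.rowLen (k - 1 - i) + i < n := fun i => by
    have := μ.rowLen_anti _ _ (Nat.zero_le (k - 1 - (i : ℕ)))
    omega
  have himg : grassmannianSet n k μ
      = Finset.univ.image fun i : Fin k => (⟨μ.rowLen (k - 1 - i) + i, hlt i⟩ : Fin n) := by
    ext v
    simp only [grassmannianSet, Finset.mem_filter, Finset.mem_univ, true_and, Finset.mem_image,
      Fin.ext_iff]
    exact ⟨fun ⟨i, hi, h⟩ => ⟨⟨i, hi⟩, h.symm⟩, fun ⟨i, h⟩ => ⟨i, i.2, h.symm⟩⟩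
  rw [himg, Finset.card_image_of_injective, Finset.card_univ, Fintype.card_fin]
  refine StrictMono.injective fun i j hij => ?_
  have h1 : (i : ℕ) < j := hij
  have := μ.rowLen_anti _ _ (show k - 1 - (j : ℕ) ≤ k - 1 - i by omega)
  exact Fin.mk_lt_mk.2 (by omega)

/-- The first `k` values of `w(μ, k)`; one-based, `w(μ, k)_i = μ_{k+1-i} + i`. -/
theorem grassmannianPerm_apply {n k : ℕ} {μ : YoungDiagram} (hk : k ≤ n)
    (hμ : μ.rowLen 0 ≤ n - k) (i : Fin k) :
    (grassmannianPerm n k μ (Fin.castLE hk i) : ℕ) = μ.rowLen (k - 1 - i) + i := by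
  have hc := grassmannianSet_card hk hμ
  have hlt : ∀ j : Fin (grassmannianSet n k μ).card, μ.rowLen (k - 1 - j) + j < n := fun j => by
    have := μ.rowLen_anti _ _ (Nat.zero_le (k - 1 - (j : ℕ)))
    have := j.2
    omega
  have huniq := Finset.orderEmbOfFin_unique (s := grassmannianSet n k μ) rfl
    (f := fun j => (⟨μ.rowLen (k - 1 - j) + j, hlt j⟩ : Fin n))
    (fun j => by
      simp only [grassmannianSet, Finset.mem_filter, Finset.mem_univ, true_and]
      exact ⟨j, by have := j.2; omega, rfl⟩)
    (fun a b hab => by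
      have h1 : (a : ℕ) < b := hab
      have := μ.rowLen_anti _ _ (show k - 1 - (b : ℕ) ≤ k - 1 - a by omega)
      exact Fin.mk_lt_mk.2 (by omega))
  have hx : Fin.cast ((Finset.card_add_card_compl (grassmannianSet n k μ)).trans
      (Fintype.card_fin n)).symm (Fin.castLE hk i)
      = Fin.castAdd (grassmannianSet n k μ)ᶜ.card (Fin.cast hc.symm i) := by
    ext; simp
  simp only [grassmannianPerm, Equiv.trans_apply, finCongr_apply]
  rw [hx, finSumFinEquiv_symm_apply_castAdd, finSumEquivOfFinset_inl, ← huniq]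
  simp

/-- The last `n - k` values of `w(μ, k)` increase. -/
theorem grassmannianPerm_lt {n k : ℕ} {μ : YoungDiagram} (hk : k ≤ n)
    (hμ : μ.rowLen 0 ≤ n - k) {a b : Fin n} (ha : k ≤ (a : ℕ)) (hab : a < b) :
    grassmannianPerm n k μ a < grassmannianPerm n k μ b := by
  have hc := grassmannianSet_card hk hμ
  have hn := (Finset.card_add_card_compl (grassmannianSet n k μ)).trans (Fintype.card_fin n)
  have hx : ∀ x : Fin n, ∀ hx : k ≤ (x : ℕ), Fin.cast hn.symm x
      = Fin.natAdd (grassmannianSet n k μ).card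
        (⟨x - k, by have := x.2; omega⟩ : Fin (grassmannianSet n k μ)ᶜ.card) := by
    intro x hx
    ext; simp only [Fin.val_cast, Fin.val_natAdd]; omega
  have h1 : (a : ℕ) < b := hab
  simp only [grassmannianPerm, Equiv.trans_apply, finCongr_apply]
  rw [hx a ha, hx b (by omega), finSumFinEquiv_symm_apply_natAdd,
    finSumFinEquiv_symm_apply_natAdd, finSumEquivOfFinset_inr, finSumEquivOfFinset_inr]
  exact (Finset.orderEmbOfFin _ _).strictMono (Fin.mk_lt_mk.2 (by omega))

end Schur

/-! ## Diagrams, forests and labelings -/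

section Diagrams

variable {k m : ℕ}

/-- A box of `D` is joined to the next box of `D` in the same row, respectively column. -/
def NextBox (D : Finset (Fin k × Fin m)) (a b : D) : Prop :=
  (a.1.1 = b.1.1 ∧ a.1.2 < b.1.2 ∧ ∀ c ∈ D, c.1 = a.1.1 → ¬ (a.1.2 < c.2 ∧ c.2 < b.1.2)) ∨
  (a.1.2 = b.1.2 ∧ a.1.1 < b.1.1 ∧ ∀ c ∈ D, c.2 = a.1.2 → ¬ (a.1.1 < c.1 ∧ c.1 < b.1.1))

/-- The graph on the boxes of a diagram `D`: two boxes are joined if they lie in the same row or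
the same column with no box of `D` directly between them. -/
def boxGraph (D : Finset (Fin k × Fin m)) : SimpleGraph D := SimpleGraph.fromRel (NextBox D)

/-- A diagram is a forest if its graph is one. -/
def IsForest (D : Finset (Fin k × Fin m)) : Prop := (boxGraph D).IsAcyclic

/-- The number of rows containing a box of `D`. -/
def rowCount (D : Finset (Fin k × Fin m)) : ℕ := (D.image Prod.fst).card

/-- The number of columns containing a box of `D`. -/
def colCount (D : Finset (Fin k × Fin m)) : ℕ := (D.image Prod.snd).card

/-- A labeling of `D`: a bijective assignment of the numbers `0, …, |D| - 1` to its boxes. -/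
abbrev Labeling (D : Finset (Fin k × Fin m)) : Type := D ≃ Fin D.card

/-- The row `i_p` of the box with label `p`. -/
def Labeling.row {D : Finset (Fin k × Fin m)} (L : Labeling D) (p : Fin D.card) : Fin k :=
  (L.symm p).1.1

/-- The column `j_p` of the box with label `p`. -/
def Labeling.col {D : Finset (Fin k × Fin m)} (L : Labeling D) (p : Fin D.card) : Fin m :=
  (L.symm p).1.2

/-- The monomial `x^{D_L} = x_{i_1 j_1} x_{i_2 j_2} ⋯` in `ℰ_n`, `n = k + m`. The rows of the
rectangle are indexed by the first `k`, its columns by the last `m` elements of `[n]`. -/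
noncomputable def Labeling.monomial {D : Finset (Fin k × Fin m)} (L : Labeling D) :
    FKAlgebra (k + m) :=
  (List.ofFn fun p => gen (Fin.castAdd m (L.row p)) (Fin.natAdd k (L.col p))).prod

/-- `L'` arises from `L` by one application of a commutation relation
`x_{ij} x_{i'j'} = x_{i'j'} x_{ij}` (`i, j, i', j'` distinct) to two adjacent factors of
`x^{D_L}`. -/
def CommStep {D : Finset (Fin k × Fin m)} (L L' : Labeling D) : Prop :=
  ∃ p q : Fin D.card, (p : ℕ) + 1 = q ∧ L.row p ≠ L.row q ∧ L.col p ≠ L.col q ∧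
    L' = L.trans (Equiv.swap p q)

/-- Two labelings are equivalent if their monomials are transformed into each other by
commutation relations. -/
def labelingSetoid (D : Finset (Fin k × Fin m)) : Setoid (Labeling D) :=
  Relation.EqvGen.setoid CommStep

/-- The classes of labelings of `D`. -/
abbrev LabelingClass (D : Finset (Fin k × Fin m)) : Type := Quotient (labelingSetoid D)

/-- The class of a labeling. -/
def Labeling.toClass {D : Finset (Fin k × Fin m)} (L : Labeling D) : LabelingClass D :=
  Quotient.mk (labelingSetoid D) L

/-- Among the first `l` boxes the rows are distinct and the columns weakly increase, and among
the remaining boxes the columns are distinct and the rows weakly increase. -/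
def Labeling.SplitsAt {D : Finset (Fin k × Fin m)} (L : Labeling D) (l : ℕ) : Prop :=
  ∀ p q : Fin D.card, p < q →
    ((q : ℕ) < l → L.row p ≠ L.row q ∧ L.col p ≤ L.col q) ∧
    (l ≤ (p : ℕ) → L.col p ≠ L.col q ∧ L.row p ≤ L.row q)

/-- `L` is a labeling with respect to the hook `(s, 1^{t-1})`. -/
def Labeling.IsWrtHook {D : Finset (Fin k × Fin m)} (L : Labeling D) (s t : ℕ) : Prop :=
  D.card + 1 = s + t ∧ t ≤ rowCount D ∧ s ≤ colCount D ∧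
    (L.SplitsAt t ∨ L.SplitsAt (t - 1))

/-- The class `c` contains a labeling with respect to the hook `(s, 1^{t-1})`. -/
def IsHookClass {D : Finset (Fin k × Fin m)} (s t : ℕ) (c : LabelingClass D) : Prop :=
  ∃ L : Labeling D, L.toClass = c ∧ L.IsWrtHook s t

open Classical in
/-- The finite set of all classes of labelings of `D` with respect to the hook `(s, 1^{t-1})`. -/
noncomputable def hookClasses (D : Finset (Fin k × Fin m)) (s t : ℕ) : Finset (LabelingClass D) :=
  Finset.univ.filter (IsHookClass s t)

open Classical in
/-- The set of all forests in the `k × m` rectangle. -/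
noncomputable def forests (k m : ℕ) : Finset (Finset (Fin k × Fin m)) :=
  Finset.univ.filter IsForest

/-- The coefficient `c_D^λ` for `λ = (s, 1^{t-1})`. -/
def hookCoeff (D : Finset (Fin k × Fin m)) (s t : ℕ) : ℕ :=
  if t ≤ rowCount D ∧ s ≤ colCount D then
    (rowCount D - t + (colCount D - s)).choose (colCount D - s)
  else 0

end Diagrams

end FominKirillov

/-! Write e_r and h_r for the elementary and complete symmetric polynomials in θ_1, …, θ_k, and F(s,
t) for the forest sum attached to the hook (s, 1^{t-1}). The proof rests on the recursion F(s+1, t)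
+ F(s, t+1) = e_t h_s for t ≥ 1, with F(0, t+1) = 0 (`hookSum_add`, `hookSum_zero`). Hook Schur
polynomials satisfy the same recursion (`listHook_add`), so induction on s identifies the two.

The factors e_t and h_s are expanded by Pieri formulas. Distribute a subset of a vertex set I over a
list J of columns, each column carrying the sum over all orders of its factors x_{ib}; call the
result the column sum. Moving a vertex j from the columns to the rows multiplies the column sum by 1
+ θ_j (`columnSum_insert`), where θ_j is the Dunkl element on the vertices I ∪ J ∪ {j}. After
grading, this makes e_r a sum over sets of r boxes with at most one box in each row, ordered by
column, and h_r a sum over sets with at most one box in each column, ordered by row.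

In the product e_t h_s, read the boxes of the first factor as arrows from rows to columns and those
of the second as arrows from columns to rows, so that every vertex has at most one outgoing arrow.
The core is the largest set of vertices each of which has its arrow inside the set. Arrows outside
the core use none of its rows and columns, so they can be split off; what remains is the sum over
all complete maps on the core. For a nonempty core this sum is, up to sign, the product of all Dunkl
elements on the vertices of the core, which vanishes (`columnSumDeg_mul_eq_zero`). The surviving
pairs are exactly the disjoint pairs (A, B) whose union is a forest (`noCore_iff`, `isForest_iff`).

Such a pair, with orders on A and B, is a labeling of the forest that splits at t. Two labelings are
equivalent iff they order the boxes of each row and each column in the same way. Within a class, a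
splitting labeling is determined by its set of initial boxes: this set must contain every box
followed in its column and avoid every box preceded in its row, and the remaining boxes are free.
Hence a class containing a splitting labeling has a binomial number of them
(`card_filter_splitsAt`), and Pascal's rule writes this number as the sum of the two hook
coefficients (`hookCoeff_add`).

The equality of the Schubert and the Schur polynomial is purely commutative. Sorting the first k
entries of a Grassmannian permutation into decreasing order gives a dominant permutation, whose
Schubert polynomial is a monomial. The operator ∂_{w_0} applied to this monomial satisfies the same
hook recursion (`sortDiff_pieri`). -/

namespace FominKirillov

/-! ### Sums over sorted arrangements, and stars -/

section SortedSum

variable {α β R : Type*} [DecidableEq α] [LinearOrder β] [Ring R]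

/-- The arrangements of the elements of `A` in a list along which the key `κ` weakly increases. -/
def sortedWords (κ : α → β) (A : Finset α) : Finset (List α) :=
  A.val.lists.toFinset.filter fun w => w.Pairwise fun a b => κ a ≤ κ b

theorem mem_sortedWords {κ : α → β} {A : Finset α} {w : List α} :
    w ∈ sortedWords κ A ↔
      w.Nodup ∧ (∀ a, a ∈ w ↔ a ∈ A) ∧ w.Pairwise fun a b => κ a ≤ κ b := by
  simp only [sortedWords, Finset.mem_filter, Multiset.mem_toFinset, Multiset.mem_lists_iff,
    Multiset.quot_mk_to_coe, ← and_assoc]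
  refine and_congr_left fun _ => ⟨fun h => ?_, fun ⟨h1, h2⟩ => ?_⟩
  · refine ⟨?_, fun a => ?_⟩
    · rw [← Multiset.coe_nodup, ← h]; exact A.nodup
    · rw [← Multiset.mem_coe, ← h]; rfl
  · refine (Multiset.Nodup.ext A.nodup (Multiset.coe_nodup.2 h1)).2 fun a => ?_
    rw [Multiset.mem_coe, h2]; rfl

/-- The sum of the products `∏ f a` over all arrangements of `A` sorted by `κ`. -/
def sortedSum (κ : α → β) (f : α → R) (A : Finset α) : R :=
  ∑ w ∈ sortedWords κ A, (w.map f).prod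

theorem sortedSum_empty (κ : α → β) (f : α → R) : sortedSum κ f ∅ = 1 := by
  have : sortedWords κ (∅ : Finset α) = {[]} := by
    ext w
    simp only [mem_sortedWords, Finset.notMem_empty, iff_false, Finset.mem_singleton]
    exact ⟨fun h => List.eq_nil_iff_forall_not_mem.2 h.2.1, by rintro rfl; simp⟩
  simp [sortedSum, this]

/-- A sorted arrangement starts with an element of minimal key, and the rest is again sorted. Sorted
sums are manipulated mostly by this recursion rather than through lists. -/
theorem sortedSum_eq_sum_first (κ : α → β) (f : α → R) {A : Finset α} (hA : A.Nonempty) :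
    sortedSum κ f A
      = ∑ a ∈ A.filter (fun a => ∀ b ∈ A, κ a ≤ κ b), f a * sortedSum κ f (A.erase a) := by
  simp only [sortedSum, Finset.mul_sum]
  rw [Finset.sum_sigma']
  symm
  refine Finset.sum_bij (fun p _ => p.1 :: p.2) ?_ ?_ ?_ ?_
  · rintro ⟨a, w⟩ h
    simp only [Finset.mem_sigma, Finset.mem_filter, mem_sortedWords, Finset.mem_erase] at h ⊢
    obtain ⟨⟨ha, hmin⟩, hnd, hmem, hs⟩ := h
    refine ⟨List.nodup_cons.2 ⟨fun h' => ((hmem a).1 h').1 rfl, hnd⟩, fun b => ?_,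
      List.pairwise_cons.2 ⟨fun b hb => hmin b ((hmem b).1 hb).2, hs⟩⟩
    rw [List.mem_cons, hmem]
    by_cases hb : b = a
    · simp [hb, ha]
    · simp [hb]
  · rintro ⟨a, w⟩ _ ⟨a', w'⟩ _ h
    simp only [List.cons.injEq] at h
    obtain ⟨rfl, rfl⟩ := h; rfl
  · intro w hw
    rw [mem_sortedWords] at hw
    obtain ⟨hnd, hmem, hs⟩ := hw
    cases w with
    | nil => obtain ⟨a, ha⟩ := hA; exact absurd ((hmem a).2 ha) (by simp)
    | cons a w =>
      rw [List.nodup_cons] at hnd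
      rw [List.pairwise_cons] at hs
      refine ⟨⟨a, w⟩, ?_, rfl⟩
      simp only [Finset.mem_sigma, Finset.mem_filter, mem_sortedWords, Finset.mem_erase]
      refine ⟨⟨(hmem a).1 (by simp), fun b hb => ?_⟩, hnd.2, fun b => ?_, hs.2⟩
      · rcases List.mem_cons.1 ((hmem b).2 hb) with rfl | h
        · exact le_rfl
        · exact hs.1 b h
      · rw [← hmem b, List.mem_cons]
        constructor
        · intro hb; exact ⟨fun e => hnd.1 (e ▸ hb), Or.inr hb⟩
        · rintro ⟨h1, h2⟩; exact h2.resolve_left h1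
  · rintro ⟨a, w⟩ _; simp

theorem sortedSum_commute (κ : α → β) (f : α → R) (A : Finset α) (y : R)
    (h : ∀ a ∈ A, Commute y (f a)) : Commute y (sortedSum κ f A) := by
  refine Commute.sum_right _ _ _ fun w hw => Commute.list_prod_right _ _ fun z hz => ?_
  obtain ⟨a, ha, rfl⟩ := List.mem_map.1 hz
  exact h a (((mem_sortedWords.1 hw).2.1 a).1 ha)

/-- Used to place a star in one column of the rectangle, to exchange rows and columns, and to pass
to the polynomial ring. -/
theorem sortedSum_map {α' β' R' : Type*} [DecidableEq α'] [LinearOrder β'] [Ring R']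
    (e : α ↪ α') (φ : R →+* R') (κ : α → β) (κ' : α' → β')
    (hκ : ∀ a b, κ' (e a) ≤ κ' (e b) ↔ κ a ≤ κ b) (f : α → R) (f' : α' → R')
    (hf : ∀ a, f' (e a) = φ (f a)) (A : Finset α) :
    sortedSum κ' f' (A.map e) = φ (sortedSum κ f A) := by
  induction A using Finset.strongInduction with
  | H A ih =>
    rcases A.eq_empty_or_nonempty with rfl | hA
    · simp [sortedSum_empty]
    · rw [sortedSum_eq_sum_first κ f hA, sortedSum_eq_sum_first κ' f' (hA.map), map_sum]
      have : (A.map e).filter (fun a => ∀ b ∈ A.map e, κ' a ≤ κ' b)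
          = (A.filter (fun a => ∀ b ∈ A, κ a ≤ κ b)).map e := by
        ext a
        simp only [Finset.mem_filter, Finset.mem_map]
        constructor
        · rintro ⟨⟨a, ha, rfl⟩, h⟩
          exact ⟨a, ⟨ha, fun b hb => by simpa [hκ] using h (e b) ⟨b, hb, rfl⟩⟩, rfl⟩
        · rintro ⟨a, ⟨ha, h⟩, rfl⟩
          refine ⟨⟨a, ha, rfl⟩, ?_⟩
          rintro _ ⟨b, hb, rfl⟩
          simpa [hκ] using h b hb
      rw [this, Finset.sum_map]
      refine Finset.sum_congr rfl fun a ha => ?_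
      rw [← Finset.map_erase, ih _ (Finset.erase_ssubset (Finset.mem_filter.1 ha).1), map_mul, hf]

/-- Scaling all factors by a central element. -/
theorem sortedSum_mul_central (κ : α → β) (f : α → R) (c : R) (hc : ∀ y, Commute c y)
    (A : Finset α) : sortedSum κ (fun a => f a * c) A = sortedSum κ f A * c ^ A.card := by
  induction A using Finset.strongInduction with
  | H A ih =>
    rcases A.eq_empty_or_nonempty with rfl | hA
    · simp [sortedSum_empty]
    · rw [sortedSum_eq_sum_first _ _ hA, sortedSum_eq_sum_first _ _ hA, Finset.sum_mul]
      refine Finset.sum_congr rfl fun a ha => ?_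
      have ha' := (Finset.mem_filter.1 ha).1
      rw [ih _ (Finset.erase_ssubset ha'), ← Finset.card_erase_add_one ha', pow_succ]
      rw [mul_assoc, mul_assoc, ← mul_assoc c, (hc _).eq]
      simp only [mul_assoc]
      rw [(hc (c ^ _)).eq]

/-- The sum of the products `∏ f a` over all arrangements of `A`. -/
def starSum (f : α → R) (A : Finset α) : R := sortedSum (fun _ => (0 : ℕ)) f A

theorem starSum_empty (f : α → R) : starSum f ∅ = 1 := sortedSum_empty _ _

theorem starSum_eq_sum_first (f : α → R) {A : Finset α} (hA : A.Nonempty) :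
    starSum f A = ∑ a ∈ A, f a * starSum f (A.erase a) := by
  rw [starSum, sortedSum_eq_sum_first _ _ hA]
  simp [starSum]

theorem starSum_insert_first (f : α → R) {j : α} {C : Finset α} (hj : j ∉ C) :
    starSum f (insert j C) = f j * starSum f C + ∑ c ∈ C, f c * starSum f (insert j (C.erase c)) := by
  rw [starSum_eq_sum_first _ (Finset.insert_nonempty j C), Finset.sum_insert hj,
    Finset.erase_insert hj]
  congr 1
  refine Finset.sum_congr rfl fun c hc => ?_
  rw [Finset.erase_insert_of_ne (by rintro rfl; exact hj hc)]

theorem sum_erase_comm {M : Type*} [AddCommMonoid M] (A : Finset α) (G : α → α → M) :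
    ∑ a ∈ A, ∑ c ∈ A.erase a, G a c = ∑ c ∈ A, ∑ a ∈ A.erase c, G a c := by
  refine Finset.sum_comm' fun a c => ?_
  simp only [Finset.mem_erase]
  exact ⟨fun ⟨h1, h2, h3⟩ => ⟨⟨h2.symm, h1⟩, h3⟩, fun ⟨⟨h1, h2⟩, h3⟩ => ⟨h2, h1.symm, h3⟩⟩

theorem starSum_eq_sum_last (f : α → R) {A : Finset α} (hA : A.Nonempty) :
    starSum f A = ∑ a ∈ A, starSum f (A.erase a) * f a := by
  induction A using Finset.strongInduction with
  | H A ih =>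
    by_cases h1 : ∃ a, A = {a}
    · obtain ⟨a, rfl⟩ := h1
      rw [starSum_eq_sum_first _ hA]; simp [starSum_empty]
    have hne : ∀ a ∈ A, (A.erase a).Nonempty := by
      intro a ha
      by_contra h
      rw [Finset.not_nonempty_iff_eq_empty, Finset.erase_eq_empty_iff] at h
      exact h1 ⟨a, h.resolve_left hA.ne_empty⟩
    rw [starSum_eq_sum_first _ hA]
    calc ∑ a ∈ A, f a * starSum f (A.erase a)
        = ∑ a ∈ A, ∑ c ∈ A.erase a, f a * starSum f ((A.erase a).erase c) * f c := by
          refine Finset.sum_congr rfl fun a ha => ?_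
          rw [ih _ (Finset.erase_ssubset ha) (hne a ha), Finset.mul_sum]
          simp only [mul_assoc]
      _ = ∑ c ∈ A, ∑ a ∈ A.erase c, f a * starSum f ((A.erase a).erase c) * f c :=
          sum_erase_comm _ _
      _ = _ := by
          refine Finset.sum_congr rfl fun c hc => ?_
          rw [starSum_eq_sum_first _ (hne c hc), Finset.sum_mul]
          refine Finset.sum_congr rfl fun a _ => ?_
          rw [Finset.erase_right_comm]

theorem starSum_commute (f : α → R) (A : Finset α) (y : R)
    (h : ∀ a ∈ A, Commute y (f a)) : Commute y (starSum f A) := sortedSum_commute _ f A y h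

end SortedSum

end FominKirillov

/-! ### Quadratic relations and identities between stars -/

namespace FominKirillov

/-- A family satisfying the quadratic relations of the Fomin–Kirillov algebra. -/
structure IsDunklSystem {V R : Type*} [Ring R] (x : V → V → R) : Prop where
  skew : ∀ i j, x j i = - x i j
  diag : ∀ i, x i i = 0
  sq : ∀ i j, x i j * x i j = 0
  comm : ∀ i j k l, i ≠ k → i ≠ l → j ≠ k → j ≠ l → x i j * x k l = x k l * x i j
  triple : ∀ i j k, i ≠ j → j ≠ k → i ≠ k →
    x i j * x j k + x j k * x k i + x k i * x i j = 0

section Dunkl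

variable {V R : Type*} [Ring R] {x : V → V → R}

/-- The three-term relation on `y, c, j`, solved for the product of the two arrows into `j`. -/
theorem IsDunklSystem.mul_swap (hx : IsDunklSystem x) {c y j : V} (h1 : c ≠ y) (h2 : c ≠ j)
    (h3 : y ≠ j) : x c j * x y j = x y c * x c j - x y j * x y c := by
  have h := hx.triple y c j h1.symm h2 h3
  rw [hx.skew y j] at h
  simp only [mul_neg, neg_mul] at h
  rw [← sub_eq_zero, ← neg_eq_zero, ← h]; abel

theorem IsDunklSystem.mul_swap' (hx : IsDunklSystem x) {a b j : V} (h1 : a ≠ b) (h2 : a ≠ j)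
    (h3 : b ≠ j) : x a b * x j a = x j b * x a b - x a j * x j b := by
  have h := hx.triple b a j h1.symm h2 h3
  rw [hx.skew a b, hx.skew j a] at h
  rw [hx.skew j a]
  simp only [mul_neg, neg_mul, neg_neg] at h ⊢
  rw [← sub_eq_zero, ← h]; abel

variable [DecidableEq V]

/-- Each summand measures how far `x y c` is from intertwining the star on `C` with the star in
which `c` is replaced by `y`. When the first letter is `x c j`, expand the rest by induction and
move `x c j` past `x y j` with `mul_swap`; `x c j` commutes with `x y d` for `d ≠ c`. -/
theorem starSum_insert_rotate (hx : IsDunklSystem x) {j y : V} (hyj : y ≠ j) {C : Finset V}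
    (hyC : y ∉ C) (hjC : j ∉ C) :
    starSum (x · j) (insert y C) = x y j * starSum (x · j) C
      + ∑ c ∈ C, (x y c * starSum (x · j) C
        - starSum (x · j) (insert y (C.erase c)) * x y c) := by
  induction C using Finset.strongInduction with
  | H C ih =>
    have hne : ∀ c ∈ C, c ≠ y := fun c hc e => hyC (e ▸ hc)
    have hnj : ∀ c ∈ C, c ≠ j := fun c hc e => hjC (e ▸ hc)
    rcases C.eq_empty_or_nonempty with rfl | hC
    · rw [starSum_insert_first _ (Finset.notMem_empty y)]; simp
    rw [starSum_insert_first _ hyC]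
    congr 1
    have step : ∀ c ∈ C, x c j * starSum (x · j) (insert y (C.erase c))
        = x y c * (x c j * starSum (x · j) (C.erase c))
          - x y j * starSum (x · j) (C.erase c) * x y c
          + ∑ d ∈ C.erase c, (x y d * (x c j * starSum (x · j) (C.erase c))
            - x c j * starSum (x · j) (insert y ((C.erase c).erase d)) * x y d) := by
      intro c hc
      rw [ih _ (Finset.erase_ssubset hc) (fun h => hyC (Finset.mem_of_mem_erase h))
        (fun h => hjC (Finset.mem_of_mem_erase h)), mul_add, ← mul_assoc,
        hx.mul_swap (hne c hc) (hnj c hc) hyj, sub_mul, mul_assoc (x y c), Finset.mul_sum]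
      have hcomm : x y c * starSum (x · j) (C.erase c) = starSum (x · j) (C.erase c) * x y c := by
        refine starSum_commute _ _ _ fun a ha => ?_
        obtain ⟨h1, h2⟩ := Finset.mem_erase.1 ha
        exact hx.comm _ _ _ _ (hne a h2).symm hyj h1.symm (hnj c hc)
      rw [mul_assoc (x y j), hcomm]
      refine congrArg₂ (· + ·) (by simp only [mul_assoc]) ?_
      refine Finset.sum_congr rfl fun d hd => ?_
      obtain ⟨h1, h2⟩ := Finset.mem_erase.1 hd
      have hcd : x y d * x c j = x c j * x y d :=
        hx.comm _ _ _ _ (hne c hc).symm hyj h1 (hnj d h2)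
      rw [mul_sub, ← mul_assoc, ← hcd, mul_assoc, mul_assoc]
    rw [Finset.sum_congr rfl step]
    simp only [Finset.sum_add_distrib, Finset.sum_sub_distrib]
    rw [sum_erase_comm C fun c d => x y d * (x c j * starSum (x · j) (C.erase c)),
      sum_erase_comm C fun c d => x c j * starSum (x · j) (insert y ((C.erase c).erase d)) * x y d]
    have e1 : ∑ c ∈ C, x y c * (x c j * starSum (x · j) (C.erase c))
        + ∑ d ∈ C, ∑ c ∈ C.erase d, x y d * (x c j * starSum (x · j) (C.erase c))
        = ∑ c ∈ C, x y c * starSum (x · j) C := by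
      rw [← Finset.sum_add_distrib]
      refine Finset.sum_congr rfl fun d hd => ?_
      rw [← Finset.mul_sum, ← mul_add, starSum_eq_sum_first _ hC,
        Finset.add_sum_erase _ (fun c => x c j * starSum (x · j) (C.erase c)) hd]
    have e2 : ∑ c ∈ C, x y j * starSum (x · j) (C.erase c) * x y c
        + ∑ d ∈ C, ∑ c ∈ C.erase d,
          x c j * starSum (x · j) (insert y ((C.erase c).erase d)) * x y d
        = ∑ c ∈ C, starSum (x · j) (insert y (C.erase c)) * x y c := by
      rw [← Finset.sum_add_distrib]
      refine Finset.sum_congr rfl fun d hd => ?_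
      rw [starSum_insert_first _ (fun h => hyC (Finset.mem_of_mem_erase h)), add_mul,
        Finset.sum_mul]
      congr 1
      refine Finset.sum_congr rfl fun c _ => ?_
      rw [Finset.erase_right_comm]
    rw [← e1, ← e2]; abel

/-- The cyclic relation: words that run through all arrows into `j` and return to the first one sum
to zero. For two letters this is the relation aba + bab = 0. Single out `y`: the term starting at
`y` is opened at its last letter, the others by rotation. The rest regroups into the relation for
`B`, multiplied on the left by `x y d`, and for `insert y (B.erase d)`, multiplied on the right by
`x y d`. -/
theorem sum_mul_starSum_mul (hx : IsDunklSystem x) {j : V} {A : Finset V} (hjA : j ∉ A) :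
    ∑ a ∈ A, x a j * starSum (x · j) (A.erase a) * x a j = 0 := by
  induction h : A.card generalizing A with
  | zero => rw [Finset.card_eq_zero.1 h]; simp
  | succ n ih =>
    obtain ⟨y, B, hyB, rfl, hB⟩ := Finset.card_eq_succ.1 h
    have hyj : y ≠ j := fun e => hjA (by simp [e])
    have hjB : j ∉ B := fun h => hjA (by simp [h])
    have hne : ∀ c ∈ B, c ≠ y := fun c hc e => hyB (e ▸ hc)
    have hnj : ∀ c ∈ B, c ≠ j := fun c hc e => hjB (e ▸ hc)
    rcases B.eq_empty_or_nonempty with rfl | hBne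
    · simp [starSum_empty, hx.sq]
    rw [Finset.sum_insert hyB, Finset.erase_insert hyB]
    have hcomm : ∀ c ∈ B, x y c * starSum (x · j) (B.erase c)
        = starSum (x · j) (B.erase c) * x y c := fun c hc => by
      refine starSum_commute _ _ _ fun a ha => ?_
      obtain ⟨h1, h2⟩ := Finset.mem_erase.1 ha
      exact hx.comm _ _ _ _ (hne a h2).symm hyj h1.symm (hnj c hc)
    have s1 : x y j * starSum (x · j) B * x y j
        = ∑ c ∈ B, (x y j * starSum (x · j) (B.erase c) * (x y c * x c j)
          - x y j * starSum (x · j) (B.erase c) * x y j * x y c) := by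
      rw [starSum_eq_sum_last _ hBne, Finset.mul_sum, Finset.sum_mul]
      refine Finset.sum_congr rfl fun c hc => ?_
      rw [← mul_assoc, mul_assoc, hx.mul_swap (hne c hc) (hnj c hc) hyj, mul_sub, mul_assoc,
        mul_assoc, mul_assoc, mul_assoc]
    have s2 : ∀ c ∈ B, x c j * starSum (x · j) ((insert y B).erase c) * x c j
        = x y c * (x c j * starSum (x · j) (B.erase c) * x c j)
          - x y j * starSum (x · j) (B.erase c) * (x y c * x c j)
          + ∑ d ∈ B.erase c, (x y d * (x c j * starSum (x · j) (B.erase c) * x c j)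
            - x c j * starSum (x · j) (insert y ((B.erase c).erase d)) * x c j * x y d) := by
      intro c hc
      rw [Finset.erase_insert_of_ne (hne c hc).symm, starSum_insert_rotate hx hyj
        (fun h => hyB (Finset.mem_of_mem_erase h)) (fun h => hjB (Finset.mem_of_mem_erase h)),
        mul_add, add_mul, ← mul_assoc, hx.mul_swap (hne c hc) (hnj c hc) hyj, sub_mul, sub_mul,
        Finset.mul_sum, Finset.sum_mul]
      congr 1
      · rw [mul_assoc (x y j), hcomm c hc]; simp only [mul_assoc]
      · refine Finset.sum_congr rfl fun d hd => ?_
        obtain ⟨h1, h2⟩ := Finset.mem_erase.1 hd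
        have hcd : x y d * x c j = x c j * x y d :=
          hx.comm _ _ _ _ (hne c hc).symm hyj h1 (hnj d h2)
        rw [mul_sub, sub_mul, ← mul_assoc, ← hcd]
        simp only [mul_assoc]
        rw [hcd]
    rw [s1, Finset.sum_congr rfl s2]
    simp only [Finset.sum_add_distrib, Finset.sum_sub_distrib]
    rw [sum_erase_comm B fun c d => x y d * (x c j * starSum (x · j) (B.erase c) * x c j),
      sum_erase_comm B fun c d =>
        x c j * starSum (x · j) (insert y ((B.erase c).erase d)) * x c j * x y d]
    have e1 : ∑ c ∈ B, x y c * (x c j * starSum (x · j) (B.erase c) * x c j)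
        + ∑ d ∈ B, ∑ c ∈ B.erase d, x y d * (x c j * starSum (x · j) (B.erase c) * x c j)
        = 0 := by
      rw [← Finset.sum_add_distrib]
      refine Finset.sum_eq_zero fun d hd => ?_
      rw [← Finset.mul_sum, ← mul_add,
        Finset.add_sum_erase _ (fun c => x c j * starSum (x · j) (B.erase c) * x c j) hd,
        ih hjB hB, mul_zero]
    have e2 : ∑ c ∈ B, x y j * starSum (x · j) (B.erase c) * x y j * x y c
        + ∑ d ∈ B, ∑ c ∈ B.erase d,
          x c j * starSum (x · j) (insert y ((B.erase c).erase d)) * x c j * x y d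
        = 0 := by
      rw [← Finset.sum_add_distrib]
      refine Finset.sum_eq_zero fun d hd => ?_
      have hy' : y ∉ B.erase d := fun h => hyB (Finset.mem_of_mem_erase h)
      have := ih (A := insert y (B.erase d))
        (by simp [hyj.symm, hjB]) (by
          rw [Finset.card_insert_of_notMem hy', Finset.card_erase_add_one hd, hB])
      rw [Finset.sum_insert hy', Finset.erase_insert hy'] at this
      rw [← Finset.sum_mul, ← add_mul, ← zero_mul (x y d), ← this]
      congr 2
      refine Finset.sum_congr rfl fun c hc => ?_
      obtain ⟨h1, h2⟩ := Finset.mem_erase.1 hc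
      rw [Finset.erase_right_comm, Finset.erase_insert_of_ne (hne c h2).symm]
    refine Eq.trans ?_ ((congrArg₂ (· - ·) e1 e2).trans (sub_zero 0))
    abel

/-- Peel off the first letter `d`. By induction the remaining star kills the sum over all other `a`,
so only `a = d` survives, which is the cyclic relation. -/
theorem sum_starSum_mul (hx : IsDunklSystem x) {j : V} {A : Finset V} (hjA : j ∉ A) :
    ∑ a ∈ A, starSum (x · j) A * x a j = 0 := by
  induction A using Finset.strongInduction with
  | H A ih =>
    rcases A.eq_empty_or_nonempty with rfl | hA
    · simp
    rw [← Finset.mul_sum, starSum_eq_sum_first _ hA, Finset.sum_mul]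
    have : ∀ d ∈ A, x d j * starSum (x · j) (A.erase d) * ∑ a ∈ A, x a j
        = x d j * starSum (x · j) (A.erase d) * x d j := by
      intro d hd
      rw [← Finset.add_sum_erase A (fun a => x a j) hd, mul_add, mul_assoc (x d j) _ (∑ a ∈ _, _),
        Finset.mul_sum, ih _ (Finset.erase_ssubset hd) (fun h => hjA (Finset.mem_of_mem_erase h)),
        mul_zero, add_zero]
    rw [Finset.sum_congr rfl this, sum_mul_starSum_mul hx hjA]

/-- Carries the part of the Dunkl element of `j` that meets `B ∪ {b}` through a star centred at `b`.
The main term attaches `j` to the star; the corrections, headed by `x a j`, later cancel against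
stars centred at `j`. -/
theorem starSum_mul_sum (hx : IsDunklSystem x) {j b : V} (hjb : j ≠ b) {B : Finset V}
    (hbB : b ∉ B) (hjB : j ∉ B) :
    starSum (x · b) B * (x j b + ∑ a ∈ B, x j a) = starSum (x · b) (insert j B)
      - ∑ a ∈ B, x a j * starSum (x · b) (insert j (B.erase a)) := by
  induction B using Finset.strongInduction with
  | H B ih =>
    have hne : ∀ c ∈ B, c ≠ b := fun c hc e => hbB (e ▸ hc)
    have hnj : ∀ c ∈ B, c ≠ j := fun c hc e => hjB (e ▸ hc)
    rcases B.eq_empty_or_nonempty with rfl | hB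
    · rw [starSum_insert_first _ (by simp)]; simp [starSum_empty]
    have step : ∀ c ∈ B, x c b * starSum (x · b) (B.erase c) * (x j b + ∑ a ∈ B, x j a)
        = x c b * starSum (x · b) (insert j (B.erase c))
          - (∑ a ∈ B.erase c, x a j * (x c b * starSum (x · b) (insert j ((B.erase c).erase a))))
          + x j b * (x c b * starSum (x · b) (B.erase c))
          - x c j * (x j b * starSum (x · b) (B.erase c)) := by
      intro c hc
      have hcomm : x j c * starSum (x · b) (B.erase c) = starSum (x · b) (B.erase c) * x j c := by
        refine starSum_commute _ _ _ fun a ha => ?_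
        obtain ⟨h1, h2⟩ := Finset.mem_erase.1 ha
        exact hx.comm _ _ _ _ (hnj a h2).symm hjb h1.symm (hne c hc)
      rw [← Finset.add_sum_erase B (fun a => x j a) hc, add_left_comm, mul_add, mul_assoc,
        ← hcomm, ← mul_assoc, hx.mul_swap' (hne c hc) (hnj c hc) hjb.symm, mul_assoc (x c b),
        ih _ (Finset.erase_ssubset hc) (fun h => hbB (Finset.mem_of_mem_erase h))
        (fun h => hjB (Finset.mem_of_mem_erase h)), mul_sub, sub_mul, Finset.mul_sum]
      have : ∀ a ∈ B.erase c, x c b * (x a j * starSum (x · b) (insert j ((B.erase c).erase a)))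
          = x a j * (x c b * starSum (x · b) (insert j ((B.erase c).erase a))) := by
        intro a ha
        obtain ⟨h1, h2⟩ := Finset.mem_erase.1 ha
        rw [← mul_assoc, hx.comm c b a j h1.symm (hnj c hc) (hne a h2).symm hjb.symm, mul_assoc]
      rw [Finset.sum_congr rfl this]
      simp only [mul_assoc]
      abel
    nth_rewrite 1 [starSum_eq_sum_first _ hB]
    rw [Finset.sum_mul, Finset.sum_congr rfl step]
    simp only [Finset.sum_add_distrib, Finset.sum_sub_distrib]
    rw [sum_erase_comm B fun c a =>
      x a j * (x c b * starSum (x · b) (insert j ((B.erase c).erase a))),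
      ← Finset.mul_sum, ← starSum_eq_sum_first _ hB]
    have e1 : ∑ a ∈ B, ∑ c ∈ B.erase a,
          x a j * (x c b * starSum (x · b) (insert j ((B.erase c).erase a)))
        + ∑ a ∈ B, x a j * (x j b * starSum (x · b) (B.erase a))
        = ∑ a ∈ B, x a j * starSum (x · b) (insert j (B.erase a)) := by
      rw [← Finset.sum_add_distrib]
      refine Finset.sum_congr rfl fun a _ => ?_
      rw [starSum_insert_first _ (fun h => hjB (Finset.mem_of_mem_erase h)), mul_add,
        Finset.mul_sum, add_comm]
      congr 1
      refine Finset.sum_congr rfl fun c _ => ?_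
      rw [Finset.erase_right_comm]
    rw [← e1, starSum_insert_first _ hjB]
    abel

end Dunkl

end FominKirillov

/-! ### Column sums and the factor 1 + θ_j -/

namespace FominKirillov

section PowersetSums

variable {V M : Type*} [DecidableEq V] [AddCommMonoid M]

theorem sum_powerset_erase (C : Finset V) (G : Finset V → V → M) :
    ∑ A ∈ C.powerset, ∑ a ∈ A, G (A.erase a) a = ∑ A ∈ C.powerset, ∑ a ∈ C \ A, G A a := by
  rw [Finset.sum_sigma', Finset.sum_sigma']
  refine Finset.sum_bij' (fun p _ => ⟨p.1.erase p.2, p.2⟩) (fun p _ => ⟨insert p.2 p.1, p.2⟩)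
    ?_ ?_ ?_ ?_ ?_
  · rintro ⟨A, a⟩ h
    simp only [Finset.mem_sigma, Finset.mem_powerset, Finset.mem_sdiff] at h ⊢
    exact ⟨(Finset.erase_subset _ _).trans h.1, h.1 h.2, Finset.notMem_erase _ _⟩
  · rintro ⟨A, a⟩ h
    simp only [Finset.mem_sigma, Finset.mem_powerset, Finset.mem_sdiff] at h ⊢
    exact ⟨Finset.insert_subset h.2.1 h.1, Finset.mem_insert_self _ _⟩
  · rintro ⟨A, a⟩ h
    simp only [Finset.mem_sigma] at h
    simp [Finset.insert_erase h.2]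
  · rintro ⟨A, a⟩ h
    simp only [Finset.mem_sigma, Finset.mem_sdiff] at h
    simp [Finset.erase_insert h.2.2]
  · rintro ⟨A, a⟩ _; rfl

theorem sum_powerset_sdiff_comm (I : Finset V) (G : Finset V → Finset V → M) :
    ∑ A ∈ I.powerset, ∑ B ∈ (I \ A).powerset, G A B
      = ∑ B ∈ I.powerset, ∑ A ∈ (I \ B).powerset, G A B := by
  refine Finset.sum_comm' fun A B => ?_
  simp only [Finset.mem_powerset, Finset.subset_sdiff]
  exact ⟨fun ⟨h1, h2, h3⟩ => ⟨⟨h1, h3.symm⟩, h2⟩, fun ⟨⟨h1, h2⟩, h3⟩ => ⟨h1, h3, h2.symm⟩⟩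

theorem sum_powerset_sdiff_union (I : Finset V) (G : Finset V → Finset V → M) :
    ∑ B ∈ I.powerset, ∑ A ∈ (I \ B).powerset, G A B
      = ∑ C ∈ I.powerset, ∑ B ∈ C.powerset, G (C \ B) B := by
  rw [Finset.sum_sigma', Finset.sum_sigma']
  refine Finset.sum_bij' (fun p _ => ⟨p.1 ∪ p.2, p.1⟩) (fun p _ => ⟨p.2, p.1 \ p.2⟩)
    ?_ ?_ ?_ ?_ ?_
  · rintro ⟨B, A⟩ h
    simp only [Finset.mem_sigma, Finset.mem_powerset, Finset.subset_sdiff] at h ⊢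
    exact ⟨Finset.union_subset h.1 h.2.1, Finset.subset_union_left⟩
  · rintro ⟨C, B⟩ h
    simp only [Finset.mem_sigma, Finset.mem_powerset, Finset.subset_sdiff] at h ⊢
    exact ⟨h.2.trans h.1, Finset.sdiff_subset.trans h.1, Finset.sdiff_disjoint⟩
  · rintro ⟨B, A⟩ h
    simp only [Finset.mem_sigma, Finset.mem_powerset, Finset.subset_sdiff] at h
    simp [Finset.union_sdiff_cancel_left h.2.2.symm]
  · rintro ⟨C, B⟩ h
    simp only [Finset.mem_sigma, Finset.mem_powerset] at h
    simp [Finset.union_sdiff_of_subset h.2]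
  · rintro ⟨B, A⟩ h
    simp only [Finset.mem_sigma, Finset.mem_powerset, Finset.subset_sdiff] at h
    simp [Finset.union_sdiff_cancel_left h.2.2.symm]

end PowersetSums

section ColumnSum

variable {ι κ R : Type*} [DecidableEq ι] [Ring R]

/-- The sum of the products of stars over all ways to distribute a subset of `I` over the list of
columns `J`. -/
def columnSum (f : ι → κ → R) : Finset ι → List κ → R
  | _, [] => 1
  | I, b :: J => ∑ A ∈ I.powerset, starSum (f · b) A * columnSum f (I \ A) J

theorem columnSum_nil (f : ι → κ → R) (I : Finset ι) : columnSum f I [] = 1 := by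
  rw [columnSum]

theorem columnSum_cons (f : ι → κ → R) (I : Finset ι) (b : κ) (J : List κ) :
    columnSum f I (b :: J)
      = ∑ A ∈ I.powerset, starSum (f · b) A * columnSum f (I \ A) J := by
  rw [columnSum]

theorem columnSum_empty (f : ι → κ → R) (J : List κ) : columnSum f ∅ J = 1 := by
  induction J with
  | nil => rw [columnSum_nil]
  | cons b J ih => rw [columnSum_cons]; simp [starSum_empty, ih]

theorem columnSum_commute (f : ι → κ → R) (y : R) (J : List κ) (I : Finset ι)
    (h : ∀ i ∈ I, ∀ b ∈ J, Commute y (f i b)) : Commute y (columnSum f I J) := by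
  induction J generalizing I with
  | nil => rw [columnSum_nil]; exact Commute.one_right _
  | cons b J ih =>
    rw [columnSum_cons]
    refine Commute.sum_right _ _ _ fun A hA => Commute.mul_right ?_ ?_
    · exact starSum_commute _ _ _ fun a ha => h a (Finset.mem_powerset.1 hA ha) b (by simp)
    · exact ih _ fun i hi c hc => h i (Finset.mem_sdiff.1 hi).1 c (by simp [hc])

end ColumnSum

section Pieri

variable {V R : Type*} [DecidableEq V] [Ring R] {x : V → V → R}

/-- A telescoping sum over `B`. After `starSum_mul_sum`, the corrections coming from the sets
`insert a B` form the last-letter expansion of the star on `C \ B` at `j`, and cancel the main term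
of `B`. Only `B = C` remains. -/
theorem sum_starSum_mul_starSum (hx : IsDunklSystem x) {j b : V} (hjb : j ≠ b) {C : Finset V}
    (hbC : b ∉ C) (hjC : j ∉ C) :
    ∑ B ∈ C.powerset, starSum (x · j) (C \ B) * (starSum (x · b) B * (x j b + ∑ a ∈ B, x j a))
      = starSum (x · b) (insert j C) := by
  have h1 : ∀ B ∈ C.powerset,
      starSum (x · j) (C \ B) * (starSum (x · b) B * (x j b + ∑ a ∈ B, x j a))
      = starSum (x · j) (C \ B) * starSum (x · b) (insert j B)
        - ∑ a ∈ B, starSum (x · j) ((C \ B.erase a).erase a) * x a j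
            * starSum (x · b) (insert j (B.erase a)) := by
    intro B hB
    have hBC := Finset.mem_powerset.1 hB
    rw [starSum_mul_sum hx hjb (fun h => hbC (hBC h)) (fun h => hjC (hBC h)), mul_sub,
      Finset.mul_sum]
    congr 1
    refine Finset.sum_congr rfl fun a ha => ?_
    have : (C \ B.erase a).erase a = C \ B := by
      ext c
      simp only [Finset.mem_erase, Finset.mem_sdiff]
      by_cases hc : c = a
      · subst hc; simp [ha]
      · simp [hc]
    rw [this, mul_assoc]
  rw [Finset.sum_congr rfl h1, Finset.sum_sub_distrib,
    sum_powerset_erase C fun B a => starSum (x · j) ((C \ B).erase a) * x a j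
      * starSum (x · b) (insert j B), ← Finset.sum_sub_distrib,
    Finset.sum_eq_single_of_mem C (Finset.mem_powerset_self C)]
  · simp [starSum_empty]
  · intro B hB hBC
    have hne : (C \ B).Nonempty := by
      rw [Finset.sdiff_nonempty]
      exact fun h => hBC (Finset.Subset.antisymm (Finset.mem_powerset.1 hB) h)
    rw [← Finset.sum_mul, ← starSum_eq_sum_last _ hne, sub_self]

/-- The case where `j` is the only column. A factor `x j a` with `a` in the star is killed by
`sum_starSum_mul`. With `a` outside the star it gives, up to sign, the last-letter expansion of a
larger star, so everything but the empty star cancels. -/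
theorem sum_starSum_mul_one_add (hx : IsDunklSystem x) {j : V} {I : Finset V} (hjI : j ∉ I) :
    (∑ A ∈ I.powerset, starSum (x · j) A) * (1 + ∑ i ∈ I, x j i) = 1 := by
  have h1 : ∀ A ∈ I.powerset, starSum (x · j) A * (1 + ∑ i ∈ I, x j i)
      = starSum (x · j) A + ∑ a ∈ I \ A, starSum (x · j) A * x j a := by
    intro A hA
    have hAI := Finset.mem_powerset.1 hA
    rw [← Finset.sum_sdiff hAI, mul_add, mul_one, mul_add, Finset.mul_sum, Finset.mul_sum]
    have : ∑ a ∈ A, starSum (x · j) A * x j a = 0 := by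
      rw [← neg_eq_zero, ← Finset.sum_neg_distrib,
        ← sum_starSum_mul hx (fun h => hjI (hAI h) : j ∉ A)]
      exact Finset.sum_congr rfl fun a _ => by rw [hx.skew a j, mul_neg, neg_neg]
    rw [this, add_zero]
  rw [Finset.sum_mul, Finset.sum_congr rfl h1, Finset.sum_add_distrib,
    ← sum_powerset_erase I fun A a => starSum (x · j) A * x j a, ← Finset.sum_add_distrib,
    Finset.sum_eq_single_of_mem ∅ (Finset.empty_mem_powerset I)]
  · simp [starSum_empty]
  · intro A _ hA
    nth_rewrite 1 [starSum_eq_sum_last _ (Finset.nonempty_iff_ne_empty.2 hA)]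
    rw [← Finset.sum_add_distrib]
    refine Finset.sum_eq_zero fun a _ => ?_
    rw [hx.skew a j, mul_neg, add_neg_cancel]

/-- Turning the column `j` into a row multiplies by 1 + θ_j. In the induction over the columns, look
at the set attached to the first column `b`. If it omits `j`, the inductive hypothesis gives θ_j
without the terms for `b` and for `B`. If it contains `j`, `sum_starSum_mul_starSum` supplies
exactly these missing terms. -/
theorem columnSum_insert (hx : IsDunklSystem x) {j : V} (J : List V) {I : Finset V}
    (hjI : j ∉ I) (hjJ : j ∉ J) (hJ : J.Nodup) (hIJ : ∀ b ∈ J, b ∉ I) :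
    columnSum x (insert j I) J
      = columnSum x I (j :: J) * (1 + (∑ i ∈ I, x j i + (J.map (x j)).sum)) := by
  induction J generalizing I with
  | nil =>
    rw [columnSum_nil, columnSum_cons]
    simp only [columnSum_nil, mul_one, List.map_nil, List.sum_nil, add_zero]
    rw [sum_starSum_mul_one_add hx hjI]
  | cons b J ih =>
    rw [List.nodup_cons] at hJ
    rw [List.mem_cons, not_or] at hjJ
    have hbI : b ∉ I := hIJ b (by simp)
    have hJI : ∀ c ∈ J, c ∉ I := fun c hc => hIJ c (by simp [hc])
    have hcomm : ∀ A ⊆ I, ∀ B ⊆ I, Disjoint A B →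
        Commute (starSum (x · j) A) (starSum (x · b) B) := by
      intro A hA B hB hAB
      refine starSum_commute _ _ _ fun c hc => (starSum_commute _ _ _ fun a ha => ?_).symm
      exact hx.comm _ _ _ _ (fun e => Finset.disjoint_left.1 hAB ha (e ▸ hc))
        (fun e => hjI (e ▸ hB hc)) (fun e => hbI (e ▸ hA ha)) (Ne.symm hjJ.1)
    have hexp : columnSum x I (j :: b :: J)
        = ∑ B ∈ I.powerset, starSum (x · b) B * columnSum x (I \ B) (j :: J) := by
      rw [columnSum_cons]
      simp only [columnSum_cons, Finset.mul_sum]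
      rw [sum_powerset_sdiff_comm I fun A B => starSum (x · j) A
        * (starSum (x · b) B * columnSum x ((I \ A) \ B) J)]
      refine Finset.sum_congr rfl fun B hB => Finset.sum_congr rfl fun A hA => ?_
      rw [Finset.mem_powerset] at hA hB
      rw [Finset.subset_sdiff] at hA
      rw [← mul_assoc, (hcomm A hA.1 B hB hA.2).eq, mul_assoc, sdiff_sdiff_comm]
    have hL : columnSum x (insert j I) (b :: J)
        = ∑ B ∈ I.powerset, starSum (x · b) B * columnSum x (insert j (I \ B)) J
          + ∑ B ∈ I.powerset, starSum (x · b) (insert j B) * columnSum x (I \ B) J := by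
      rw [columnSum_cons, Finset.sum_powerset_insert hjI]
      congr 1
      · refine Finset.sum_congr rfl fun B hB => ?_
        rw [Finset.insert_sdiff_of_notMem _ (fun h => hjI (Finset.mem_powerset.1 hB h))]
      · refine Finset.sum_congr rfl fun B hB => ?_
        rw [Finset.insert_sdiff_insert, Finset.sdiff_insert_of_notMem hjI]
    have hR : ∑ B ∈ I.powerset, starSum (x · b) (insert j B) * columnSum x (I \ B) J
        = ∑ B ∈ I.powerset, starSum (x · b) B * columnSum x (I \ B) (j :: J)
          * (x j b + ∑ a ∈ B, x j a) := by
      have : ∀ B ∈ I.powerset, starSum (x · b) B * columnSum x (I \ B) (j :: J)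
          * (x j b + ∑ a ∈ B, x j a)
          = ∑ A ∈ (I \ B).powerset, starSum (x · j) A *
            (starSum (x · b) B * (x j b + ∑ a ∈ B, x j a)) * columnSum x (I \ (B ∪ A)) J := by
        intro B hB
        rw [Finset.mem_powerset] at hB
        rw [columnSum_cons, Finset.mul_sum, Finset.sum_mul]
        refine Finset.sum_congr rfl fun A hA => ?_
        rw [Finset.mem_powerset, Finset.subset_sdiff] at hA
        -- The remaining columns and rows involve none of `j`, `b` and `B`, so the new factor can be
        -- moved next to the two stars.
        have hc : Commute (x j b + ∑ a ∈ B, x j a) (columnSum x ((I \ B) \ A) J) := by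
          refine Commute.add_left ?_ (Commute.sum_left _ _ _ fun a ha => ?_)
          · refine columnSum_commute _ _ _ _ fun i hi c hc => ?_
            simp only [Finset.mem_sdiff] at hi
            exact hx.comm _ _ _ _ (fun e => hjI (e ▸ hi.1.1)) (fun e => hjJ.2 (e ▸ hc))
              (fun e => hbI (e ▸ hi.1.1)) (fun e => hJ.1 (e ▸ hc))
          · refine columnSum_commute _ _ _ _ fun i hi c hc => ?_
            simp only [Finset.mem_sdiff] at hi
            exact hx.comm _ _ _ _ (fun e => hjI (e ▸ hi.1.1)) (fun e => hjJ.2 (e ▸ hc))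
              (fun e => hi.1.2 (e ▸ ha)) (fun e => hJI c hc (e ▸ hB ha))
        rw [← mul_assoc, mul_assoc, ← hc.eq, ← (hcomm A hA.1 B hB hA.2).eq, sdiff_sdiff_left, Finset.sup_eq_union]
        simp only [mul_assoc]
      rw [Finset.sum_congr rfl this, sum_powerset_sdiff_union I fun A B => starSum (x · j) A *
            (starSum (x · b) B * (x j b + ∑ a ∈ B, x j a)) * columnSum x (I \ (B ∪ A)) J]
      refine Finset.sum_congr rfl fun C hC => ?_
      rw [Finset.mem_powerset] at hC
      rw [← sum_starSum_mul_starSum hx hjJ.1 (fun h => hbI (hC h)) (fun h => hjI (hC h)),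
        Finset.sum_mul]
      refine Finset.sum_congr rfl fun B hB => ?_
      rw [Finset.union_sdiff_of_subset (Finset.mem_powerset.1 hB)]
    rw [hL, hR, hexp, Finset.sum_mul, ← Finset.sum_add_distrib]
    refine Finset.sum_congr rfl fun B hB => ?_
    rw [Finset.mem_powerset] at hB
    rw [ih (fun h => hjI (Finset.mem_sdiff.1 h).1) hjJ.2 hJ.2
      (fun c hc h => hJI c hc (Finset.mem_sdiff.1 h).1), ← mul_assoc, ← mul_add,
      List.map_cons, List.sum_cons, ← Finset.sum_sdiff hB]
    congr 1
    abel

end Pieri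

end FominKirillov

/-! ### Grading and the Pieri formulas -/

namespace FominKirillov

section ListSymm

/-- The elementary symmetric polynomials of the entries of a list. -/
def listESymm {R : Type*} [Semiring R] : List R → ℕ → R
  | _, 0 => 1
  | [], _ + 1 => 0
  | a :: l, r + 1 => listESymm l (r + 1) + listESymm l r * a

/-- The complete homogeneous symmetric polynomials of the entries of a list. -/
def listHSymm {R : Type*} [Semiring R] : List R → ℕ → R
  | _, 0 => 1
  | [], _ + 1 => 0
  | a :: l, r + 1 => listHSymm l (r + 1) + listHSymm (a :: l) r * a

variable {R : Type*} [Semiring R]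

theorem listESymm_zero (l : List R) : listESymm l 0 = 1 := by cases l <;> rw [listESymm]

theorem listESymm_nil (r : ℕ) : listESymm ([] : List R) (r + 1) = 0 := by rw [listESymm]

theorem listESymm_cons (a : R) (l : List R) (r : ℕ) :
    listESymm (a :: l) (r + 1) = listESymm l (r + 1) + listESymm l r * a := by rw [listESymm]

theorem listHSymm_zero (l : List R) : listHSymm l 0 = 1 := by cases l <;> rw [listHSymm]

theorem listHSymm_nil (r : ℕ) : listHSymm ([] : List R) (r + 1) = 0 := by rw [listHSymm]

theorem listHSymm_cons (a : R) (l : List R) (r : ℕ) :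
    listHSymm (a :: l) (r + 1) = listHSymm l (r + 1) + listHSymm (a :: l) r * a := by
  rw [listHSymm]

theorem listESymm_of_length_lt (l : List R) (r : ℕ) (h : l.length < r) : listESymm l r = 0 := by
  induction l generalizing r with
  | nil => cases r with
    | zero => simp at h
    | succ r => rw [listESymm_nil]
  | cons a l ih => cases r with
    | zero => simp at h
    | succ r =>
      simp only [List.length_cons] at h
      rw [listESymm_cons, ih _ (by omega), ih _ (by omega), zero_mul, add_zero]

theorem listESymm_length (l : List R) : listESymm l l.length = l.reverse.prod := by
  induction l with
  | nil => simp [listESymm_zero]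
  | cons a l ih =>
    rw [List.length_cons, listESymm_cons, listESymm_of_length_lt _ _ (Nat.lt_succ_self _), ih]
    simp

theorem map_listESymm {R' : Type*} [Semiring R'] (φ : R →+* R') (l : List R) (r : ℕ) :
    φ (listESymm l r) = listESymm (l.map φ) r := by
  induction l generalizing r with
  | nil => cases r <;> simp [listESymm_zero, listESymm_nil]
  | cons a l ih => cases r <;> simp [listESymm_zero, listESymm_cons, ih]

theorem map_listHSymm {R' : Type*} [Semiring R'] (φ : R →+* R') (l : List R) (r : ℕ) :
    φ (listHSymm l r) = listHSymm (l.map φ) r := by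
  induction l generalizing r with
  | nil => cases r <;> simp [listHSymm_zero, listHSymm_nil]
  | cons a l ih =>
    induction r with
    | zero => simp [listHSymm_zero]
    | succ r ihr => rw [listHSymm_cons, map_add, map_mul, ih, ihr, List.map_cons, listHSymm_cons]

end ListSymm

section Graded

open Polynomial

variable {ι κ R : Type*} [DecidableEq ι] [Ring R]

/-- The part of degree `r` of `columnSum`. -/
noncomputable def columnSumDeg (f : ι → κ → R) (I : Finset ι) (J : List κ) (r : ℕ) : R :=
  (columnSum (fun i b => C (f i b) * X) I J).coeff r

theorem columnSumDeg_empty (f : ι → κ → R) (J : List κ) (r : ℕ) :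
    columnSumDeg f ∅ J r = if r = 0 then 1 else 0 := by
  rw [columnSumDeg, columnSum_empty, Polynomial.coeff_one]

theorem columnSumDeg_nil (f : ι → κ → R) (I : Finset ι) (r : ℕ) :
    columnSumDeg f I [] r = if r = 0 then 1 else 0 := by
  rw [columnSumDeg, columnSum_nil, Polynomial.coeff_one]

/-- The relations are homogeneous, so a central variable may mark the degree. This replaces a
grading on the algebra itself. -/
theorem IsDunklSystem.scale {V : Type*} {x : V → V → R} (hx : IsDunklSystem x) :
    IsDunklSystem fun i j => (C (x i j) * X : R[X]) := by
  have hm : ∀ a b : R, (C a * X * (C b * X) : R[X]) = C (a * b) * X ^ 2 := fun a b => by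
    rw [C_mul, mul_assoc, ← mul_assoc X, (commute_X (C b)).eq, pow_two]
    simp only [mul_assoc]
  refine ⟨fun i j => ?_, fun i => ?_, fun i j => ?_, fun i j k l h1 h2 h3 h4 => ?_,
    fun i j k h1 h2 h3 => ?_⟩
  · rw [hx.skew i j, C_neg, neg_mul]
  · rw [hx.diag, C_0, zero_mul]
  · rw [hm, hx.sq, C_0, zero_mul]
  · rw [hm, hm, hx.comm i j k l h1 h2 h3 h4]
  · rw [hm, hm, hm, ← add_mul, ← add_mul, ← C_add, ← C_add, hx.triple i j k h1 h2 h3, C_0,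
      zero_mul]

end Graded

section Pieri

open Polynomial

variable {V R : Type*} [DecidableEq V] [Ring R] {x : V → V → R}

/-- The Dunkl element `∑_{w ∈ S} x_{vw}` relative to the vertex set `S`. -/
def localDunkl (x : V → V → R) (S : Finset V) (v : V) : R := ∑ w ∈ S, x v w

theorem columnSum_insert_scale (hx : IsDunklSystem x) {j : V} (J : List V) {I : Finset V}
    (hjI : j ∉ I) (hjJ : j ∉ J) (hJ : J.Nodup) (hIJ : ∀ b ∈ J, b ∉ I) :
    columnSum (fun i b => (C (x i b) * X : R[X])) (insert j I) J
      = columnSum (fun i b => C (x i b) * X) I (j :: J)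
        * (1 + C (localDunkl x (insert j (I ∪ J.toFinset)) j) * X) := by
  rw [columnSum_insert hx.scale J hjI hjJ hJ hIJ]
  congr 2
  have hd : Disjoint I J.toFinset :=
    Finset.disjoint_right.2 fun b hb => hIJ b (List.mem_toFinset.1 hb)
  rw [localDunkl, Finset.sum_insert (by simp [hjI, hjJ]), hx.diag, zero_add, Finset.sum_union hd,
    List.sum_toFinset _ hJ, C_add, add_mul, map_sum, Finset.sum_mul, map_list_sum, List.map_map,
    ← List.sum_map_mul_right]
  rfl

theorem columnSumDeg_zero (hx : IsDunklSystem x) {j : V} (J : List V) {I : Finset V}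
    (hjI : j ∉ I) (hjJ : j ∉ J) (hJ : J.Nodup) (hIJ : ∀ b ∈ J, b ∉ I) :
    columnSumDeg x (insert j I) J 0 = columnSumDeg x I (j :: J) 0 := by
  rw [columnSumDeg, columnSum_insert_scale hx J hjI hjJ hJ hIJ, mul_add, mul_one, ← mul_assoc,
    coeff_add, mul_coeff_zero, coeff_X_zero, mul_zero, add_zero, columnSumDeg]

theorem columnSumDeg_succ (hx : IsDunklSystem x) {j : V} (J : List V) {I : Finset V}
    (hjI : j ∉ I) (hjJ : j ∉ J) (hJ : J.Nodup) (hIJ : ∀ b ∈ J, b ∉ I) (r : ℕ) :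
    columnSumDeg x (insert j I) J (r + 1) = columnSumDeg x I (j :: J) (r + 1)
      + columnSumDeg x I (j :: J) r * localDunkl x (insert j (I ∪ J.toFinset)) j := by
  rw [columnSumDeg, columnSum_insert_scale hx J hjI hjJ hJ hIJ, mul_add, mul_one, ← mul_assoc,
    coeff_add, coeff_mul_X, coeff_mul_C, columnSumDeg, columnSumDeg]

/-- The Pieri formula for elementary symmetric polynomials in Dunkl elements. -/
theorem columnSumDeg_eq_listESymm (hx : IsDunklSystem x) (S : Finset V) (L J : List V)
    (hL : L.Nodup) (hJ : J.Nodup) (hLJ : ∀ b ∈ J, b ∉ L) (hS : L.toFinset ∪ J.toFinset = S)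
    (r : ℕ) : columnSumDeg x L.toFinset J r = listESymm (L.map (localDunkl x S)) r := by
  induction L generalizing J r with
  | nil =>
    rw [List.toFinset_nil, columnSumDeg_empty]
    cases r <;> simp [listESymm_zero, listESymm_nil]
  | cons j L ih =>
    rw [List.nodup_cons] at hL
    have hjJ : j ∉ J := fun h => hLJ j h (by simp)
    have hjL : j ∉ L.toFinset := by simpa using hL.1
    have hJL : ∀ b ∈ J, b ∉ L.toFinset := fun b hb h => hLJ b hb (by
      simp [List.mem_toFinset.1 h])
    have hS' : insert j (L.toFinset ∪ J.toFinset) = S := by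
      rw [← hS, List.toFinset_cons, Finset.insert_union]
    -- With `j` moved to the columns the vertex set, hence every Dunkl element, stays the same.
    -- Iterating, the column sum is the product of the factors 1 + θ_v X for `v` in `L`.
    have key : ∀ r, columnSumDeg x L.toFinset (j :: J) r
        = listESymm (L.map (localDunkl x S)) r := by
      refine ih (j :: J) hL.2 (List.nodup_cons.2 ⟨hjJ, hJ⟩) ?_ ?_
      · intro b hb
        rcases List.mem_cons.1 hb with rfl | h
        · exact hL.1
        · exact fun h' => hLJ b h (by simp [h'])
      · rw [List.toFinset_cons, Finset.union_insert, hS']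
    rw [List.toFinset_cons]
    cases r with
    | zero => rw [columnSumDeg_zero hx J hjL hjJ hJ hJL, key, listESymm_zero, listESymm_zero]
    | succ r =>
      rw [columnSumDeg_succ hx J hjL hjJ hJ hJL, key, key, List.map_cons, listESymm_cons, hS']

/-- The Pieri formula for complete homogeneous symmetric polynomials in Dunkl elements. -/
theorem columnSumDeg_eq_listHSymm (hx : IsDunklSystem x) (S : Finset V) (L : List V)
    (J : Finset V) (hL : L.Nodup) (hLJ : ∀ b ∈ L, b ∉ J) (hS : L.toFinset ∪ J = S)
    (r : ℕ) : (-1) ^ r * columnSumDeg x J L r = listHSymm (L.map (localDunkl x S)) r := by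
  induction L generalizing J r with
  | nil =>
    rw [columnSumDeg_nil]
    cases r <;> simp [listHSymm_zero, listHSymm_nil]
  | cons j L ih =>
    rw [List.nodup_cons] at hL
    have hjJ : j ∉ J := hLJ j (by simp)
    have hLJ' : ∀ b ∈ L, b ∉ J := fun b hb => hLJ b (by simp [hb])
    have hS' : insert j (J ∪ L.toFinset) = S := by
      rw [← hS, List.toFinset_cons, Finset.insert_union, Finset.union_comm]
    -- The move now goes from columns to rows, so the column sum is the inverse of the product of
    -- the factors 1 + θ_v X. Its coefficients are the complete symmetric polynomials up to the sign
    -- (-1)^r.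
    have key : ∀ r, (-1) ^ r * columnSumDeg x (insert j J) L r
        = listHSymm (L.map (localDunkl x S)) r := by
      refine ih (insert j J) hL.2 ?_ ?_
      · intro b hb h
        rcases Finset.mem_insert.1 h with rfl | h
        · exact hL.1 hb
        · exact hLJ' b hb h
      · rw [Finset.union_insert, Finset.union_comm, hS']
    induction r with
    | zero =>
      have := key 0
      rw [columnSumDeg_zero hx L hjJ hL.1 hL.2 hLJ'] at this
      rw [this, listHSymm_zero, listHSymm_zero]
    | succ r ihr =>
      have := key (r + 1)
      rw [columnSumDeg_succ hx L hjJ hL.1 hL.2 hLJ', hS'] at this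
      rw [List.map_cons, listHSymm_cons, ← List.map_cons, ← ihr, ← this, pow_succ]
      noncomm_ring

/-- The products of maximal degree over a nonempty vertex set vanish. -/
theorem columnSumDeg_mul_eq_zero (hx : IsDunklSystem x) (p q : List V) (hp : p.Nodup)
    (hq : q.Nodup) (hpq : ∀ b ∈ q, b ∉ p) (hne : q ++ p ≠ []) :
    columnSumDeg x p.toFinset q p.length * columnSumDeg x q.toFinset p q.length = 0 := by
  set S := p.toFinset ∪ q.toFinset with hS
  have hqp : ∀ b ∈ p, b ∉ q := fun b hb h => hpq b h hb
  have hnd : (q ++ p).Nodup := List.nodup_append'.2 ⟨hq, hp, fun b hb h => hpq b hb h⟩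
  have h1 := columnSumDeg_eq_listESymm hx S p q hp hq hpq rfl p.length
  have h2 := columnSumDeg_eq_listESymm hx S q p hq hp hqp (Finset.union_comm _ _) q.length
  -- Both factors are top elementary polynomials, so their product is the product of all θ_v. That
  -- is the top elementary polynomial of all vertices, computed with no column left, where the
  -- column sum is 1 and has no part of positive degree.
  have h3 := columnSumDeg_eq_listESymm hx S (q ++ p) [] hnd List.nodup_nil (by simp)
    (by simp [hS, Finset.union_comm]) (q ++ p).length
  have l1 := listESymm_length (p.map (localDunkl x S))
  have l2 := listESymm_length (q.map (localDunkl x S))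
  have l3 := listESymm_length ((q ++ p).map (localDunkl x S))
  rw [List.length_map] at l1 l2 l3
  rw [h1, h2, l1, l2, ← List.prod_append, ← List.reverse_append, ← List.map_append, ← l3, ← h3,
    columnSumDeg_nil, if_neg (by simpa using hne)]

end Pieri

end FominKirillov

/-! ### From column sums to sets of boxes -/

namespace FominKirillov

section Split

variable {α β R : Type*} [DecidableEq α] [LinearOrder β] [Ring R]

/-- No key of `A` equals a key of `B`, so the keys fix the way in which sorted arrangements of `A`
and `B` interleave. Each letter of `B` that precedes a letter of `A` commutes with it, so the
product factors. -/
theorem sortedSum_union (κ : α → β) (f : α → R) (A B : Finset α)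
    (h : ∀ a ∈ A, ∀ b ∈ B, κ a < κ b ∨ (κ b < κ a ∧ Commute (f a) (f b))) :
    sortedSum κ f (A ∪ B) = sortedSum κ f A * sortedSum κ f B := by
  induction hn : A.card + B.card using Nat.strong_induction_on generalizing A B with
  | _ n ih =>
    rcases (A ∪ B).eq_empty_or_nonempty with h0 | hne
    · obtain ⟨rfl, rfl⟩ := Finset.union_eq_empty.1 h0
      simp [sortedSum_empty]
    have hdisj : ∀ a ∈ A, a ∉ B := fun a ha hb => by
      rcases h a ha a hb with h | h
      · exact lt_irrefl _ h
      · exact lt_irrefl _ h.1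
    obtain ⟨m, hm, hmin⟩ := (A ∪ B).exists_min_image κ hne
    rw [sortedSum_eq_sum_first κ f hne]
    rcases Finset.mem_union.1 hm with hmA | hmB
    · have hlt : ∀ b ∈ B, κ m < κ b := fun b hb => by
        rcases h m hmA b hb with h | h
        · exact h
        · exact absurd h.1 (hmin b (Finset.mem_union_right _ hb)).not_gt
      have hf : (A ∪ B).filter (fun a => ∀ b ∈ A ∪ B, κ a ≤ κ b)
          = A.filter (fun a => ∀ b ∈ A, κ a ≤ κ b) := by
        ext a
        simp only [Finset.mem_filter, Finset.mem_union]
        constructor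
        · rintro ⟨h1, h2⟩
          refine ⟨h1.resolve_right fun hb => ?_, fun b hb => h2 b (Or.inl hb)⟩
          exact (hlt a hb).not_ge (h2 m (Or.inl hmA))
        · rintro ⟨h1, h2⟩
          refine ⟨Or.inl h1, fun b hb => ?_⟩
          rcases hb with hb | hb
          · exact h2 b hb
          · exact (h2 m hmA).trans (hlt b hb).le
      rw [hf, sortedSum_eq_sum_first κ f ⟨m, hmA⟩, Finset.sum_mul]
      refine Finset.sum_congr rfl fun a ha => ?_
      have haA := (Finset.mem_filter.1 ha).1
      have hc := Finset.card_erase_lt_of_mem haA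
      rw [Finset.erase_union_distrib, Finset.erase_eq_of_notMem (hdisj a haA),
        ih _ (by omega) _ _ (fun c hc b hb => h c (Finset.mem_of_mem_erase hc) b hb) rfl,
        mul_assoc]
    · have hlt : ∀ a ∈ A, κ m < κ a := fun a ha => by
        rcases h a ha m hmB with h | h
        · exact absurd h (hmin a (Finset.mem_union_left _ ha)).not_gt
        · exact h.1
      have hf : (A ∪ B).filter (fun a => ∀ b ∈ A ∪ B, κ a ≤ κ b)
          = B.filter (fun a => ∀ b ∈ B, κ a ≤ κ b) := by
        ext a
        simp only [Finset.mem_filter, Finset.mem_union]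
        constructor
        · rintro ⟨h1, h2⟩
          refine ⟨h1.resolve_left fun hb => ?_, fun b hb => h2 b (Or.inr hb)⟩
          exact (hlt a hb).not_ge (h2 m (Or.inr hmB))
        · rintro ⟨h1, h2⟩
          refine ⟨Or.inr h1, fun b hb => ?_⟩
          rcases hb with hb | hb
          · exact (h2 m hmB).trans (hlt b hb).le
          · exact h2 b hb
      rw [hf, sortedSum_eq_sum_first κ f ⟨m, hmB⟩, Finset.mul_sum]
      refine Finset.sum_congr rfl fun b hb => ?_
      obtain ⟨hbB, hbm⟩ := Finset.mem_filter.1 hb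
      have hc := Finset.card_erase_lt_of_mem hbB
      rw [Finset.erase_union_distrib, Finset.erase_eq_of_notMem (fun hA => hdisj b hA hbB),
        ih _ (by omega) _ _ (fun c hc b hb => h c hc b (Finset.mem_of_mem_erase hb)) rfl,
        ← mul_assoc, ← mul_assoc]
      congr 1
      refine sortedSum_commute _ _ _ _ fun a ha => ?_
      rcases h a ha b hbB with h' | h'
      · exact absurd ((hbm m hmB).trans_lt (hlt a ha)) h'.not_gt
      · exact h'.2.symm

end Split

section Boxes

variable {ι κ R : Type*} [DecidableEq ι] [LinearOrder κ] [Ring R]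

/-- The sets of `r` boxes in `P × Q` with at most one box in each row. -/
def rowMaps (P : Finset ι) (Q : Finset κ) (r : ℕ) : Finset (Finset (ι × κ)) :=
  ((P ×ˢ Q).powersetCard r).filter fun A => ∀ p ∈ A, ∀ q ∈ A, p.1 = q.1 → p = q

theorem mem_rowMaps {P : Finset ι} {Q : Finset κ} {r : ℕ} {A : Finset (ι × κ)} :
    A ∈ rowMaps P Q r ↔ (∀ p ∈ A, p.1 ∈ P ∧ p.2 ∈ Q) ∧ A.card = r ∧
      ∀ p ∈ A, ∀ q ∈ A, p.1 = q.1 → p = q := by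
  simp only [rowMaps, Finset.mem_filter, Finset.mem_powersetCard, Finset.subset_iff,
    Finset.mem_product, and_assoc]

/-- The column sum as a sum over sets of boxes with at most one box in each row. -/
theorem columnSum_eq_sum_boxes (f : ι → κ → R) (I : Finset ι) (J : List κ)
    (hJ : J.Pairwise (· < ·)) :
    columnSum f I J = ∑ A ∈ ((I ×ˢ J.toFinset).powerset).filter
      (fun A => ∀ p ∈ A, ∀ q ∈ A, p.1 = q.1 → p = q), sortedSum Prod.snd (fun p => f p.1 p.2) A := by
  induction J generalizing I with
  | nil =>
    rw [columnSum_nil, List.toFinset_nil, Finset.product_empty, Finset.powerset_empty,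
      Finset.filter_singleton]
    simp [sortedSum_empty]
  | cons b J ih =>
    rw [List.pairwise_cons] at hJ
    rw [columnSum_cons]
    have e1 : ∀ A ∈ I.powerset, starSum (f · b) A * columnSum f (I \ A) J
        = ∑ B ∈ (((I \ A) ×ˢ J.toFinset).powerset).filter
          (fun A => ∀ p ∈ A, ∀ q ∈ A, p.1 = q.1 → p = q),
          sortedSum Prod.snd (fun p => f p.1 p.2)
            (A.map ⟨fun i => (i, b), Prod.mk_left_injective b⟩ ∪ B) := by
      intro A _
      rw [ih _ hJ.2, Finset.mul_sum]
      refine Finset.sum_congr rfl fun B hB => ?_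
      rw [sortedSum_union]
      · congr 1
        exact (sortedSum_map _ (RingHom.id R) _ _ (by simp) _ _ (by simp) A).symm
      · intro p hp q hq
        obtain ⟨i, _, rfl⟩ := Finset.mem_map.1 hp
        have hq' := Finset.mem_powerset.1 (Finset.mem_filter.1 hB).1 hq
        rw [Finset.mem_product, List.mem_toFinset] at hq'
        -- The list of columns is increasing, so the new column comes before all others.
        exact Or.inl (hJ.1 _ hq'.2)
    rw [Finset.sum_congr rfl e1, Finset.sum_sigma']
    refine Finset.sum_bij'
      (fun p _ => p.1.map ⟨fun i => (i, b), Prod.mk_left_injective b⟩ ∪ p.2)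
      (fun A _ => ⟨(A.filter (fun p => p.2 = b)).image Prod.fst, A.filter (fun p => p.2 ≠ b)⟩)
      ?_ ?_ ?_ ?_ ?_
    · rintro ⟨A, B⟩ h
      simp only [Finset.mem_sigma, Finset.mem_filter, Finset.mem_powerset, Finset.subset_iff,
        Finset.mem_product, Finset.mem_sdiff, List.mem_toFinset, Finset.mem_union,
        Finset.mem_map, Function.Embedding.coeFn_mk, List.mem_cons] at h ⊢
      obtain ⟨hA, hB, hinj⟩ := h
      constructor
      · rintro p (⟨i, hi, rfl⟩ | hp)
        · exact ⟨hA hi, Or.inl rfl⟩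
        · exact ⟨(hB hp).1.1, Or.inr (hB hp).2⟩
      · rintro p (⟨i, hi, rfl⟩ | hp) q (⟨i', hi', rfl⟩ | hq) hpq
        · simp only at hpq; rw [hpq]
        · exact absurd (show q.1 ∈ A from hpq ▸ hi) (hB hq).1.2
        · exact absurd (show p.1 ∈ A from hpq ▸ hi') (hB hp).1.2
        · exact hinj p hp q hq hpq
    · intro A h
      simp only [Finset.mem_sigma, Finset.mem_filter, Finset.mem_powerset, Finset.subset_iff,
        Finset.mem_product, Finset.mem_sdiff, List.mem_toFinset, List.mem_cons,
        Finset.mem_image] at h ⊢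
      obtain ⟨hA, hinj⟩ := h
      refine ⟨?_, ?_, fun p hp q hq => hinj p hp.1 q hq.1⟩
      · rintro _ ⟨p, ⟨hp, _⟩, rfl⟩; exact (hA hp).1
      · rintro p ⟨hp, hpb⟩
        refine ⟨⟨(hA hp).1, ?_⟩, (hA hp).2.resolve_left hpb⟩
        rintro ⟨q, ⟨hq, hqb⟩, hqp⟩
        rw [hinj q hq p hp hqp] at hqb
        exact hpb hqb
    · rintro ⟨A, B⟩ h
      simp only [Finset.mem_sigma, Finset.mem_filter, Finset.mem_powerset, Finset.subset_iff,
        Finset.mem_product, Finset.mem_sdiff, List.mem_toFinset] at h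
      have hB : ∀ p ∈ B, p.2 ≠ b := fun p hp e => (hJ.1 _ (h.2.1 hp).2).ne e.symm
      have h1 : ((A.map ⟨fun i => (i, b), Prod.mk_left_injective b⟩ ∪ B).filter
          (fun p => p.2 = b)).image Prod.fst = A := by
        ext i
        simp only [Finset.mem_image, Finset.mem_filter, Finset.mem_union, Finset.mem_map,
          Function.Embedding.coeFn_mk]
        constructor
        · rintro ⟨p, ⟨⟨j, hj, rfl⟩ | hp, hpb⟩, rfl⟩
          · exact hj
          · exact absurd hpb (hB p hp)
        · intro hi; exact ⟨(i, b), ⟨Or.inl ⟨i, hi, rfl⟩, rfl⟩, rfl⟩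
      have h2 : (A.map ⟨fun i => (i, b), Prod.mk_left_injective b⟩ ∪ B).filter
          (fun p => p.2 ≠ b) = B := by
        ext p
        simp only [Finset.mem_filter, Finset.mem_union, Finset.mem_map,
          Function.Embedding.coeFn_mk]
        constructor
        · rintro ⟨⟨j, hj, rfl⟩ | hp, hpb⟩
          · exact absurd rfl hpb
          · exact hp
        · intro hp; exact ⟨Or.inr hp, hB p hp⟩
      simp only [h1, h2]
    · intro A h
      ext p
      simp only [Finset.mem_filter, Finset.mem_union, Finset.mem_map, Finset.mem_image,
        Function.Embedding.coeFn_mk]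
      constructor
      · rintro (⟨i, ⟨q, ⟨hq, rfl⟩, rfl⟩, rfl⟩ | hp)
        · exact hq
        · exact hp.1
      · intro hp
        by_cases hpb : p.2 = b
        · exact Or.inl ⟨p.1, ⟨p, ⟨hp, hpb⟩, rfl⟩, by rw [← hpb]⟩
        · exact Or.inr ⟨hp, hpb⟩
    · rintro ⟨A, B⟩ _; rfl

open Polynomial in
-- A set of boxes contributes the central variable to the power of its size, so the coefficient
-- selects the sets with `r` boxes.
theorem columnSumDeg_eq_sum_boxes (f : ι → κ → R) (I : Finset ι) (Q : Finset κ) (r : ℕ) :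
    columnSumDeg f I Q.sort r
      = ∑ A ∈ rowMaps I Q r, sortedSum Prod.snd (fun p => f p.1 p.2) A := by
  have hs : ∀ A : Finset (ι × κ), sortedSum Prod.snd (fun p => (C (f p.1 p.2) * X : R[X])) A
      = C (sortedSum Prod.snd (fun p => f p.1 p.2) A) * X ^ A.card := fun A => by
    rw [sortedSum_mul_central _ _ _ Polynomial.commute_X,
      ← sortedSum_map (Function.Embedding.refl _) C Prod.snd Prod.snd (fun _ _ => Iff.rfl)
        (fun p : ι × κ => f p.1 p.2) (fun p => C (f p.1 p.2)) (fun _ => rfl), Finset.map_refl]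
  rw [columnSumDeg, columnSum_eq_sum_boxes _ _ _ Q.sortedLT_sort.pairwise, finsetSum_coeff,
    Finset.sort_toFinset]
  simp only [hs, coeff_C_mul, coeff_X_pow]
  rw [rowMaps, Finset.powersetCard_eq_filter, Finset.filter_filter, ← Finset.sum_filter_add_sum_filter_not
    (Finset.filter _ _) (fun A : Finset (ι × κ) => A.card = r)]
  rw [Finset.filter_filter, add_eq_left.2]
  · refine Finset.sum_congr (by ext A; simp only [Finset.mem_filter, and_comm]) fun A hA => ?_
    rw [if_pos, mul_one]
    simp only [Finset.mem_filter] at hA; exact hA.2.1.symm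
  · refine Finset.sum_eq_zero fun A hA => ?_
    rw [if_neg, mul_zero]
    exact fun h => (Finset.mem_filter.1 hA).2 h.symm

end Boxes

section Map

variable {ι κ R : Type*} [DecidableEq ι] [Ring R]

theorem columnSumDeg_map {ι' κ' : Type*} [DecidableEq ι'] (e : ι ↪ ι') (e' : κ → κ')
    (f : ι' → κ' → R) (I : Finset ι) (J : List κ) (r : ℕ) :
    columnSumDeg f (I.map e) (J.map e') r = columnSumDeg (fun i b => f (e i) (e' b)) I J r := by
  -- Quantified over the ring, since it is applied over the polynomial ring.
  have : ∀ {R : Type _} [Ring R] (f : ι' → κ' → R) (I : Finset ι),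
      columnSum f (I.map e) (J.map e') = columnSum (fun i b => f (e i) (e' b)) I J := by
    intro R _ f I
    induction J generalizing I with
    | nil => rw [List.map_nil, columnSum_nil, columnSum_nil]
    | cons b J ih =>
      rw [List.map_cons, columnSum_cons, columnSum_cons]
      symm
      refine Finset.sum_bij (fun A _ => A.map e) ?_ ?_ ?_ ?_
      · intro A hA
        rw [Finset.mem_powerset] at hA ⊢
        exact Finset.map_subset_map.2 hA
      · intro A _ B _ h; exact Finset.map_injective e h
      · intro B hB
        rw [Finset.mem_powerset, Finset.subset_map_iff] at hB
        obtain ⟨A, hA, rfl⟩ := hB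
        exact ⟨A, Finset.mem_powerset.2 hA, rfl⟩
      · intro A _
        rw [← Finset.map_sdiff, ih]
        congr 1
        exact (sortedSum_map e (RingHom.id R) _ _ (by simp) _ _ (by simp) A).symm
  rw [columnSumDeg, this, columnSumDeg]

end Map

section BoxPieri

variable {ι κ : Type*} [LinearOrder ι] [LinearOrder κ]

/-- The sets of `r` boxes in `P × Q` with at most one box in each column. -/
def colMaps (P : Finset ι) (Q : Finset κ) (r : ℕ) : Finset (Finset (ι × κ)) :=
  ((P ×ˢ Q).powersetCard r).filter fun A => ∀ p ∈ A, ∀ q ∈ A, p.2 = q.2 → p = q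

theorem mem_colMaps {P : Finset ι} {Q : Finset κ} {r : ℕ} {A : Finset (ι × κ)} :
    A ∈ colMaps P Q r ↔ (∀ p ∈ A, p.1 ∈ P ∧ p.2 ∈ Q) ∧ A.card = r ∧
      ∀ p ∈ A, ∀ q ∈ A, p.2 = q.2 → p = q := by
  simp only [colMaps, Finset.mem_filter, Finset.mem_powersetCard, Finset.subset_iff,
    Finset.mem_product, and_assoc]

/-- With at most one box in each row and as many boxes as rows, the partial map from `P` to `Q` is
total. -/
theorem exists_mem_of_mem_rowMaps {A : Finset (ι × κ)} {P : Finset ι} {Q : Finset κ} (hA : A ∈ rowMaps P Q P.card) :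
    ∀ i ∈ P, ∃ j ∈ Q, (i, j) ∈ A := by
  rw [mem_rowMaps] at hA
  obtain ⟨h1, h2, h3⟩ := hA
  have : A.image Prod.fst = P := by
    refine Finset.eq_of_subset_of_card_le (fun i hi => ?_) ?_
    · obtain ⟨p, hp, rfl⟩ := Finset.mem_image.1 hi; exact (h1 p hp).1
    · rw [Finset.card_image_of_injOn (fun p hp q hq h => h3 p hp q hq h), h2]
  intro i hi
  rw [← this] at hi
  obtain ⟨p, hp, rfl⟩ := Finset.mem_image.1 hi
  exact ⟨p.2, (h1 p hp).2, hp⟩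

theorem exists_mem_of_mem_colMaps {B : Finset (ι × κ)} {P : Finset ι} {Q : Finset κ} (hB : B ∈ colMaps P Q Q.card) :
    ∀ j ∈ Q, ∃ i ∈ P, (i, j) ∈ B := by
  rw [mem_colMaps] at hB
  obtain ⟨h1, h2, h3⟩ := hB
  have : B.image Prod.snd = Q := by
    refine Finset.eq_of_subset_of_card_le (fun i hi => ?_) ?_
    · obtain ⟨p, hp, rfl⟩ := Finset.mem_image.1 hi; exact (h1 p hp).2
    · rw [Finset.card_image_of_injOn (fun p hp q hq h => h3 p hp q hq h), h2]
  intro i hi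
  rw [← this] at hi
  obtain ⟨p, hp, rfl⟩ := Finset.mem_image.1 hi
  exact ⟨p.1, (h1 p hp).1, hp⟩

variable {V R : Type*} [DecidableEq V] [Ring R] {x : V → V → R}

theorem columnSumDeg_eq_sum_rowMaps (x : V → V → R) (e : ι ↪ V) (e' : κ ↪ V) (P : Finset ι)
    (Q : Finset κ) (r : ℕ) : columnSumDeg x (P.map e) (Q.sort.map e') r
      = ∑ A ∈ rowMaps P Q r, sortedSum Prod.snd (fun p => x (e p.1) (e' p.2)) A := by
  rw [columnSumDeg_map, columnSumDeg_eq_sum_boxes]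

/-- Rows and columns exchange their roles, so every generator is read in the opposite direction.
Each of the `r` factors contributes a sign. -/
theorem columnSumDeg_eq_sum_colMaps (hx : IsDunklSystem x) (e : ι ↪ V) (e' : κ ↪ V)
    (P : Finset ι) (Q : Finset κ) (r : ℕ) : columnSumDeg x (Q.map e') (P.sort.map e) r
      = (-1) ^ r * ∑ A ∈ colMaps P Q r, sortedSum Prod.fst (fun p => x (e p.1) (e' p.2)) A := by
  rw [columnSumDeg_map, columnSumDeg_eq_sum_boxes, Finset.mul_sum]
  refine Finset.sum_bij' (fun A _ => A.map (Equiv.prodComm κ ι).toEmbedding)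
    (fun A _ => A.map (Equiv.prodComm ι κ).toEmbedding) ?_ ?_ ?_ ?_ ?_
  · intro A hA
    simp only [mem_rowMaps, mem_colMaps, Finset.card_map, Finset.mem_map_equiv] at hA ⊢
    exact ⟨fun p hp => (hA.1 _ hp).symm, hA.2.1, fun p hp q hq h =>
      (Equiv.prodComm ι κ).injective (hA.2.2 _ hp _ hq h)⟩
  · intro A hA
    simp only [mem_rowMaps, mem_colMaps, Finset.card_map, Finset.mem_map_equiv] at hA ⊢
    exact ⟨fun p hp => (hA.1 _ hp).symm, hA.2.1, fun p hp q hq h =>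
      (Equiv.prodComm κ ι).injective (hA.2.2 _ hp _ hq h)⟩
  · intro A _; ext p; simp
  · intro A _; ext p; simp
  · intro A hA
    have h1 : sortedSum Prod.fst (fun p : ι × κ => x (e p.1) (e' p.2))
        (A.map (Equiv.prodComm κ ι).toEmbedding)
        = sortedSum Prod.snd (fun p : κ × ι => x (e p.2) (e' p.1)) A :=
      sortedSum_map _ (RingHom.id R) _ _ (by simp) _ _ (by simp) A
    have h2 : (fun p : κ × ι => x (e' p.1) (e p.2)) = fun p => x (e p.2) (e' p.1) * (-1) := by
      funext p; rw [hx.skew (e p.2) (e' p.1), mul_neg_one]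
    rw [h1, h2, sortedSum_mul_central _ _ _ (Commute.neg_one_left), (mem_rowMaps.1 hA).2.1]
    exact ((Commute.neg_one_left _).pow_left r).eq.symm

/-- The sums over the complete maps on a nonempty set of rows and columns multiply to zero. -/
theorem sum_rowMaps_mul_sum_colMaps (hx : IsDunklSystem x) (e : ι ↪ V) (e' : κ ↪ V)
    (hee : ∀ i j, e i ≠ e' j) (P : Finset ι) (Q : Finset κ) (hne : P.Nonempty ∨ Q.Nonempty) :
    (∑ A ∈ rowMaps P Q P.card, sortedSum Prod.snd (fun p => x (e p.1) (e' p.2)) A)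
      * ∑ A ∈ colMaps P Q Q.card, sortedSum Prod.fst (fun p => x (e p.1) (e' p.2)) A = 0 := by
  have h := columnSumDeg_mul_eq_zero hx (P.sort.map e) (Q.sort.map e')
    ((P.sort_nodup _).map e.injective) ((Q.sort_nodup _).map e'.injective) (by
      simp only [List.mem_map]
      rintro _ ⟨j, _, rfl⟩ ⟨i, _, h⟩
      exact hee i j h) (by
      rw [Ne, List.append_eq_nil_iff, List.map_eq_nil_iff, List.map_eq_nil_iff]
      rintro ⟨h1, h2⟩
      have h1' := congrArg List.length h1
      have h2' := congrArg List.length h2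
      simp only [Finset.length_sort, List.length_nil, Finset.card_eq_zero] at h1' h2'
      subst h1' h2'
      simp at hne)
  have t1 : (P.sort.map e).toFinset = P.map e := by ext; simp
  have t2 : (Q.sort.map e').toFinset = Q.map e' := by ext; simp
  rw [t1, t2, columnSumDeg_eq_sum_rowMaps, columnSumDeg_eq_sum_colMaps hx] at h
  simp only [List.length_map, Finset.length_sort] at h
  rcases neg_one_pow_eq_or R Q.card with h' | h'
  · rwa [h', one_mul] at h
  · rwa [h', neg_one_mul, mul_neg, neg_eq_zero] at h

end BoxPieri

end FominKirillov

/-! ### The core of a pair and the cancellation -/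

namespace FominKirillov

section Core

variable {ι κ : Type*} [Fintype ι] [Fintype κ] [LinearOrder ι] [LinearOrder κ]

/-- Regard the boxes of `A` as arrows from rows to columns and the boxes of `B` as arrows from
columns to rows. Every element of the set `P` of rows and `Q` of columns is the origin of an
arrow into this set. -/
def SelfFeeding (A B : Finset (ι × κ)) (P : Finset ι) (Q : Finset κ) : Prop :=
  (∀ i ∈ P, ∃ j ∈ Q, (i, j) ∈ A) ∧ ∀ j ∈ Q, ∃ i ∈ P, (i, j) ∈ B

open Classical in
/-- The rows of the largest self-feeding set. -/
noncomputable def coreRows (A B : Finset (ι × κ)) : Finset ι :=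
  Finset.univ.filter fun i => ∃ P Q, SelfFeeding A B P Q ∧ i ∈ P

open Classical in
/-- The columns of the largest self-feeding set. -/
noncomputable def coreCols (A B : Finset (ι × κ)) : Finset κ :=
  Finset.univ.filter fun j => ∃ P Q, SelfFeeding A B P Q ∧ j ∈ Q

variable {A B : Finset (ι × κ)}

set_option linter.unusedSectionVars false in
theorem SelfFeeding.subset_coreRows {P : Finset ι} {Q : Finset κ} (h : SelfFeeding A B P Q) :
    P ⊆ coreRows A B := fun i hi => by
  simp only [coreRows, Finset.mem_filter, Finset.mem_univ, true_and]
  exact ⟨P, Q, h, hi⟩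

set_option linter.unusedSectionVars false in
theorem SelfFeeding.subset_coreCols {P : Finset ι} {Q : Finset κ} (h : SelfFeeding A B P Q) :
    Q ⊆ coreCols A B := fun i hi => by
  simp only [coreCols, Finset.mem_filter, Finset.mem_univ, true_and]
  exact ⟨P, Q, h, hi⟩

theorem selfFeeding_core (A B : Finset (ι × κ)) :
    SelfFeeding A B (coreRows A B) (coreCols A B) := by
  constructor
  · intro i hi
    simp only [coreRows, Finset.mem_filter, Finset.mem_univ, true_and] at hi
    obtain ⟨P, Q, h, hi⟩ := hi
    obtain ⟨j, hj, hij⟩ := h.1 i hi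
    exact ⟨j, h.subset_coreCols hj, hij⟩
  · intro j hj
    simp only [coreCols, Finset.mem_filter, Finset.mem_univ, true_and] at hj
    obtain ⟨P, Q, h, hj⟩ := hj
    obtain ⟨i, hi, hij⟩ := h.2 j hj
    exact ⟨i, h.subset_coreRows hi, hij⟩

/-- Adjoining the origin of an arrow into the core leaves the set self-feeding, so by maximality the
origin was already in the core. Thus no arrow enters the core from outside. -/
theorem mem_coreRows_of_mem_coreCols {p : ι × κ} (hp : p ∈ A) (h : p.2 ∈ coreCols A B) :
    p.1 ∈ coreRows A B := by
  have hc := selfFeeding_core A B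
  have : SelfFeeding A B (insert p.1 (coreRows A B)) (coreCols A B) := by
    constructor
    · intro i hi
      rcases Finset.mem_insert.1 hi with rfl | hi
      · exact ⟨p.2, h, hp⟩
      · exact hc.1 i hi
    · intro j hj
      obtain ⟨i, hi, hij⟩ := hc.2 j hj
      exact ⟨i, Finset.mem_insert_of_mem hi, hij⟩
  exact this.subset_coreRows (Finset.mem_insert_self _ _)

theorem mem_coreCols_of_mem_coreRows {p : ι × κ} (hp : p ∈ B) (h : p.1 ∈ coreRows A B) :
    p.2 ∈ coreCols A B := by
  have hc := selfFeeding_core A B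
  have : SelfFeeding A B (coreRows A B) (insert p.2 (coreCols A B)) := by
    constructor
    · intro i hi
      obtain ⟨j, hj, hij⟩ := hc.1 i hi
      exact ⟨j, Finset.mem_insert_of_mem hj, hij⟩
    · intro j hj
      rcases Finset.mem_insert.1 hj with rfl | hj
      · exact ⟨p.1, h, hp⟩
      · exact hc.2 j hj
  exact this.subset_coreCols (Finset.mem_insert_self _ _)

/-- A core row has an arrow into the core, and it has only one arrow. Thus no arrow leaves the core.
-/
theorem mem_coreCols_of_rowInj (hA : ∀ p ∈ A, ∀ q ∈ A, p.1 = q.1 → p = q) {p : ι × κ}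
    (hp : p ∈ A) (h : p.1 ∈ coreRows A B) : p.2 ∈ coreCols A B := by
  obtain ⟨j, hj, hij⟩ := (selfFeeding_core A B).1 _ h
  rw [hA p hp _ hij rfl]; exact hj

theorem mem_coreRows_of_colInj (hB : ∀ p ∈ B, ∀ q ∈ B, p.2 = q.2 → p = q) {p : ι × κ}
    (hp : p ∈ B) (h : p.2 ∈ coreCols A B) : p.1 ∈ coreRows A B := by
  obtain ⟨j, hj, hij⟩ := (selfFeeding_core A B).2 _ h
  rw [hB p hp _ hij rfl]; exact hj

/-- The graph of the arrows given by `A` and `B` has no directed cycle. -/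
def NoCore (A B : Finset (ι × κ)) : Prop := coreRows A B = ∅ ∧ coreCols A B = ∅

theorem filter_mem_rowMaps (hA : ∀ p ∈ A, ∀ q ∈ A, p.1 = q.1 → p = q) :
    A.filter (fun p => p.1 ∈ coreRows A B)
      ∈ rowMaps (coreRows A B) (coreCols A B) (coreRows A B).card := by
  refine mem_rowMaps.2 ⟨fun p hp => ?_, ?_, fun p hp q hq => ?_⟩
  · rw [Finset.mem_filter] at hp
    exact ⟨hp.2, mem_coreCols_of_rowInj hA hp.1 hp.2⟩
  · have : (A.filter (fun p => p.1 ∈ coreRows A B)).image Prod.fst = coreRows A B := by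
      ext i
      simp only [Finset.mem_image, Finset.mem_filter]
      constructor
      · rintro ⟨p, hp, rfl⟩; exact hp.2
      · intro hi
        obtain ⟨j, _, hij⟩ := (selfFeeding_core A B).1 i hi
        exact ⟨(i, j), ⟨hij, hi⟩, rfl⟩
    conv_rhs => rw [← this]
    rw [Finset.card_image_of_injOn]
    intro p hp q hq h
    simp only [Finset.coe_filter, Set.mem_ofPred_eq] at hp hq
    exact hA p hp.1 q hq.1 h
  · rw [Finset.mem_filter] at hp hq
    exact hA p hp.1 q hq.1

theorem filter_mem_colMaps (hB : ∀ p ∈ B, ∀ q ∈ B, p.2 = q.2 → p = q) :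
    B.filter (fun p => p.1 ∈ coreRows A B)
      ∈ colMaps (coreRows A B) (coreCols A B) (coreCols A B).card := by
  refine mem_colMaps.2 ⟨fun p hp => ?_, ?_, fun p hp q hq => ?_⟩
  · rw [Finset.mem_filter] at hp
    exact ⟨hp.2, mem_coreCols_of_mem_coreRows hp.1 hp.2⟩
  · have : (B.filter (fun p => p.1 ∈ coreRows A B)).image Prod.snd = coreCols A B := by
      ext j
      simp only [Finset.mem_image, Finset.mem_filter]
      constructor
      · rintro ⟨p, hp, rfl⟩; exact mem_coreCols_of_mem_coreRows hp.1 hp.2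
      · intro hj
        obtain ⟨i, hi, hij⟩ := (selfFeeding_core A B).2 j hj
        exact ⟨(i, j), ⟨hij, hi⟩, rfl⟩
    conv_rhs => rw [← this]
    rw [Finset.card_image_of_injOn]
    intro p hp q hq h
    simp only [Finset.coe_filter, Set.mem_ofPred_eq] at hp hq
    exact hB p hp.1 q hq.1 h
  · rw [Finset.mem_filter] at hp hq
    exact hB p hp.1 q hq.1

/-- Replacing the arrows inside the core does not change the core. -/
theorem core_replace {A₁ B₁ : Finset (ι × κ)}
    (hA₁ : A₁ ∈ rowMaps (coreRows A B) (coreCols A B) (coreRows A B).card)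
    (hB₁ : B₁ ∈ colMaps (coreRows A B) (coreCols A B) (coreCols A B).card) :
    coreRows (A₁ ∪ A.filter (fun p => p.1 ∉ coreRows A B))
        (B₁ ∪ B.filter (fun p => p.1 ∉ coreRows A B)) = coreRows A B ∧
      coreCols (A₁ ∪ A.filter (fun p => p.1 ∉ coreRows A B))
        (B₁ ∪ B.filter (fun p => p.1 ∉ coreRows A B)) = coreCols A B := by
  have hsub : SelfFeeding (A₁ ∪ A.filter (fun p => p.1 ∉ coreRows A B))
        (B₁ ∪ B.filter (fun p => p.1 ∉ coreRows A B)) (coreRows A B) (coreCols A B) := by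
    constructor
    · intro i hi
      obtain ⟨j, hj, hij⟩ := exists_mem_of_mem_rowMaps hA₁ i hi
      exact ⟨j, hj, Finset.mem_union_left _ hij⟩
    · intro j hj
      obtain ⟨i, hi, hij⟩ := exists_mem_of_mem_colMaps hB₁ j hj
      exact ⟨i, hi, Finset.mem_union_left _ hij⟩
  -- Outside the old core the arrows are unchanged and none of them enters it. So what a new
  -- self-feeding set has outside the old core feeds itself for the old arrows, and by maximality
  -- there is nothing.
  have hsup : ∀ P' Q', SelfFeeding (A₁ ∪ A.filter (fun p => p.1 ∉ coreRows A B))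
        (B₁ ∪ B.filter (fun p => p.1 ∉ coreRows A B)) P' Q' →
        SelfFeeding A B (P' \ coreRows A B) (Q' \ coreCols A B) := by
    intro P' Q' h
    constructor
    · intro i hi
      rw [Finset.mem_sdiff] at hi
      obtain ⟨j, hj, hij⟩ := h.1 i hi.1
      rcases Finset.mem_union.1 hij with hij | hij
      · exact absurd ((mem_rowMaps.1 hA₁).1 _ hij).1 hi.2
      · rw [Finset.mem_filter] at hij
        exact ⟨j, Finset.mem_sdiff.2 ⟨hj, fun hjc =>
          hi.2 (mem_coreRows_of_mem_coreCols hij.1 hjc)⟩, hij.1⟩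
    · intro j hj
      rw [Finset.mem_sdiff] at hj
      obtain ⟨i, hi, hij⟩ := h.2 j hj.1
      rcases Finset.mem_union.1 hij with hij | hij
      · exact absurd ((mem_colMaps.1 hB₁).1 _ hij).2 hj.2
      · rw [Finset.mem_filter] at hij
        exact ⟨i, Finset.mem_sdiff.2 ⟨hi, hij.2⟩, hij.1⟩
  have h := hsup _ _ (selfFeeding_core _ _)
  constructor
  · refine Finset.Subset.antisymm (fun i hi => ?_) hsub.subset_coreRows
    by_contra hc
    exact hc (h.subset_coreRows (Finset.mem_sdiff.2 ⟨hi, hc⟩))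
  · refine Finset.Subset.antisymm (fun i hi => ?_) hsub.subset_coreCols
    by_contra hc
    exact hc (h.subset_coreCols (Finset.mem_sdiff.2 ⟨hi, hc⟩))

/-- The core together with the arrows outside of the core. -/
noncomputable def outerPart (p : Finset (ι × κ) × Finset (ι × κ)) :
    (Finset ι × Finset κ) × (Finset (ι × κ) × Finset (ι × κ)) :=
  ((coreRows p.1 p.2, coreCols p.1 p.2),
    (p.1.filter (fun a => a.1 ∉ coreRows p.1 p.2), p.2.filter (fun a => a.1 ∉ coreRows p.1 p.2)))

open Classical in
/-- The pairs with a nonempty core cancel. -/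
theorem sum_rowMaps_mul_sum_colMaps_eq_sum_noCore {R : Type*} [Ring R] (F : ι × κ → R)
    (hF : ∀ p q, p.1 ≠ q.1 → p.2 ≠ q.2 → Commute (F p) (F q))
    (hzero : ∀ (P : Finset ι) (Q : Finset κ), P.Nonempty ∨ Q.Nonempty →
      (∑ A ∈ rowMaps P Q P.card, sortedSum Prod.snd F A)
        * ∑ B ∈ colMaps P Q Q.card, sortedSum Prod.fst F B = 0) (l r : ℕ) :
    (∑ A ∈ rowMaps Finset.univ Finset.univ l, sortedSum Prod.snd F A)
        * ∑ B ∈ colMaps Finset.univ Finset.univ r, sortedSum Prod.fst F B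
      = ∑ p ∈ (rowMaps Finset.univ Finset.univ l ×ˢ colMaps Finset.univ Finset.univ r).filter
          (fun p => NoCore p.1 p.2), sortedSum Prod.snd F p.1 * sortedSum Prod.fst F p.2 := by
  rw [Finset.sum_mul_sum, ← Finset.sum_product', ← Finset.sum_filter_add_sum_filter_not _
    (fun p : Finset (ι × κ) × Finset (ι × κ) => NoCore p.1 p.2), add_eq_left]
  -- Group the pairs by their core and the arrows outside of it. In each group the inner arrows run
  -- freely over all complete maps on the core.
  rw [← Finset.sum_fiberwise_of_maps_to (g := outerPart)
    (fun p hp => Finset.mem_image_of_mem outerPart hp)]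
  refine Finset.sum_eq_zero fun y hy => ?_
  obtain ⟨⟨A, B⟩, hAB, rfl⟩ := Finset.mem_image.1 hy
  rw [Finset.mem_filter, Finset.mem_product, mem_rowMaps, mem_colMaps] at hAB
  obtain ⟨⟨⟨-, hAl, hA⟩, ⟨-, hBr, hB⟩⟩, hcore⟩ := hAB
  simp only at hAl hA hBr hB hcore
  set P := coreRows A B with hP
  set Q := coreCols A B with hQ
  set A₂ := A.filter (fun p => p.1 ∉ P) with hA₂
  set B₂ := B.filter (fun p => p.1 ∉ P) with hB₂
  have hout : outerPart (A, B) = ((P, Q), (A₂, B₂)) := rfl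
  have hne : P.Nonempty ∨ Q.Nonempty := by
    by_contra h
    rw [not_or, Finset.not_nonempty_iff_eq_empty, Finset.not_nonempty_iff_eq_empty] at h
    exact hcore h
  have hA₂m : ∀ p ∈ A₂, p ∈ A ∧ p.1 ∉ P ∧ p.2 ∉ Q := fun p hp => by
    rw [hA₂, Finset.mem_filter] at hp
    exact ⟨hp.1, hp.2, fun h => hp.2 (mem_coreRows_of_mem_coreCols hp.1 h)⟩
  have hB₂m : ∀ p ∈ B₂, p ∈ B ∧ p.1 ∉ P ∧ p.2 ∉ Q := fun p hp => by
    rw [hB₂, Finset.mem_filter] at hp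
    exact ⟨hp.1, hp.2, fun h => hp.2 (mem_coreRows_of_colInj hB hp.1 h)⟩
  have hcardA : P.card + A₂.card = l := by
    rw [← (mem_rowMaps.1 (filter_mem_rowMaps (B := B) hA)).2.1, ← hAl]
    exact Finset.card_filter_add_card_filter_not _
  have hcardB : Q.card + B₂.card = r := by
    rw [← (mem_colMaps.1 (filter_mem_colMaps (A := A) hB)).2.1, ← hBr]
    exact Finset.card_filter_add_card_filter_not _
  have hmain : ∑ p ∈ rowMaps P Q P.card ×ˢ colMaps P Q Q.card,
      (sortedSum Prod.snd F p.1 * sortedSum Prod.fst F p.2)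
        * (sortedSum Prod.snd F A₂ * sortedSum Prod.fst F B₂) = 0 := by
    rw [← Finset.sum_mul, Finset.sum_product, ← Finset.sum_mul_sum, hzero P Q hne, zero_mul]
  rw [← hmain]
  symm
  refine Finset.sum_bij' (fun p _ => (p.1 ∪ A₂, p.2 ∪ B₂))
    (fun p _ => (p.1.filter (fun a => a.1 ∈ P), p.2.filter (fun a => a.1 ∈ P))) ?_ ?_ ?_ ?_ ?_
  · rintro ⟨A₁, B₁⟩ h
    rw [Finset.mem_product] at h
    obtain ⟨hA₁, hB₁⟩ := h
    have hc := core_replace hA₁ hB₁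
    rw [← hP, ← hQ, ← hA₂, ← hB₂] at hc
    simp only at hA₁ hB₁
    rw [mem_rowMaps] at hA₁
    rw [mem_colMaps] at hB₁
    have hdA : Disjoint A₁ A₂ := Finset.disjoint_left.2 fun p hp hp' =>
      (hA₂m p hp').2.1 (hA₁.1 p hp).1
    have hdB : Disjoint B₁ B₂ := Finset.disjoint_left.2 fun p hp hp' =>
      (hB₂m p hp').2.1 (hB₁.1 p hp).1
    rw [Finset.mem_filter, Finset.mem_filter, Finset.mem_product, mem_rowMaps, mem_colMaps]
    refine ⟨⟨⟨⟨fun p _ => by simp, ?_, ?_⟩, ⟨fun p _ => by simp, ?_, ?_⟩⟩, ?_⟩, ?_⟩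
    · simp only; rw [Finset.card_union_of_disjoint hdA, hA₁.2.1, hcardA]
    · simp only [Finset.mem_union]
      rintro p (hp | hp) q (hq | hq) hpq
      · exact hA₁.2.2 p hp q hq hpq
      · exact absurd (hpq ▸ (hA₁.1 p hp).1) (hA₂m q hq).2.1
      · exact absurd (hpq ▸ (hA₁.1 q hq).1) (hA₂m p hp).2.1
      · exact hA p (hA₂m p hp).1 q (hA₂m q hq).1 hpq
    · simp only; rw [Finset.card_union_of_disjoint hdB, hB₁.2.1, hcardB]
    · simp only [Finset.mem_union]
      rintro p (hp | hp) q (hq | hq) hpq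
      · exact hB₁.2.2 p hp q hq hpq
      · exact absurd (hpq ▸ (hB₁.1 p hp).2) (hB₂m q hq).2.2
      · exact absurd (hpq ▸ (hB₁.1 q hq).2) (hB₂m p hp).2.2
      · exact hB p (hB₂m p hp).1 q (hB₂m q hq).1 hpq
    · simp only [NoCore, hc.1, hc.2]
      rintro ⟨h1, h2⟩
      simp [h1, h2] at hne
    · rw [hout]
      simp only [outerPart, hc.1, hc.2, Prod.mk.injEq, true_and]
      constructor
      · rw [Finset.filter_union, Finset.filter_true_of_mem fun p hp => (hA₂m p hp).2.1,
          Finset.filter_false_of_mem fun p hp => not_not.2 (hA₁.1 p hp).1, Finset.empty_union]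
      · rw [Finset.filter_union, Finset.filter_true_of_mem fun p hp => (hB₂m p hp).2.1,
          Finset.filter_false_of_mem fun p hp => not_not.2 (hB₁.1 p hp).1, Finset.empty_union]
  · rintro ⟨A', B'⟩ h
    rw [Finset.mem_filter, Finset.mem_filter, Finset.mem_product, mem_rowMaps, mem_colMaps,
      hout] at h
    obtain ⟨⟨⟨h1, h2⟩, -⟩, h3⟩ := h
    simp only [outerPart, Prod.mk.injEq] at h1 h2 h3
    rw [Finset.mem_product, ← h3.1.1, ← h3.1.2]
    exact ⟨filter_mem_rowMaps h1.2.2, filter_mem_colMaps h2.2.2⟩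
  · rintro ⟨A₁, B₁⟩ h
    rw [Finset.mem_product, mem_rowMaps, mem_colMaps] at h
    simp only at h
    simp only [Prod.mk.injEq]
    constructor
    · rw [Finset.filter_union, Finset.filter_true_of_mem fun p hp => (h.1.1 p hp).1,
          Finset.filter_false_of_mem fun p hp => (hA₂m p hp).2.1, Finset.union_empty]
    · rw [Finset.filter_union, Finset.filter_true_of_mem fun p hp => (h.2.1 p hp).1,
          Finset.filter_false_of_mem fun p hp => (hB₂m p hp).2.1, Finset.union_empty]
  · rintro ⟨A', B'⟩ h
    rw [Finset.mem_filter, hout] at h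
    simp only [outerPart, Prod.mk.injEq] at h
    simp only [Prod.mk.injEq]
    constructor
    · rw [← h.2.2.1, h.2.1.1]; exact Finset.filter_union_filter_not_eq _ _
    · rw [← h.2.2.2, h.2.1.1]; exact Finset.filter_union_filter_not_eq _ _
  · rintro ⟨A₁, B₁⟩ h
    rw [Finset.mem_product, mem_rowMaps, mem_colMaps] at h
    obtain ⟨hA₁, hB₁⟩ := h
    simp only at hA₁ hB₁
    simp only
    -- Inner and outer boxes share neither a row nor a column, so they never tie in the sorting key
    -- and they commute.
    rw [sortedSum_union, sortedSum_union]
    · have hc : Commute (sortedSum Prod.fst F B₁) (sortedSum Prod.snd F A₂) := by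
        refine sortedSum_commute _ _ _ _ fun p hp =>
          (sortedSum_commute _ _ _ _ fun q hq => hF _ _ ?_ ?_).symm
        · exact fun e => (hA₂m p hp).2.1 (e ▸ (hB₁.1 q hq).1)
        · exact fun e => (hA₂m p hp).2.2 (e ▸ (hB₁.1 q hq).2)
      rw [mul_assoc, ← mul_assoc _ (sortedSum Prod.snd F A₂), hc.eq]
      simp only [mul_assoc]
    · intro a ha b hb
      have hne1 : a.1 ≠ b.1 := fun e => (hB₂m b hb).2.1 (e ▸ (hB₁.1 a ha).1)
      have hne2 : a.2 ≠ b.2 := fun e => (hB₂m b hb).2.2 (e ▸ (hB₁.1 a ha).2)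
      exact (lt_or_gt_of_ne hne1).imp id fun h => ⟨h, hF _ _ hne1 hne2⟩
    · intro a ha b hb
      have hne1 : a.1 ≠ b.1 := fun e => (hA₂m b hb).2.1 (e ▸ (hA₁.1 a ha).1)
      have hne2 : a.2 ≠ b.2 := fun e => (hA₂m b hb).2.2 (e ▸ (hA₁.1 a ha).2)
      exact (lt_or_gt_of_ne hne2).imp id fun h => ⟨h, hF _ _ hne1 hne2⟩

end Core

end FominKirillov

/-! ### Forests, closed sets of boxes and pairs without core -/

namespace FominKirillov

section Graph

variable {V : Type*} {G : SimpleGraph V}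

/-- Every vertex of `Z` has two neighbors in `Z`. -/
def TwoNeighbors (G : SimpleGraph V) (Z : Set V) : Prop :=
  ∀ z ∈ Z, ∃ a ∈ Z, ∃ b ∈ Z, a ≠ b ∧ G.Adj z a ∧ G.Adj z b

/-- In an acyclic graph, a component of the graph induced on `Z` would be a finite tree with several
vertices, hence would have a leaf; but every vertex has two neighbors there. -/
theorem TwoNeighbors.not_isAcyclic [Finite V] {Z : Set V} (hZ : TwoNeighbors G Z)
    (hne : Z.Nonempty) : ¬ G.IsAcyclic := by
  classical
  intro hG
  obtain ⟨z, hz⟩ := hne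
  set H := G.induce Z with hH
  set c := H.connectedComponentMk ⟨z, hz⟩ with hc
  have htree := (hG.induce Z).isTree_connectedComponent c
  have hnb : ∀ v : c, ∃ a b : c, a ≠ b ∧ c.toSimpleGraph.Adj v a ∧ c.toSimpleGraph.Adj v b := by
    rintro ⟨⟨v, hv⟩, hvc⟩
    obtain ⟨a, ha, b, hb, hab, hva, hvb⟩ := hZ v hv
    have ha' : H.Adj ⟨v, hv⟩ ⟨a, ha⟩ := hva
    have hb' : H.Adj ⟨v, hv⟩ ⟨b, hb⟩ := hvb
    have hac : (⟨a, ha⟩ : Z) ∈ c.supp := (c.mem_supp_congr_adj ha').1 hvc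
    have hbc : (⟨b, hb⟩ : Z) ∈ c.supp := (c.mem_supp_congr_adj hb').1 hvc
    exact ⟨⟨⟨a, ha⟩, hac⟩, ⟨⟨b, hb⟩, hbc⟩, fun e => hab (by simpa using e), ha', hb'⟩
  have hz0 : (⟨z, hz⟩ : Z) ∈ c.supp := rfl
  obtain ⟨a, b, hab, _, _⟩ := hnb ⟨_, hz0⟩
  have : Nontrivial c := ⟨a, b, hab⟩
  have : Fintype Z := Fintype.ofFinite _
  have : Fintype c := Fintype.ofFinite _
  obtain ⟨v, hv⟩ := htree.exists_vert_degree_one_of_nontrivial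
  obtain ⟨a, b, hab, ha, hb⟩ := hnb v
  obtain ⟨w, _, hw⟩ := SimpleGraph.degree_eq_one_iff_existsUnique_adj.1 hv
  exact hab ((hw a ha).trans (hw b hb).symm)

/-- The vertices of a cycle form such a set. -/
theorem exists_twoNeighbors (h : ¬ G.IsAcyclic) : ∃ Z : Set V, Z.Nonempty ∧ TwoNeighbors G Z := by
  rw [SimpleGraph.IsAcyclic] at h
  push Not at h
  obtain ⟨v, w, hw⟩ := h
  refine ⟨{u | u ∈ w.support}, ⟨v, w.start_mem_support⟩, fun z hz => ?_⟩
  have h2 := hw.ncard_neighborSet_toSubgraph_eq_two hz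
  obtain ⟨a, b, hab, he⟩ := Set.ncard_eq_two.1 h2
  have ha : w.toSubgraph.Adj z a := by
    have : a ∈ w.toSubgraph.neighborSet z := he ▸ Or.inl rfl
    exact this
  have hb : w.toSubgraph.Adj z b := by
    have : b ∈ w.toSubgraph.neighborSet z := he ▸ Or.inr rfl
    exact this
  refine ⟨a, ?_, b, ?_, hab, ha.adj_sub, hb.adj_sub⟩
  · exact (w.mem_verts_toSubgraph).1 ha.snd_mem
  · exact (w.mem_verts_toSubgraph).1 hb.snd_mem

end Graph

section Closed

variable {ι κ : Type*}

/-- Every box of `X` shares its row with another box of `X`, and also its column. -/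
def ClosedBoxes (X : Finset (ι × κ)) : Prop :=
  ∀ p ∈ X, (∃ q ∈ X, q ≠ p ∧ q.1 = p.1) ∧ ∃ q ∈ X, q ≠ p ∧ q.2 = p.2

/-- Repeatedly discard the rows and columns that receive no arrow from the set; it stays
self-feeding and nonempty. When nothing more is discarded, every line has an outgoing and an
incoming arrow, and these are different boxes as `A` and `B` are disjoint. The boxes of `A ∪ B` on
the remaining lines are then closed. -/
theorem exists_closedBoxes_of_selfFeeding [DecidableEq ι] [DecidableEq κ] {A B : Finset (ι × κ)}
    (hAB : Disjoint A B) {P : Finset ι} {Q : Finset κ} (h : SelfFeeding A B P Q)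
    (hne : P.Nonempty ∨ Q.Nonempty) :
    ∃ X ⊆ A ∪ B, X.Nonempty ∧ ClosedBoxes X := by
  classical
  induction hn : P.card + Q.card using Nat.strong_induction_on generalizing P Q with
  | _ n ih =>
    set P' := P.filter fun i => ∃ j ∈ Q, (i, j) ∈ B with hP'
    set Q' := Q.filter fun j => ∃ i ∈ P, (i, j) ∈ A with hQ'
    have h' : SelfFeeding A B P' Q' := by
      constructor
      · intro i hi
        rw [hP', Finset.mem_filter] at hi
        obtain ⟨j, hj, hij⟩ := h.1 i hi.1
        exact ⟨j, Finset.mem_filter.2 ⟨hj, i, hi.1, hij⟩, hij⟩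
      · intro j hj
        rw [hQ', Finset.mem_filter] at hj
        obtain ⟨i, hi, hij⟩ := h.2 j hj.1
        exact ⟨i, Finset.mem_filter.2 ⟨hi, j, hj.1, hij⟩, hij⟩
    have hne' : P'.Nonempty ∨ Q'.Nonempty := by
      rcases hne with ⟨i, hi⟩ | ⟨j, hj⟩
      · obtain ⟨j, hj, hij⟩ := h.1 i hi
        exact Or.inr ⟨j, Finset.mem_filter.2 ⟨hj, i, hi, hij⟩⟩
      · obtain ⟨i, hi, hij⟩ := h.2 j hj
        exact Or.inl ⟨i, Finset.mem_filter.2 ⟨hi, j, hj, hij⟩⟩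
    by_cases hlt : P'.card + Q'.card < n
    · exact ih _ hlt h' hne' rfl
    have hPs : P' ⊆ P := Finset.filter_subset _ _
    have hQs : Q' ⊆ Q := Finset.filter_subset _ _
    have c1 := Finset.card_le_card hPs
    have c2 := Finset.card_le_card hQs
    have eP : P' = P := Finset.eq_of_subset_of_card_le hPs (by omega)
    have eQ : Q' = Q := Finset.eq_of_subset_of_card_le hQs (by omega)
    refine ⟨(A ∪ B).filter fun p => p.1 ∈ P ∧ p.2 ∈ Q, Finset.filter_subset _ _, ?_, ?_⟩
    · rcases hne with ⟨i, hi⟩ | ⟨j, hj⟩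
      · obtain ⟨j, hj, hij⟩ := h.1 i hi
        exact ⟨(i, j), Finset.mem_filter.2 ⟨Finset.mem_union_left _ hij, hi, hj⟩⟩
      · obtain ⟨i, hi, hij⟩ := h.2 j hj
        exact ⟨(i, j), Finset.mem_filter.2 ⟨Finset.mem_union_right _ hij, hi, hj⟩⟩
    · intro p hp
      rw [Finset.mem_filter] at hp
      obtain ⟨_, hp1, hp2⟩ := hp
      constructor
      · obtain ⟨j, hj, hij⟩ := h.1 p.1 hp1
        have hp1' := hp1
        rw [← eP, hP', Finset.mem_filter] at hp1'
        obtain ⟨_, j', hj', hij'⟩ := hp1'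
        by_cases e : (p.1, j) = p
        · refine ⟨(p.1, j'), Finset.mem_filter.2 ⟨Finset.mem_union_right _ hij', hp1, hj'⟩, ?_, rfl⟩
          intro e'
          exact Finset.disjoint_left.1 hAB hij (e.trans e'.symm ▸ hij')
        · exact ⟨(p.1, j), Finset.mem_filter.2 ⟨Finset.mem_union_left _ hij, hp1, hj⟩, e, rfl⟩
      · obtain ⟨i, hi, hij⟩ := h.2 p.2 hp2
        have hp2' := hp2
        rw [← eQ, hQ', Finset.mem_filter] at hp2'
        obtain ⟨_, i', hi', hij'⟩ := hp2'
        by_cases e : (i, p.2) = p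
        · refine ⟨(i', p.2), Finset.mem_filter.2 ⟨Finset.mem_union_left _ hij', hi', hp2⟩, ?_, rfl⟩
          intro e'
          exact Finset.disjoint_left.1 hAB hij' (e'.trans e.symm ▸ hij)
        · exact ⟨(i, p.2), Finset.mem_filter.2 ⟨Finset.mem_union_right _ hij, hi, hp2⟩, e, rfl⟩

/-- Of two boxes in a row at most one lies in `A`, so every row of `X` carries a box of `B`;
likewise every column carries a box of `A`. Following these boxes against their arrows gives
injections rows to columns and columns to rows. By finiteness both are surjective, which produces an
outgoing arrow at every line. -/
theorem ClosedBoxes.selfFeeding [DecidableEq ι] [DecidableEq κ] {A B X : Finset (ι × κ)}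
    (hA : ∀ p ∈ A, ∀ q ∈ A, p.1 = q.1 → p = q) (hB : ∀ p ∈ B, ∀ q ∈ B, p.2 = q.2 → p = q)
    (hX : ClosedBoxes X) (hXD : X ⊆ A ∪ B) (hne : X.Nonempty) :
    SelfFeeding A B (X.image Prod.fst) (X.image Prod.snd) := by
  obtain ⟨⟨i₀, j₀⟩, -⟩ := hne
  have : Nonempty ι := ⟨i₀⟩
  have : Nonempty κ := ⟨j₀⟩
  have h1 : ∀ i ∈ X.image Prod.fst, ∃ j ∈ X.image Prod.snd, (i, j) ∈ B := by
    intro i hi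
    obtain ⟨p, hp, rfl⟩ := Finset.mem_image.1 hi
    obtain ⟨q, hq, hqp, hqp1⟩ := (hX p hp).1
    rcases Finset.mem_union.1 (hXD hp) with hpA | hpB
    · rcases Finset.mem_union.1 (hXD hq) with hqA | hqB
      · exact absurd (hA q hqA p hpA hqp1) hqp
      · exact ⟨q.2, Finset.mem_image_of_mem _ hq, hqp1 ▸ hqB⟩
    · exact ⟨p.2, Finset.mem_image_of_mem _ hp, hpB⟩
  have h2 : ∀ j ∈ X.image Prod.snd, ∃ i ∈ X.image Prod.fst, (i, j) ∈ A := by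
    intro i hi
    obtain ⟨p, hp, rfl⟩ := Finset.mem_image.1 hi
    obtain ⟨q, hq, hqp, hqp1⟩ := (hX p hp).2
    rcases Finset.mem_union.1 (hXD hp) with hpA | hpB
    · exact ⟨p.1, Finset.mem_image_of_mem _ hp, hpA⟩
    · rcases Finset.mem_union.1 (hXD hq) with hqA | hqB
      · exact ⟨q.1, Finset.mem_image_of_mem _ hq, hqp1 ▸ hqA⟩
      · exact absurd (hB q hqB p hpB hqp1) hqp
  choose! f hf hfB using h1
  choose! g hg hgA using h2
  have hfi : Set.InjOn f (X.image Prod.fst) := fun i hi i' hi' e =>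
    congrArg Prod.fst (hB _ (hfB i hi) _ (hfB i' hi') e)
  have hgi : Set.InjOn g (X.image Prod.snd) := fun i hi i' hi' e =>
    congrArg Prod.snd (hA _ (hgA i hi) _ (hgA i' hi') e)
  have c1 := Finset.card_le_card_of_injOn f hf hfi
  have c2 := Finset.card_le_card_of_injOn g hg hgi
  constructor
  · intro i hi
    obtain ⟨j, hj, rfl⟩ := Finset.surjOn_of_injOn_of_card_le g hg hgi c1 hi
    exact ⟨j, hj, hgA j hj⟩
  · intro j hj
    obtain ⟨i, hi, rfl⟩ := Finset.surjOn_of_injOn_of_card_le f hf hfi c2 hj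
    exact ⟨i, hi, hfB i hi⟩

/-- A box common to `A` and `B` is a directed 2-cycle and lies in the core. For disjoint `A` and
`B`, self-feeding sets and closed sets produce each other. -/
theorem noCore_iff [Fintype ι] [Fintype κ] [LinearOrder ι] [LinearOrder κ] {A B : Finset (ι × κ)}
    (hA : ∀ p ∈ A, ∀ q ∈ A, p.1 = q.1 → p = q) (hB : ∀ p ∈ B, ∀ q ∈ B, p.2 = q.2 → p = q) :
    NoCore A B ↔ Disjoint A B ∧ ∀ X ⊆ A ∪ B, X.Nonempty → ¬ ClosedBoxes X := by
  constructor
  · rintro ⟨h1, h2⟩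
    constructor
    · refine Finset.disjoint_left.2 fun p hpA hpB => ?_
      have : SelfFeeding A B {p.1} {p.2} := by
        constructor
        · intro i hi
          exact ⟨p.2, Finset.mem_singleton_self _, by rw [Finset.mem_singleton.1 hi]; exact hpA⟩
        · intro i hi
          exact ⟨p.1, Finset.mem_singleton_self _, by rw [Finset.mem_singleton.1 hi]; exact hpB⟩
      have := this.subset_coreRows (Finset.mem_singleton_self _)
      rw [h1] at this; simp at this
    · rintro X hX ⟨p, hp⟩ hc
      have := (hc.selfFeeding hA hB hX ⟨p, hp⟩).subset_coreRows (Finset.mem_image_of_mem _ hp)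
      rw [h1] at this; simp at this
  · rintro ⟨h1, h2⟩
    by_contra hc
    have hne : (coreRows A B).Nonempty ∨ (coreCols A B).Nonempty := by
      by_contra h
      rw [not_or, Finset.not_nonempty_iff_eq_empty, Finset.not_nonempty_iff_eq_empty] at h
      exact hc h
    obtain ⟨X, hX, hXne, hXc⟩ := exists_closedBoxes_of_selfFeeding h1 (selfFeeding_core A B) hne
    exact h2 X hX hXne hXc

end Closed

section Forest

variable {k m : ℕ} {D : Finset (Fin k × Fin m)}

theorem exists_nextBox_right {d e : D} (h1 : d.1.1 = e.1.1) (h2 : d.1.2 < e.1.2) :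
    ∃ c : D, c.1.1 = d.1.1 ∧ d.1.2 < c.1.2 ∧ c.1.2 ≤ e.1.2 ∧ (boxGraph D).Adj d c := by
  obtain ⟨c, hc, hmin⟩ := (D.filter fun c => c.1 = d.1.1 ∧ d.1.2 < c.2).exists_min_image Prod.snd
    ⟨e.1, Finset.mem_filter.2 ⟨e.2, h1.symm, h2⟩⟩
  rw [Finset.mem_filter] at hc
  refine ⟨⟨c, hc.1⟩, hc.2.1, hc.2.2, hmin e.1 (Finset.mem_filter.2 ⟨e.2, h1.symm, h2⟩), ?_⟩
  rw [boxGraph, SimpleGraph.fromRel_adj]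
  refine ⟨fun e => ?_, Or.inl (Or.inl ⟨hc.2.1.symm, hc.2.2, fun x hx hx1 hx2 => ?_⟩)⟩
  · have := hc.2.2; rw [e] at this; exact lt_irrefl _ this
  · exact (hmin x (Finset.mem_filter.2 ⟨hx, hx1, hx2.1⟩)).not_gt hx2.2

theorem exists_nextBox_left {d e : D} (h1 : d.1.1 = e.1.1) (h2 : e.1.2 < d.1.2) :
    ∃ c : D, c.1.1 = d.1.1 ∧ c.1.2 < d.1.2 ∧ e.1.2 ≤ c.1.2 ∧ (boxGraph D).Adj d c := by
  obtain ⟨c, hc, hmax⟩ := (D.filter fun c => c.1 = d.1.1 ∧ c.2 < d.1.2).exists_max_image Prod.snd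
    ⟨e.1, Finset.mem_filter.2 ⟨e.2, h1.symm, h2⟩⟩
  rw [Finset.mem_filter] at hc
  refine ⟨⟨c, hc.1⟩, hc.2.1, hc.2.2, hmax e.1 (Finset.mem_filter.2 ⟨e.2, h1.symm, h2⟩), ?_⟩
  rw [boxGraph, SimpleGraph.fromRel_adj]
  refine ⟨fun e => ?_, Or.inr (Or.inl ⟨hc.2.1, hc.2.2, fun x hx hx1 hx2 => ?_⟩)⟩
  · have := hc.2.2; rw [e] at this; exact lt_irrefl _ this
  · exact (hmax x (Finset.mem_filter.2 ⟨hx, hx1.trans hc.2.1, hx2.2⟩)).not_gt hx2.1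

theorem exists_nextBox_down {d e : D} (h1 : d.1.2 = e.1.2) (h2 : d.1.1 < e.1.1) :
    ∃ c : D, c.1.2 = d.1.2 ∧ d.1.1 < c.1.1 ∧ c.1.1 ≤ e.1.1 ∧ (boxGraph D).Adj d c := by
  obtain ⟨c, hc, hmin⟩ := (D.filter fun c => c.2 = d.1.2 ∧ d.1.1 < c.1).exists_min_image Prod.fst
    ⟨e.1, Finset.mem_filter.2 ⟨e.2, h1.symm, h2⟩⟩
  rw [Finset.mem_filter] at hc
  refine ⟨⟨c, hc.1⟩, hc.2.1, hc.2.2, hmin e.1 (Finset.mem_filter.2 ⟨e.2, h1.symm, h2⟩), ?_⟩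
  rw [boxGraph, SimpleGraph.fromRel_adj]
  refine ⟨fun e => ?_, Or.inl (Or.inr ⟨hc.2.1.symm, hc.2.2, fun x hx hx1 hx2 => ?_⟩)⟩
  · have := hc.2.2; rw [e] at this; exact lt_irrefl _ this
  · exact (hmin x (Finset.mem_filter.2 ⟨hx, hx1, hx2.1⟩)).not_gt hx2.2

theorem exists_nextBox_up {d e : D} (h1 : d.1.2 = e.1.2) (h2 : e.1.1 < d.1.1) :
    ∃ c : D, c.1.2 = d.1.2 ∧ c.1.1 < d.1.1 ∧ e.1.1 ≤ c.1.1 ∧ (boxGraph D).Adj d c := by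
  obtain ⟨c, hc, hmax⟩ := (D.filter fun c => c.2 = d.1.2 ∧ c.1 < d.1.1).exists_max_image Prod.fst
    ⟨e.1, Finset.mem_filter.2 ⟨e.2, h1.symm, h2⟩⟩
  rw [Finset.mem_filter] at hc
  refine ⟨⟨c, hc.1⟩, hc.2.1, hc.2.2, hmax e.1 (Finset.mem_filter.2 ⟨e.2, h1.symm, h2⟩), ?_⟩
  rw [boxGraph, SimpleGraph.fromRel_adj]
  refine ⟨fun e => ?_, Or.inr (Or.inr ⟨hc.2.1, hc.2.2, fun x hx hx1 hx2 => ?_⟩)⟩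
  · have := hc.2.2; rw [e] at this; exact lt_irrefl _ this
  · exact (hmax x (Finset.mem_filter.2 ⟨hx, hx1.trans hc.2.1, hx2.2⟩)).not_gt hx2.1

/-- Boxes of `X` on a common line need not be adjacent in the graph, as other boxes of `D` may lie
between them. So `Z` adds all boxes of `D` between two boxes of `X` on a line. A box of `X` has a
neighbor in `Z` along its row and one along its column; an added box has one on each side. -/
theorem ClosedBoxes.not_isForest {X : Finset (Fin k × Fin m)} (hX : ClosedBoxes X) (hXD : X ⊆ D)
    (hne : X.Nonempty) : ¬ IsForest D := by
  let Z : Set D := {d | (∃ a ∈ X, ∃ b ∈ X, a.1 = d.1.1 ∧ b.1 = d.1.1 ∧ a.2 ≤ d.1.2 ∧ d.1.2 ≤ b.2) ∨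
    (∃ a ∈ X, ∃ b ∈ X, a.2 = d.1.2 ∧ b.2 = d.1.2 ∧ a.1 ≤ d.1.1 ∧ d.1.1 ≤ b.1)}
  obtain ⟨p, hp⟩ := hne
  refine TwoNeighbors.not_isAcyclic (Z := Z) (fun z hz => ?_)
    ⟨⟨p, hXD hp⟩, Or.inl ⟨p, hp, p, hp, rfl, rfl, le_rfl, le_rfl⟩⟩
  by_cases hzX : z.1 ∈ X
  · obtain ⟨⟨q, hq, hqz, hq1⟩, ⟨r, hr, hrz, hr2⟩⟩ := hX z.1 hzX
    have hq2 : q.2 ≠ z.1.2 := fun e => hqz (Prod.ext hq1 e)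
    have hr1 : r.1 ≠ z.1.1 := fun e => hrz (Prod.ext e hr2)
    have hrow : ∃ a ∈ Z, a.1.1 = z.1.1 ∧ a.1.2 ≠ z.1.2 ∧ (boxGraph D).Adj z a := by
      rcases lt_or_gt_of_ne hq2 with h | h
      · obtain ⟨c, h1, h2, h3, h4⟩ := exists_nextBox_left (d := z) (e := ⟨q, hXD hq⟩) hq1.symm h
        exact ⟨c, Or.inl ⟨q, hq, z.1, hzX, hq1.trans h1.symm, h1.symm, h3, h2.le⟩, h1, h2.ne, h4⟩
      · obtain ⟨c, h1, h2, h3, h4⟩ := exists_nextBox_right (d := z) (e := ⟨q, hXD hq⟩) hq1.symm h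
        exact ⟨c, Or.inl ⟨z.1, hzX, q, hq, h1.symm, hq1.trans h1.symm, h2.le, h3⟩, h1, h2.ne', h4⟩
    have hcol : ∃ a ∈ Z, a.1.2 = z.1.2 ∧ (boxGraph D).Adj z a := by
      rcases lt_or_gt_of_ne hr1 with h | h
      · obtain ⟨c, h1, h2, h3, h4⟩ := exists_nextBox_up (d := z) (e := ⟨r, hXD hr⟩) hr2.symm h
        exact ⟨c, Or.inr ⟨r, hr, z.1, hzX, hr2.trans h1.symm, h1.symm, h3, h2.le⟩, h1, h4⟩
      · obtain ⟨c, h1, h2, h3, h4⟩ := exists_nextBox_down (d := z) (e := ⟨r, hXD hr⟩) hr2.symm h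
        exact ⟨c, Or.inr ⟨z.1, hzX, r, hr, h1.symm, hr2.trans h1.symm, h2.le, h3⟩, h1, h4⟩
    obtain ⟨a, haZ, _, ha2, ha⟩ := hrow
    obtain ⟨b, hbZ, hb2, hb⟩ := hcol
    exact ⟨a, haZ, b, hbZ, fun e => ha2 (e ▸ hb2), ha, hb⟩
  · rcases hz with ⟨a, ha, b, hb, h1, h2, h3, h4⟩ | ⟨a, ha, b, hb, h1, h2, h3, h4⟩
    · have h3' : a.2 < z.1.2 := lt_of_le_of_ne h3 fun e => hzX (Prod.ext h1 e ▸ ha)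
      have h4' : z.1.2 < b.2 := lt_of_le_of_ne h4 fun e => hzX (Prod.ext h2 e.symm ▸ hb)
      obtain ⟨c, c1, c2, c3, c4⟩ := exists_nextBox_left (d := z) (e := ⟨a, hXD ha⟩) h1.symm h3'
      obtain ⟨d, d1, d2, d3, d4⟩ := exists_nextBox_right (d := z) (e := ⟨b, hXD hb⟩) h2.symm h4'
      refine ⟨c, Or.inl ⟨a, ha, b, hb, h1.trans c1.symm, h2.trans c1.symm, c3, (c2.trans h4').le⟩,
        d, Or.inl ⟨a, ha, b, hb, h1.trans d1.symm, h2.trans d1.symm, (h3'.trans d2).le, d3⟩, ?_,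
        c4, d4⟩
      rintro rfl; exact lt_asymm c2 d2
    · have h3' : a.1 < z.1.1 := lt_of_le_of_ne h3 fun e => hzX (Prod.ext e h1 ▸ ha)
      have h4' : z.1.1 < b.1 := lt_of_le_of_ne h4 fun e => hzX (Prod.ext e.symm h2 ▸ hb)
      obtain ⟨c, c1, c2, c3, c4⟩ := exists_nextBox_up (d := z) (e := ⟨a, hXD ha⟩) h1.symm h3'
      obtain ⟨d, d1, d2, d3, d4⟩ := exists_nextBox_down (d := z) (e := ⟨b, hXD hb⟩) h2.symm h4'
      refine ⟨c, Or.inr ⟨a, ha, b, hb, h1.trans c1.symm, h2.trans c1.symm, c3, (c2.trans h4').le⟩,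
        d, Or.inr ⟨a, ha, b, hb, h1.trans d1.symm, h2.trans d1.symm, (h3'.trans d2).le, d3⟩, ?_,
        c4, d4⟩
      rintro rfl; exact lt_asymm c2 d2

theorem boxGraph_adj {a b : D} (h : (boxGraph D).Adj a b) :
    a ≠ b ∧ ((a.1.1 = b.1.1 ∧ ∀ c ∈ D, c.1 = a.1.1 →
        ¬ (a.1.2 < c.2 ∧ c.2 < b.1.2) ∧ ¬ (b.1.2 < c.2 ∧ c.2 < a.1.2)) ∨
      (a.1.2 = b.1.2 ∧ ∀ c ∈ D, c.2 = a.1.2 →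
        ¬ (a.1.1 < c.1 ∧ c.1 < b.1.1) ∧ ¬ (b.1.1 < c.1 ∧ c.1 < a.1.1))) := by
  rw [boxGraph, SimpleGraph.fromRel_adj] at h
  refine ⟨h.1, ?_⟩
  rcases h.2 with (⟨h1, h2, h3⟩ | ⟨h1, h2, h3⟩) | (⟨h1, h2, h3⟩ | ⟨h1, h2, h3⟩)
  · exact Or.inl ⟨h1, fun c hc hca => ⟨h3 c hc hca, fun h => lt_asymm h2 (h.1.trans h.2)⟩⟩
  · exact Or.inr ⟨h1, fun c hc hca => ⟨h3 c hc hca, fun h => lt_asymm h2 (h.1.trans h.2)⟩⟩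
  · exact Or.inl ⟨h1.symm, fun c hc hca =>
      ⟨fun h => lt_asymm h2 (h.1.trans h.2), h3 c hc (hca.trans h1.symm)⟩⟩
  · exact Or.inr ⟨h1.symm, fun c hc hca =>
      ⟨fun h => lt_asymm h2 (h.1.trans h.2), h3 c hc (hca.trans h1.symm)⟩⟩

/-- A box at the end of a row of `Z` has a neighbor in its column. -/
theorem exists_col_mate {Z : Set D} {l : D} (hl : ∃ a ∈ Z, ∃ b ∈ Z, a ≠ b ∧ (boxGraph D).Adj l a ∧
      (boxGraph D).Adj l b)
    (hext : (∀ z ∈ Z, z.1.1 = l.1.1 → l.1.2 ≤ z.1.2) ∨ ∀ z ∈ Z, z.1.1 = l.1.1 → z.1.2 ≤ l.1.2) :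
    ∃ q ∈ Z, q ≠ l ∧ q.1.2 = l.1.2 := by
  obtain ⟨a, ha, b, hb, hab, hla, hlb⟩ := hl
  obtain ⟨na, h | h⟩ := boxGraph_adj hla
  · obtain ⟨nb, h' | h'⟩ := boxGraph_adj hlb
    -- Two neighbors in the row of an extreme box would lie on the same side of it, so the nearer
    -- one would separate the box from the other.
    · exfalso
      have ea := h.2 b.1 b.2 h'.1.symm
      have eb := h'.2 a.1 a.2 h.1.symm
      have n1 : l.1.2 ≠ a.1.2 := fun e => na (Subtype.ext (Prod.ext h.1 e))
      have n2 : l.1.2 ≠ b.1.2 := fun e => nb (Subtype.ext (Prod.ext h'.1 e))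
      have n3 : a.1.2 ≠ b.1.2 := fun e => hab (Subtype.ext (Prod.ext (h.1.symm.trans h'.1) e))
      rcases hext with hx | hx
      · have x1 := hx a ha h.1.symm
        have x2 := hx b hb h'.1.symm
        rcases lt_or_gt_of_ne n3 with h3 | h3
        · exact eb.1 ⟨lt_of_le_of_ne x1 n1, h3⟩
        · exact ea.1 ⟨lt_of_le_of_ne x2 n2, h3⟩
      · have x1 := hx a ha h.1.symm
        have x2 := hx b hb h'.1.symm
        rcases lt_or_gt_of_ne n3 with h3 | h3
        · exact ea.2 ⟨h3, lt_of_le_of_ne x2 n2.symm⟩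
        · exact eb.2 ⟨h3, lt_of_le_of_ne x1 n1.symm⟩
    · exact ⟨b, hb, nb.symm, h'.1.symm⟩
  · exact ⟨a, ha, na.symm, h.1.symm⟩

/-- A box at the end of a column of `Z` has a neighbor in its row. -/
theorem exists_row_mate {Z : Set D} {l : D} (hl : ∃ a ∈ Z, ∃ b ∈ Z, a ≠ b ∧ (boxGraph D).Adj l a ∧
      (boxGraph D).Adj l b)
    (hext : (∀ z ∈ Z, z.1.2 = l.1.2 → l.1.1 ≤ z.1.1) ∨ ∀ z ∈ Z, z.1.2 = l.1.2 → z.1.1 ≤ l.1.1) :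
    ∃ q ∈ Z, q ≠ l ∧ q.1.1 = l.1.1 := by
  obtain ⟨a, ha, b, hb, hab, hla, hlb⟩ := hl
  obtain ⟨na, h | h⟩ := boxGraph_adj hla
  · exact ⟨a, ha, na.symm, h.1.symm⟩
  · obtain ⟨nb, h' | h'⟩ := boxGraph_adj hlb
    · exact ⟨b, hb, nb.symm, h'.1.symm⟩
    · exfalso
      have ea := h.2 b.1 b.2 h'.1.symm
      have eb := h'.2 a.1 a.2 h.1.symm
      have n1 : l.1.1 ≠ a.1.1 := fun e => na (Subtype.ext (Prod.ext e h.1))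
      have n2 : l.1.1 ≠ b.1.1 := fun e => nb (Subtype.ext (Prod.ext e h'.1))
      have n3 : a.1.1 ≠ b.1.1 := fun e => hab (Subtype.ext (Prod.ext e (h.1.symm.trans h'.1)))
      rcases hext with hx | hx
      · have x1 := hx a ha h.1.symm
        have x2 := hx b hb h'.1.symm
        rcases lt_or_gt_of_ne n3 with h3 | h3
        · exact eb.1 ⟨lt_of_le_of_ne x1 n1, h3⟩
        · exact ea.1 ⟨lt_of_le_of_ne x2 n2, h3⟩
      · have x1 := hx a ha h.1.symm
        have x2 := hx b hb h'.1.symm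
        rcases lt_or_gt_of_ne n3 with h3 | h3
        · exact ea.2 ⟨h3, lt_of_le_of_ne x2 n2.symm⟩
        · exact eb.2 ⟨h3, lt_of_le_of_ne x1 n1.symm⟩

/-- In a row of `Z` with two boxes, every box has a mate with mates in row and column. -/
theorem exists_row_corner {Z : Set D} (hZ : TwoNeighbors (boxGraph D) Z) {z y : D} (hz : z ∈ Z)
    (hy : y ∈ Z) (hyz : y ≠ z) (h1 : y.1.1 = z.1.1) :
    ∃ c ∈ Z, c ≠ z ∧ c.1.1 = z.1.1 ∧ (∃ q ∈ Z, q ≠ c ∧ q.1.1 = c.1.1) ∧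
      ∃ q ∈ Z, q ≠ c ∧ q.1.2 = c.1.2 := by
  classical
  have hfin : Set.Finite {c | c ∈ Z ∧ c.1.1 = z.1.1} := Set.toFinite _
  have hne : {c | c ∈ Z ∧ c.1.1 = z.1.1}.Nonempty := ⟨z, hz, rfl⟩
  have hy2 : y.1.2 ≠ z.1.2 := fun e => hyz (Subtype.ext (Prod.ext h1 e))
  rcases lt_or_gt_of_ne hy2 with h | h
  · obtain ⟨c, hc, hmin⟩ := Set.exists_min_image _ (fun c : D => c.1.2) hfin hne
    have hcz : c ≠ z := by
      rintro rfl; exact (hmin y ⟨hy, h1⟩).not_gt h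
    refine ⟨c, hc.1, hcz, hc.2, ⟨z, hz, hcz.symm, hc.2.symm⟩, ?_⟩
    exact exists_col_mate (hZ c hc.1) (Or.inl fun w hw hwc => hmin w ⟨hw, hwc.trans hc.2⟩)
  · obtain ⟨c, hc, hmax⟩ := Set.exists_max_image _ (fun c : D => c.1.2) hfin hne
    have hcz : c ≠ z := by
      rintro rfl; exact (hmax y ⟨hy, h1⟩).not_gt h
    refine ⟨c, hc.1, hcz, hc.2, ⟨z, hz, hcz.symm, hc.2.symm⟩, ?_⟩
    exact exists_col_mate (hZ c hc.1) (Or.inr fun w hw hwc => hmax w ⟨hw, hwc.trans hc.2⟩)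

/-- In a column of `Z` with two boxes, every box has a mate with mates in row and column. -/
theorem exists_col_corner {Z : Set D} (hZ : TwoNeighbors (boxGraph D) Z) {z y : D} (hz : z ∈ Z)
    (hy : y ∈ Z) (hyz : y ≠ z) (h1 : y.1.2 = z.1.2) :
    ∃ c ∈ Z, c ≠ z ∧ c.1.2 = z.1.2 ∧ (∃ q ∈ Z, q ≠ c ∧ q.1.1 = c.1.1) ∧
      ∃ q ∈ Z, q ≠ c ∧ q.1.2 = c.1.2 := by
  classical
  have hfin : Set.Finite {c | c ∈ Z ∧ c.1.2 = z.1.2} := Set.toFinite _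
  have hne : {c | c ∈ Z ∧ c.1.2 = z.1.2}.Nonempty := ⟨z, hz, rfl⟩
  have hy2 : y.1.1 ≠ z.1.1 := fun e => hyz (Subtype.ext (Prod.ext e h1))
  rcases lt_or_gt_of_ne hy2 with h | h
  · obtain ⟨c, hc, hmin⟩ := Set.exists_min_image _ (fun c : D => c.1.1) hfin hne
    have hcz : c ≠ z := by
      rintro rfl; exact (hmin y ⟨hy, h1⟩).not_gt h
    refine ⟨c, hc.1, hcz, hc.2, ?_, ⟨z, hz, hcz.symm, hc.2.symm⟩⟩
    exact exists_row_mate (hZ c hc.1) (Or.inl fun w hw hwc => hmin w ⟨hw, hwc.trans hc.2⟩)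
  · obtain ⟨c, hc, hmax⟩ := Set.exists_max_image _ (fun c : D => c.1.1) hfin hne
    have hcz : c ≠ z := by
      rintro rfl; exact (hmax y ⟨hy, h1⟩).not_gt h
    refine ⟨c, hc.1, hcz, hc.2, ?_, ⟨z, hz, hcz.symm, hc.2.symm⟩⟩
    exact exists_row_mate (hZ c hc.1) (Or.inr fun w hw hwc => hmax w ⟨hw, hwc.trans hc.2⟩)

/-- A diagram is a forest iff it contains no nonempty closed set of boxes. -/
theorem isForest_iff : IsForest D ↔ ∀ X ⊆ D, X.Nonempty → ¬ ClosedBoxes X := by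
  classical
  constructor
  · intro h X hXD hne hX
    exact hX.not_isForest hXD hne h
  · intro h
    by_contra hc
    obtain ⟨Z, hZne, hZ⟩ := exists_twoNeighbors hc
    -- Boxes passed straight through have mates in one direction only and are dropped; the corners
    -- remain. The ends of a row or column of `Z` are corners, so every corner has mates that are
    -- corners.
    let P : D → Prop := fun c => c ∈ Z ∧ (∃ q ∈ Z, q ≠ c ∧ q.1.1 = c.1.1) ∧
      ∃ q ∈ Z, q ≠ c ∧ q.1.2 = c.1.2
    let X : Finset (Fin k × Fin m) := (Finset.univ.filter P).map (Function.Embedding.subtype _)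
    have hmem : ∀ c : D, P c → c.1 ∈ X := fun c hc =>
      Finset.mem_map.2 ⟨c, by simpa using hc, rfl⟩
    have hmem' : ∀ p ∈ X, ∃ c : D, P c ∧ c.1 = p := fun p hp => by
      obtain ⟨c, hc, rfl⟩ := Finset.mem_map.1 hp
      exact ⟨c, by simpa using hc, rfl⟩
    refine h X (fun p hp => ?_) ?_ ?_
    · obtain ⟨c, _, rfl⟩ := hmem' p hp; exact c.2
    · obtain ⟨z, hz⟩ := hZne
      obtain ⟨a, ha, b, hb, hab, hza, hzb⟩ := hZ z hz
      obtain ⟨na, h' | h'⟩ := boxGraph_adj hza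
      · obtain ⟨c, h1, h2, h3, h4, h5⟩ := exists_row_corner hZ hz ha na.symm h'.1.symm
        exact ⟨c.1, hmem c ⟨h1, h4, h5⟩⟩
      · obtain ⟨c, h1, h2, h3, h4, h5⟩ := exists_col_corner hZ hz ha na.symm h'.1.symm
        exact ⟨c.1, hmem c ⟨h1, h4, h5⟩⟩
    · intro p hp
      obtain ⟨z, ⟨hz, ⟨q, hq, hqz, hq1⟩, ⟨r, hr, hrz, hr2⟩⟩, rfl⟩ := hmem' p hp
      constructor
      · obtain ⟨c, h1, h2, h3, h4, h5⟩ := exists_row_corner hZ hz hq hqz hq1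
        exact ⟨c.1, hmem c ⟨h1, h4, h5⟩, fun e => h2 (Subtype.ext e), h3⟩
      · obtain ⟨c, h1, h2, h3, h4, h5⟩ := exists_col_corner hZ hz hr hrz hr2
        exact ⟨c.1, hmem c ⟨h1, h4, h5⟩, fun e => h2 (Subtype.ext e), h3⟩

end Forest

end FominKirillov

/-! ### Equivalence of labelings -/

namespace FominKirillov

section Equivalence

variable {k m : ℕ} {D : Finset (Fin k × Fin m)}

/-- The labels of any two boxes in the same row or column are in the same order. -/
def SamePrec (L L' : Labeling D) : Prop :=
  ∀ a b : D, (a.1.1 = b.1.1 ∨ a.1.2 = b.1.2) → (L a < L b ↔ L' a < L' b)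

theorem SamePrec.symm {L L' : Labeling D} (h : SamePrec L L') : SamePrec L' L :=
  fun a b hab => (h a b hab).symm

theorem SamePrec.trans {L L' L'' : Labeling D} (h : SamePrec L L') (h' : SamePrec L' L'') :
    SamePrec L L'' := fun a b hab => (h a b hab).trans (h' a b hab)

theorem CommStep.samePrec {L L' : Labeling D} (h : CommStep L L') : SamePrec L L' := by
  obtain ⟨p, q, hpq, hr, hc, rfl⟩ := h
  intro a b hab
  have hne : ¬ (L a = p ∧ L b = q) ∧ ¬ (L a = q ∧ L b = p) := by
    constructor
    · rintro ⟨rfl, rfl⟩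
      simp only [Labeling.row, Labeling.col, Equiv.symm_apply_apply] at hr hc
      exact hab.elim hr hc
    · rintro ⟨rfl, rfl⟩
      simp only [Labeling.row, Labeling.col, Equiv.symm_apply_apply] at hr hc
      exact hab.elim (fun h => hr h.symm) (fun h => hc h.symm)
  simp only [Equiv.trans_apply, Equiv.swap_apply_def]
  simp only [Fin.ext_iff] at hne
  split_ifs <;> simp only [Fin.ext_iff, Fin.lt_def] at * <;> omega

theorem samePrec_of_toClass_eq {L L' : Labeling D} (h : L.toClass = L'.toClass) :
    SamePrec L L' := by
  replace h : Relation.EqvGen CommStep L L' := Quotient.exact h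
  induction h with
  | rel _ _ h => exact h.samePrec
  | refl _ => exact fun _ _ _ => Iff.rfl
  | symm _ _ _ ih => exact ih.symm
  | trans _ _ _ _ _ ih1 ih2 => exact ih1.trans ih2

/-- A strictly increasing permutation of `Fin N` is the identity. -/
theorem labeling_eq_of_lt_imp {L L' : Labeling D} (h : ∀ a b, L a < L b → L' a < L' b) :
    L = L' := by
  have hmono : StrictMono (L.symm.trans L') := fun p q hpq => h _ _ (by simpa using hpq)
  have h1 : (L.symm.trans L') = Equiv.refl _ := by
    have e1 := (hmono.range_inj strictMono_id).1 (by
      rw [(L.symm.trans L').surjective.range_eq, Set.range_id])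
    exact Equiv.ext fun p => congrFun e1 p
  ext a
  have := Equiv.congr_fun h1 (L a)
  simp only [Equiv.trans_apply, Equiv.symm_apply_apply, Equiv.refl_apply] at this
  rw [this]

/-- Bubble sort of `L` towards `L'`. If two boxes with consecutive labels in `L` are in the opposite
order in `L'`, they share neither row nor column, so exchanging them is a commutation step. -/
theorem toClass_eq_of_samePrec {L L' : Labeling D} (h : SamePrec L L') :
    L.toClass = L'.toClass := by
  -- The sum of x · w(x) grows when an inversion of w is removed, and the cube of the number of
  -- boxes bounds it; the difference serves as the termination measure.
  induction hn : D.card * (D.card * D.card)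
      - ∑ x : Fin D.card, (x : ℕ) * ((L.symm.trans L') x : ℕ)
    using Nat.strong_induction_on generalizing L with
  | _ n ih =>
    by_cases hdesc : ∃ p q : Fin D.card, (p : ℕ) + 1 = q ∧ L' (L.symm q) < L' (L.symm p)
    · obtain ⟨p, q, hpq, hlt⟩ := hdesc
      have hlt' : p < q := Fin.lt_def.2 (by omega)
      have hno : ¬ ((L.symm p).1.1 = (L.symm q).1.1 ∨ (L.symm p).1.2 = (L.symm q).1.2) := by
        intro hc
        have := (h _ _ hc).1 (by simpa using hlt')
        exact lt_asymm this hlt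
      rw [not_or] at hno
      have hstep : CommStep L (L.trans (Equiv.swap p q)) := ⟨p, q, hpq, hno.1, hno.2, rfl⟩
      have h1 : L.toClass = Labeling.toClass (L.trans (Equiv.swap p q)) :=
        Quotient.sound (Relation.EqvGen.rel _ _ hstep)
      rw [h1]
      refine ih _ ?_ (hstep.samePrec.symm.trans h) rfl
      set w : Equiv.Perm (Fin D.card) := (L.trans (Equiv.swap p q)).symm.trans L' with hw
      have hw1 : w * Equiv.swap p q = L.symm.trans L' := by
        ext x
        simp [hw, Equiv.Perm.mul_apply]
      have hs := sum_mul_swap_lt w p q hlt' (by simpa [hw] using hlt)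
      rw [hw1] at hs
      have hb : ∑ x : Fin D.card, (x : ℕ) * (w x : ℕ) ≤ D.card * (D.card * D.card) := by
        refine (Finset.sum_le_card_nsmul _ _ (D.card * D.card) fun x _ =>
          Nat.mul_le_mul x.2.le (w x).2.le).trans (by simp)
      omega
    · push Not at hdesc
      have : L = L' := by
        refine labeling_eq_of_lt_imp fun a b hab => ?_
        have hN : 0 < D.card := Fin.pos (L a)
        have key : ∀ d : ℕ, ∀ p q : Fin D.card, (p : ℕ) + d + 1 = q →
            L' (L.symm p) < L' (L.symm q) := by
          intro d
          induction d with
          | zero =>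
            intro p q hpq
            refine lt_of_le_of_ne (hdesc p q hpq) fun e => ?_
            have : p = q := L.symm.injective (L'.injective e)
            rw [this] at hpq; omega
          | succ d ihd =>
            intro p q hpq
            have hq := q.2
            refine (ihd p ⟨q - 1, by omega⟩ (by simp only; omega)).trans ?_
            refine lt_of_le_of_ne (hdesc _ q (by simp only; omega)) fun e => ?_
            have := congrArg Fin.val (L.symm.injective (L'.injective e))
            simp only at this; omega
        have := key ((L b : ℕ) - L a - 1) (L a) (L b) (by have := Fin.lt_def.1 hab; omega)
        simpa using this
      rw [this]

theorem prod_ofFn_swap {R : Type*} [Monoid R] {n : ℕ} (f : Fin n → R) (p q : Fin n)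
    (hpq : (p : ℕ) + 1 = q) (hc : f p * f q = f q * f p) :
    (List.ofFn fun i => f (Equiv.swap p q i)).prod = (List.ofFn f).prod := by
  induction n with
  | zero => exact p.elim0
  | succ n ih =>
    cases p using Fin.cases with
    | zero =>
      cases q using Fin.cases with
      | zero => simp at hpq
      | succ q =>
        cases n with
        | zero => exact q.elim0
        | succ n =>
          have hq : q = 0 := Fin.ext (by simpa using hpq.symm)
          subst hq
          simp only [List.ofFn_succ, List.prod_cons, Equiv.swap_apply_left]
          rw [Equiv.swap_apply_right, ← mul_assoc, ← mul_assoc, hc]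
          congr 3
    | succ p =>
      cases q using Fin.cases with
      | zero => simp at hpq
      | succ q =>
        rw [List.ofFn_succ, List.ofFn_succ, List.prod_cons, List.prod_cons,
          Equiv.swap_apply_of_ne_of_ne (Fin.succ_ne_zero _).symm (Fin.succ_ne_zero _).symm]
        congr 1
        rw [← ih (fun i => f i.succ) p q (by simpa using hpq) hc]
        congr 2
        funext i
        congr 1
        simp only [Equiv.swap_apply_def, Fin.succ_inj]
        split_ifs <;> rfl

theorem monomial_eq_of_toClass_eq {L L' : Labeling D} (h : L.toClass = L'.toClass) :
    L.monomial = L'.monomial := by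
  replace h : Relation.EqvGen CommStep L L' := Quotient.exact h
  induction h with
  | rel L L' h =>
    obtain ⟨p, q, hpq, hr, hc, rfl⟩ := h
    have := prod_ofFn_swap (fun p => gen (Fin.castAdd m (L.row p)) (Fin.natAdd k (L.col p))) p q hpq
      (gen_comm _ _ _ _ (fun e => hr (Fin.castAdd_injective _ _ e))
        (fun e => by have := congrArg Fin.val e; simp at this; omega)
        (fun e => by have := congrArg Fin.val e; simp at this; omega)
        (fun e => hc (Fin.natAdd_injective _ _ e)))
    rw [Labeling.monomial, ← this]
    rfl
  | refl _ => rfl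
  | symm _ _ _ ih => exact ih.symm
  | trans _ _ _ _ _ ih1 ih2 => exact ih1.trans ih2

end Equivalence

/-! ### Labelings as words, and labelings that split -/

section Words

variable {k m : ℕ} {D : Finset (Fin k × Fin m)}

/-- The list of the boxes in the order of their labels. -/
def Labeling.word (L : Labeling D) : List (Fin k × Fin m) := List.ofFn fun p => (L.symm p).1

theorem Labeling.nodup_word (L : Labeling D) : L.word.Nodup :=
  List.nodup_ofFn.2 (Subtype.val_injective.comp L.symm.injective)

theorem Labeling.mem_word (L : Labeling D) {p : Fin k × Fin m} : p ∈ L.word ↔ p ∈ D := by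
  rw [Labeling.word, List.mem_ofFn]
  constructor
  · rintro ⟨i, rfl⟩; exact (L.symm i).2
  · intro hp; exact ⟨L ⟨p, hp⟩, by simp⟩

theorem Labeling.length_word (L : Labeling D) : L.word.length = D.card := List.length_ofFn

theorem Labeling.word_injective : Function.Injective (Labeling.word (D := D)) := by
  intro L L' h
  have := List.ofFn_injective h
  have h2 : L.symm = L'.symm := Equiv.ext fun p => Subtype.ext (congrFun this p)
  exact Equiv.symm_bijective.injective h2

theorem Labeling.exists_word_eq (w : List (Fin k × Fin m)) (hw : w.Nodup)
    (hmem : ∀ p, p ∈ w ↔ p ∈ D) : ∃ L : Labeling D, L.word = w := by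
  have hlen : w.length = D.card := by
    rw [← List.toFinset_card_of_nodup hw]
    congr 1; ext p; simp [hmem]
  let f : Fin D.card → D := fun p => ⟨w[p]'(by rw [hlen]; exact p.2), (hmem _).1 (List.getElem_mem _)⟩
  have hf : Function.Injective f := by
    intro p q h
    have := congrArg Subtype.val h
    exact Fin.ext ((hw.getElem_inj_iff).1 this)
  have hb : Function.Bijective f := (Fintype.bijective_iff_injective_and_card f).2 ⟨hf, by simp⟩
  refine ⟨(Equiv.ofBijective f hb).symm, ?_⟩
  refine List.ext_getElem (by simp [Labeling.word, hlen]) fun i h1 h2 => ?_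
  simp [Labeling.word, f]

theorem Labeling.splitsAt_iff (L : Labeling D) (l : ℕ) :
    L.SplitsAt l ↔ (L.word.take l).Pairwise (fun a b => a.1 ≠ b.1 ∧ a.2 ≤ b.2) ∧
      (L.word.drop l).Pairwise (fun a b => a.2 ≠ b.2 ∧ a.1 ≤ b.1) := by
  rw [List.pairwise_iff_getElem, List.pairwise_iff_getElem]
  simp only [List.getElem_take, List.getElem_drop, List.length_take, List.length_drop,
    Labeling.length_word]
  have hget : ∀ (i : ℕ) (h : i < L.word.length),
      L.word[i] = (L.symm ⟨i, by rwa [Labeling.length_word] at h⟩).1 := fun i h => by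
    simp [Labeling.word]
  simp only [hget]
  constructor
  · intro h
    constructor
    · intro i j hi hj hij
      exact (h ⟨i, by omega⟩ ⟨j, by omega⟩ hij).1 (by simp only; omega)
    · intro i j hi hj hij
      exact (h ⟨l + i, by omega⟩ ⟨l + j, by omega⟩ (by simpa using hij)).2 (by simp)
  · rintro ⟨h1, h2⟩ p q hpq
    have hpq' := Fin.lt_def.1 hpq
    constructor
    · intro hq
      exact h1 p q (by omega) (by omega) hpq
    · intro hp
      have := h2 (p - l) (q - l) (by omega) (by omega) (by omega)
      simp only [Nat.add_sub_cancel' hp, Nat.add_sub_cancel' (hp.trans hpq'.le)] at this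
      exact this

/-- The generator of `ℰ_{k+m}` for a box of the `k × m` rectangle. -/
noncomputable def boxGen (p : Fin k × Fin m) : FKAlgebra (k + m) :=
  gen (Fin.castAdd m p.1) (Fin.natAdd k p.2)

theorem Labeling.monomial_eq (L : Labeling D) : L.monomial = (L.word.map boxGen).prod := by
  rw [Labeling.monomial, Labeling.word, List.map_ofFn]
  rfl

open Classical in
/-- The labelings that split at `l` give the products of sorted sums. -/
theorem sum_monomial_splitsAt {l : ℕ} (hl : l ≤ D.card) :
    ∑ L ∈ Finset.univ.filter (fun L : Labeling D => L.SplitsAt l), L.monomial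
      = ∑ A ∈ (D.powersetCard l).filter (fun A => (∀ p ∈ A, ∀ q ∈ A, p.1 = q.1 → p = q) ∧
          ∀ p ∈ D \ A, ∀ q ∈ D \ A, p.2 = q.2 → p = q),
        sortedSum Prod.snd boxGen A * sortedSum Prod.fst boxGen (D \ A) := by
  simp only [sortedSum, Finset.sum_mul_sum, ← Finset.sum_product']
  rw [Finset.sum_sigma']
  refine Finset.sum_bij (fun L _ => ⟨(L.word.take l).toFinset, (L.word.take l, L.word.drop l)⟩)
    ?_ ?_ ?_ ?_
  · intro L hL
    simp only [Finset.mem_filter, Finset.mem_univ, true_and, Labeling.splitsAt_iff] at hL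
    obtain ⟨h1, h2⟩ := hL
    have hnd := L.nodup_word
    have hsplit := List.take_append_drop l L.word
    have hnd' := hnd
    rw [← hsplit, List.nodup_append'] at hnd'
    have hmemD : ∀ p, p ∈ L.word.drop l ↔ p ∈ D \ (L.word.take l).toFinset := by
      intro p
      rw [Finset.mem_sdiff, List.mem_toFinset, ← L.mem_word]
      nth_rewrite 2 [← hsplit]
      rw [List.mem_append]
      constructor
      · intro hp; exact ⟨Or.inr hp, fun hp' => hnd'.2.2 hp' hp⟩
      · rintro ⟨h, h'⟩; exact h.resolve_left h'
    simp only [Finset.mem_sigma, Finset.mem_filter, Finset.mem_product, mem_sortedWords,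
      Finset.mem_powersetCard]
    refine ⟨⟨⟨?_, ?_⟩, ?_, ?_⟩, ⟨hnd'.1, fun p => by simp, h1.imp fun h => h.2⟩,
      ⟨hnd'.2.1, hmemD, h2.imp fun h => h.2⟩⟩
    · intro p hp
      exact L.mem_word.1 (List.mem_of_mem_take (List.mem_toFinset.1 hp))
    · rw [List.toFinset_card_of_nodup hnd'.1, List.length_take, L.length_word, min_eq_left hl]
    · intro p hp q hq hpq
      by_contra hne
      have : Std.Symm fun a b : Fin k × Fin m => a.1 ≠ b.1 := ⟨fun _ _ h => h.symm⟩
      have := (h1.imp (S := fun a b => a.1 ≠ b.1) fun h => h.1).forall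
        (List.mem_toFinset.1 hp) (List.mem_toFinset.1 hq) hne
      exact this hpq
    · intro p hp q hq hpq
      by_contra hne
      have : Std.Symm fun a b : Fin k × Fin m => a.2 ≠ b.2 := ⟨fun _ _ h => h.symm⟩
      have := (h2.imp (S := fun a b => a.2 ≠ b.2) fun h => h.1).forall
        ((hmemD p).2 hp) ((hmemD q).2 hq) hne
      exact this hpq
  · intro L _ L' _ h
    simp only [Sigma.mk.injEq] at h
    have h2 := eq_of_heq h.2
    rw [Prod.mk.injEq] at h2
    refine Labeling.word_injective ?_
    rw [← List.take_append_drop l L.word, h2.1, h2.2, List.take_append_drop]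
  · rintro ⟨A, w1, w2⟩ h
    simp only [Finset.mem_sigma, Finset.mem_filter, Finset.mem_product, mem_sortedWords,
      Finset.mem_powersetCard] at h
    obtain ⟨⟨⟨hAD, hAl⟩, hA, hB⟩, ⟨n1, m1, s1⟩, ⟨n2, m2, s2⟩⟩ := h
    obtain ⟨L, hL⟩ := Labeling.exists_word_eq (D := D) (w1 ++ w2)
      (List.nodup_append'.2 ⟨n1, n2, fun p hp hp' =>
        (Finset.mem_sdiff.1 ((m2 p).1 hp')).2 ((m1 p).1 hp)⟩) (by
      intro p
      rw [List.mem_append, m1, m2, Finset.mem_sdiff]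
      constructor
      · rintro (h | h)
        · exact hAD h
        · exact h.1
      · intro h
        by_cases hp : p ∈ A
        · exact Or.inl hp
        · exact Or.inr ⟨h, hp⟩)
    have hw1 : w1.toFinset = A := by ext p; simp [m1]
    have hlen : w1.length = l := by rw [← List.toFinset_card_of_nodup n1, hw1, hAl]
    have ht : L.word.take l = w1 := by rw [hL, ← hlen, List.take_left]
    have hd : L.word.drop l = w2 := by rw [hL, ← hlen, List.drop_left]
    refine ⟨L, ?_, by simp only [ht, hd, hw1]⟩
    rw [Finset.mem_filter, Labeling.splitsAt_iff, ht, hd]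
    refine ⟨Finset.mem_univ _, ?_, ?_⟩
    · refine List.Pairwise.imp_of_mem (fun {a b} ha hb h => ⟨fun e => ?_, h.1⟩) (s1.and n1)
      exact h.2 (hA _ ((m1 a).1 ha) _ ((m1 b).1 hb) e)
    · refine List.Pairwise.imp_of_mem (fun {a b} ha hb h => ⟨fun e => ?_, h.1⟩) (s2.and n2)
      exact h.2 (hB _ ((m2 a).1 ha) _ ((m2 b).1 hb) e)
  · intro L _
    simp only
    rw [L.monomial_eq, ← List.prod_append, ← List.map_append, List.take_append_drop]

end Words

end FominKirillov

/-! ### Counting the splitting labelings in a class -/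

namespace FominKirillov

section ClassCount

variable {k m : ℕ} {D : Finset (Fin k × Fin m)}

theorem SamePrec.of_imp {L L' : Labeling D}
    (h : ∀ a b : D, (a.1.1 = b.1.1 ∨ a.1.2 = b.1.2) → L a < L b → L' a < L' b) :
    SamePrec L L' := by
  intro a b hab
  refine ⟨h a b hab, fun h' => ?_⟩
  by_contra hn
  rcases (not_lt.1 hn).lt_or_eq with h1 | h1
  · exact lt_asymm h' (h b a (hab.imp Eq.symm Eq.symm) h1)
  · rw [L.injective h1] at h'
    exact lt_irrefl _ h'

/-- The boxes that precede a box of the same column. -/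
def colFollowed (L : Labeling D) : Finset D :=
  Finset.univ.filter fun b => ∃ c : D, c.1.2 = b.1.2 ∧ L b < L c

/-- The boxes that are preceded by a box of the same row. -/
def rowPreceded (L : Labeling D) : Finset D :=
  Finset.univ.filter fun b => ∃ c : D, c.1.1 = b.1.1 ∧ L c < L b

/-- The boxes with the first `l` labels. -/
def initialBoxes (L : Labeling D) (l : ℕ) : Finset D :=
  Finset.univ.filter fun b => (L b : ℕ) < l

theorem mem_colFollowed {L : Labeling D} {b : D} :
    b ∈ colFollowed L ↔ ∃ c : D, c.1.2 = b.1.2 ∧ L b < L c := by simp [colFollowed]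

theorem mem_rowPreceded {L : Labeling D} {b : D} :
    b ∈ rowPreceded L ↔ ∃ c : D, c.1.1 = b.1.1 ∧ L c < L b := by simp [rowPreceded]

theorem mem_initialBoxes {L : Labeling D} {l : ℕ} {b : D} :
    b ∈ initialBoxes L l ↔ (L b : ℕ) < l := by simp [initialBoxes]

theorem colFollowed_eq_of_samePrec {L L' : Labeling D} (h : SamePrec L L') :
    colFollowed L = colFollowed L' := by
  ext b
  simp only [mem_colFollowed]
  exact exists_congr fun c => and_congr_right fun hc => h _ _ (Or.inr hc.symm)

theorem rowPreceded_eq_of_samePrec {L L' : Labeling D} (h : SamePrec L L') :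
    rowPreceded L = rowPreceded L' := by
  ext b
  simp only [mem_rowPreceded]
  exact exists_congr fun c => and_congr_right fun hc => h _ _ (Or.inl hc)

/-- Exactly one box of each occupied column is not followed, namely the one with the largest label.
-/
theorem card_compl_colFollowed (L : Labeling D) : (colFollowed L)ᶜ.card = colCount D := by
  classical
  have himg : D.image Prod.snd = (colFollowed L)ᶜ.image (fun b => b.1.2) := by
    ext j
    simp only [Finset.mem_image, Finset.mem_compl, mem_colFollowed]
    constructor
    · rintro ⟨p, hp, rfl⟩
      obtain ⟨b, hb, hmax⟩ := Finset.exists_max_image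
        (Finset.univ.filter fun b : D => b.1.2 = p.2) L ⟨⟨p, hp⟩, by simp⟩
      simp only [Finset.mem_filter, Finset.mem_univ, true_and] at hb hmax
      refine ⟨b, ?_, hb⟩
      rintro ⟨c, hc, hlt⟩
      exact absurd hlt (not_lt.2 (hmax c (hc.trans hb)))
    · rintro ⟨b, -, rfl⟩
      exact ⟨b.1, b.2, rfl⟩
  rw [colCount, himg, Finset.card_image_of_injOn]
  intro b hb c hc hbc
  simp only [Finset.coe_compl, Set.mem_compl_iff, Finset.mem_coe, mem_colFollowed] at hb hc
  push Not at hb hc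
  exact L.injective (le_antisymm (hc b hbc) (hb c hbc.symm))

/-- Exactly one box of each occupied row is not preceded, namely the one with the smallest label. -/
theorem card_compl_rowPreceded (L : Labeling D) : (rowPreceded L)ᶜ.card = rowCount D := by
  classical
  have himg : D.image Prod.fst = (rowPreceded L)ᶜ.image (fun b => b.1.1) := by
    ext j
    simp only [Finset.mem_image, Finset.mem_compl, mem_rowPreceded]
    constructor
    · rintro ⟨p, hp, rfl⟩
      obtain ⟨b, hb, hmin⟩ := Finset.exists_min_image
        (Finset.univ.filter fun b : D => b.1.1 = p.1) L ⟨⟨p, hp⟩, by simp⟩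
      simp only [Finset.mem_filter, Finset.mem_univ, true_and] at hb hmin
      refine ⟨b, ?_, hb⟩
      rintro ⟨c, hc, hlt⟩
      exact absurd hlt (not_lt.2 (hmin c (hc.trans hb)))
    · rintro ⟨b, -, rfl⟩
      exact ⟨b.1, b.2, rfl⟩
  rw [rowCount, himg, Finset.card_image_of_injOn]
  intro b hb c hc hbc
  simp only [Finset.coe_compl, Set.mem_compl_iff, Finset.mem_coe, mem_rowPreceded] at hb hc
  push Not at hb hc
  exact L.injective (le_antisymm (hb c hbc.symm) (hc b hbc))

theorem Labeling.SplitsAt.apply {L : Labeling D} {l : ℕ} (h : L.SplitsAt l) {a b : D}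
    (hab : L a < L b) :
    ((L b : ℕ) < l → a.1.1 ≠ b.1.1 ∧ a.1.2 ≤ b.1.2) ∧
      (l ≤ (L a : ℕ) → a.1.2 ≠ b.1.2 ∧ a.1.1 ≤ b.1.1) := by
  simpa [Labeling.row, Labeling.col] using h (L a) (L b) hab

/-- In the second half the columns are distinct, so a box followed in its column belongs to the
first half. -/
theorem Labeling.SplitsAt.colFollowed_subset {L : Labeling D} {l : ℕ} (h : L.SplitsAt l) :
    colFollowed L ⊆ initialBoxes L l := by
  intro b hb
  obtain ⟨c, hc, hlt⟩ := mem_colFollowed.1 hb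
  rw [mem_initialBoxes]
  by_contra hn
  exact ((h.apply hlt).2 (not_lt.1 hn)).1 hc.symm

theorem Labeling.SplitsAt.disjoint_rowPreceded {L : Labeling D} {l : ℕ} (h : L.SplitsAt l) :
    Disjoint (initialBoxes L l) (rowPreceded L) := by
  rw [Finset.disjoint_right]
  intro b hb hbl
  obtain ⟨c, hc, hlt⟩ := mem_rowPreceded.1 hb
  exact ((h.apply hlt).1 (mem_initialBoxes.1 hbl)).1 hc

theorem Labeling.card_initialBoxes (L : Labeling D) {l : ℕ} (hl : l ≤ D.card) :
    (initialBoxes L l).card = l := by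
  have : (initialBoxes L l).map L.toEmbedding
      = Finset.univ.filter (fun p : Fin D.card => (p : ℕ) < l) := by
    ext p
    simp only [Finset.mem_map_equiv, mem_initialBoxes, Equiv.apply_symm_apply, Finset.mem_filter,
      Finset.mem_univ, true_and]
  rw [← Finset.card_map L.toEmbedding, this, Fin.card_filter_val_lt, min_eq_right hl]

/-- The first half is sorted by column and the second by row. Ties occur only within one column or
row, where both labelings agree. -/
theorem labeling_eq_of_initialBoxes_eq {L L' : Labeling D} {l : ℕ} (h : SamePrec L L')
    (hL : L.SplitsAt l) (hL' : L'.SplitsAt l) (hA : initialBoxes L l = initialBoxes L' l) :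
    L = L' := by
  have hA' : ∀ b, (L b : ℕ) < l ↔ (L' b : ℕ) < l := fun b => by
    rw [← mem_initialBoxes, ← mem_initialBoxes, hA]
  refine labeling_eq_of_lt_imp fun a b hab => ?_
  by_contra hn
  have hba : L' b < L' a := lt_of_le_of_ne (not_lt.1 hn) fun e => by
    rw [L'.injective e] at hab; exact lt_irrefl _ hab
  have h1 := Fin.lt_def.1 hab
  have h2 := Fin.lt_def.1 hba
  by_cases hb : (L b : ℕ) < l
  · have e1 := ((hL.apply hab).1 hb).2
    have e2 := ((hL'.apply hba).1 ((hA' a).1 (h1.trans hb))).2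
    exact hn ((h a b (Or.inr (le_antisymm e1 e2))).1 hab)
  · have hb' := mt (hA' b).2 hb
    have ha' : ¬ (L a : ℕ) < l := mt (hA' a).1 (by omega)
    have e1 := ((hL.apply hab).2 (by omega)).2
    have e2 := ((hL'.apply hba).2 (by omega)).2
    exact hn ((h a b (Or.inl (le_antisymm e1 e2))).1 hab)

theorem exists_labeling_of_injective {β : Type*} [LinearOrder β] (κ : D → β)
    (hκ : Function.Injective κ) : ∃ L : Labeling D, ∀ a b, L a < L b ↔ κ a < κ b := by
  classical
  have hcard : (Finset.univ.image κ).card = D.card := by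
    rw [Finset.card_image_of_injective _ hκ, Finset.card_univ, Fintype.card_coe]
  have e := (Finset.univ.image κ).orderIsoOfFin hcard
  let f : D → Fin D.card := fun b => e.symm ⟨κ b, Finset.mem_image_of_mem _ (Finset.mem_univ b)⟩
  have hf : Function.Injective f := fun a b h =>
    hκ (congrArg Subtype.val (e.symm.injective h))
  have hb : Function.Bijective f := (Fintype.bijective_iff_injective_and_card f).2 ⟨hf, by simp⟩
  refine ⟨Equiv.ofBijective f hb, fun a b => ?_⟩
  rw [Equiv.ofBijective_apply, Equiv.ofBijective_apply, e.symm.lt_iff_lt, Subtype.mk_lt_mk]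

theorem exists_labeling_lex (L : Labeling D) (g : D → ℕ) :
    ∃ L' : Labeling D, ∀ a b, L' a < L' b ↔ g a < g b ∨ (g a = g b ∧ L a < L b) := by
  obtain ⟨L', hL'⟩ := exists_labeling_of_injective (fun b => toLex (g b, L b)) fun a b h =>
    L.injective (Prod.mk.inj (toLex.injective h)).2
  exact ⟨L', fun a b => (hL' a b).trans Prod.Lex.toLex_lt_toLex⟩

theorem mem_iff_lt_card_of_lower {N : ℕ} {S : Finset (Fin N)}
    (hS : ∀ p ∈ S, ∀ q, q < p → q ∈ S) (p : Fin N) : p ∈ S ↔ (p : ℕ) < S.card := by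
  constructor
  · intro hp
    have : Finset.Iic p ⊆ S := fun q hq => by
      rcases (Finset.mem_Iic.1 hq).lt_or_eq with h | rfl
      · exact hS p hp q h
      · exact hp
    have := Finset.card_le_card this
    rw [Fin.card_Iic] at this
    omega
  · intro hp
    by_contra hn
    have : S ⊆ Finset.Iio p := fun q hq => by
      rw [Finset.mem_Iio]
      by_contra h
      rcases (not_lt.1 h).lt_or_eq with h | rfl
      · exact hn (hS q hq p h)
      · exact hn hq
    have := Finset.card_le_card this
    rw [Fin.card_Iio] at this
    omega

/-- List the boxes of `A` by column, then the others by row, breaking ties by `L`. The order within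
a row is kept because the later of two boxes is preceded and so lies outside `A`; within a column,
because the earlier one is followed and so lies in `A`. -/
theorem exists_splitsAt_of_subset {L : Labeling D} {A : Finset D}
    (h1 : colFollowed L ⊆ A) (h2 : Disjoint A (rowPreceded L)) :
    ∃ L' : Labeling D, SamePrec L L' ∧ L'.SplitsAt A.card ∧ initialBoxes L' A.card = A := by
  classical
  -- Columns are smaller than `m`, so the offset puts all of `A` first.
  set g : D → ℕ := fun b => if b ∈ A then (b.1.2 : ℕ) else m + b.1.1 with hg
  obtain ⟨L', hL'⟩ := exists_labeling_lex L g
  have gin : ∀ {b}, b ∈ A → g b = b.1.2 := fun hb => if_pos hb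
  have gout : ∀ {b}, b ∉ A → g b = m + b.1.1 := fun hb => if_neg hb
  have hprec : SamePrec L L' := by
    refine SamePrec.of_imp fun a b hab hlt => ?_
    rw [hL']
    have := a.1.2.2
    rcases hab with hab | hab
    · have hb : b ∉ A := fun hb => Finset.disjoint_left.1 h2 hb (mem_rowPreceded.2 ⟨a, hab, hlt⟩)
      rw [gout hb]
      by_cases ha : a ∈ A
      · rw [gin ha]; left; omega
      · rw [gout ha, hab]; exact Or.inr ⟨rfl, hlt⟩
    · have ha : a ∈ A := h1 (mem_colFollowed.2 ⟨b, hab.symm, hlt⟩)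
      rw [gin ha]
      by_cases hb : b ∈ A
      · rw [gin hb, hab]; exact Or.inr ⟨rfl, hlt⟩
      · rw [gout hb]; left; omega
  have hA : ∀ b, b ∈ A ↔ (L' b : ℕ) < A.card := by
    intro b
    have := mem_iff_lt_card_of_lower (S := A.map L'.toEmbedding) (by
      intro p hp q hqp
      rw [Finset.mem_map_equiv] at hp ⊢
      by_contra hq
      have := (hL' (L'.symm q) (L'.symm p)).1 (by simpa using hqp)
      rw [gin hp, gout hq] at this
      have := (L'.symm p).1.2.2
      omega) (L' b)
    rw [Finset.card_map, Finset.mem_map_equiv, Equiv.symm_apply_apply] at this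
    exact this
  refine ⟨L', hprec, ?_, ?_⟩
  · intro p q hpq
    obtain ⟨a, rfl⟩ := L'.surjective p
    obtain ⟨b, rfl⟩ := L'.surjective q
    have hpq' := Fin.lt_def.1 hpq
    have hg' := (hL' a b).1 hpq
    simp only [Labeling.row, Labeling.col, Equiv.symm_apply_apply]
    constructor
    · intro hb
      have hbA := (hA b).2 hb
      have haA := (hA a).2 (hpq'.trans hb)
      rw [gin haA, gin hbA] at hg'
      refine ⟨fun e => ?_, Fin.le_def.2 (by omega)⟩
      exact Finset.disjoint_left.1 h2 hbA (mem_rowPreceded.2 ⟨a, e, (hprec _ _ (Or.inl e)).2 hpq⟩)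
    · intro ha
      have haA : a ∉ A := fun h => absurd ((hA a).1 h) (by omega)
      have hbA : b ∉ A := fun h => absurd ((hA b).1 h) (by omega)
      rw [gout haA, gout hbA] at hg'
      refine ⟨fun e => ?_, Fin.le_def.2 (by omega)⟩
      exact haA (h1 (mem_colFollowed.2 ⟨b, e.symm, (hprec _ _ (Or.inr e)).2 hpq⟩))
  · ext b
    rw [mem_initialBoxes, hA]

theorem card_filter_between {α : Type*} [Fintype α] [DecidableEq α] {F G : Finset α}
    (h : Disjoint F G) {l : ℕ} (hl : F.card ≤ l) :
    (Finset.univ.filter fun A : Finset α => F ⊆ A ∧ Disjoint A G ∧ A.card = l).card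
      = ((F ∪ G)ᶜ.card).choose (l - F.card) := by
  rw [← Finset.card_powersetCard]
  refine Finset.card_bij' (fun A _ => A \ F) (fun B _ => B ∪ F) ?_ ?_ ?_ ?_
  · intro A hA
    simp only [Finset.mem_filter, Finset.mem_univ, true_and] at hA
    rw [Finset.mem_powersetCard, Finset.card_sdiff_of_subset hA.1, hA.2.2]
    refine ⟨fun a ha => ?_, rfl⟩
    rw [Finset.mem_sdiff] at ha
    rw [Finset.mem_compl, Finset.mem_union, not_or]
    exact ⟨ha.2, Finset.disjoint_left.1 hA.2.1 ha.1⟩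
  · intro B hB
    rw [Finset.mem_powersetCard] at hB
    have hBF : ∀ a ∈ B, a ∉ F ∧ a ∉ G := fun a ha => by
      have := hB.1 ha
      rwa [Finset.mem_compl, Finset.mem_union, not_or] at this
    simp only [Finset.mem_filter, Finset.mem_univ, true_and]
    refine ⟨Finset.subset_union_right, ?_, ?_⟩
    · rw [Finset.disjoint_union_left]
      exact ⟨Finset.disjoint_left.2 fun a ha => (hBF a ha).2, h⟩
    · rw [Finset.card_union_of_disjoint (Finset.disjoint_left.2 fun a ha => (hBF a ha).1), hB.2]
      omega
  · intro A hA
    simp only [Finset.mem_filter, Finset.mem_univ, true_and] at hA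
    exact Finset.sdiff_union_of_subset hA.1
  · intro B hB
    rw [Finset.mem_powersetCard] at hB
    ext a
    have := fun ha : a ∈ B => hB.1 ha
    simp only [Finset.mem_compl, Finset.mem_union, not_or] at this
    simp only [Finset.mem_sdiff, Finset.mem_union]
    tauto

theorem Labeling.SplitsAt.disjoint {L : Labeling D} {l : ℕ} (h : L.SplitsAt l) :
    Disjoint (colFollowed L) (rowPreceded L) :=
  Finset.disjoint_of_subset_left h.colFollowed_subset h.disjoint_rowPreceded

theorem card_colFollowed (L : Labeling D) : (colFollowed L).card + colCount D = D.card := by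
  rw [← card_compl_colFollowed L, Finset.card_add_card_compl, Fintype.card_coe]

theorem card_rowPreceded (L : Labeling D) : (rowPreceded L).card + rowCount D = D.card := by
  rw [← card_compl_rowPreceded L, Finset.card_add_card_compl, Fintype.card_coe]

/-- Counts the free boxes, which may be put on either side of the cut. The subtraction is avoided by
adding `D.card` on the left. -/
theorem card_compl_union {L : Labeling D} {l : ℕ} (h : L.SplitsAt l) :
    (colFollowed L ∪ rowPreceded L)ᶜ.card + D.card = rowCount D + colCount D := by
  have h1 := card_colFollowed L
  have h2 := card_rowPreceded L
  have h3 := Finset.card_union_of_disjoint h.disjoint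
  have h4 := Finset.card_add_card_compl (colFollowed L ∪ rowPreceded L)
  rw [Fintype.card_coe] at h4
  omega

open Classical in
/-- The number of labelings splitting at `l` in a class of labelings. -/
theorem card_filter_splitsAt {L : Labeling D} {l₀ : ℕ} (h : L.SplitsAt l₀) {l : ℕ}
    (hl : l ≤ D.card) :
    (Finset.univ.filter fun L' : Labeling D => L'.toClass = L.toClass ∧ L'.SplitsAt l).card
      = if D.card ≤ l + colCount D then
          (rowCount D + colCount D - D.card).choose (l + colCount D - D.card) else 0 := by
  -- Within the class a splitting labeling is the same as its set of initial boxes, which contains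
  -- the followed boxes and avoids the preceded ones.
  have hcard : (Finset.univ.filter fun L' : Labeling D =>
      L'.toClass = L.toClass ∧ L'.SplitsAt l).card
      = (Finset.univ.filter fun A : Finset D =>
        colFollowed L ⊆ A ∧ Disjoint A (rowPreceded L) ∧ A.card = l).card := by
    refine Finset.card_bij (fun L' _ => initialBoxes L' l) ?_ ?_ ?_
    · intro L' hL'
      simp only [Finset.mem_filter, Finset.mem_univ, true_and] at hL' ⊢
      have hp := samePrec_of_toClass_eq hL'.1
      rw [← colFollowed_eq_of_samePrec hp, ← rowPreceded_eq_of_samePrec hp]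
      exact ⟨hL'.2.colFollowed_subset, hL'.2.disjoint_rowPreceded, L'.card_initialBoxes hl⟩
    · intro L1 h1 L2 h2 h12
      simp only [Finset.mem_filter, Finset.mem_univ, true_and] at h1 h2
      exact labeling_eq_of_initialBoxes_eq (samePrec_of_toClass_eq (h1.1.trans h2.1.symm))
        h1.2 h2.2 h12
    · intro A hA
      simp only [Finset.mem_filter, Finset.mem_univ, true_and] at hA
      obtain ⟨hA1, hA2, rfl⟩ := hA
      obtain ⟨L', hp, hs, hi⟩ := exists_splitsAt_of_subset hA1 hA2
      refine ⟨L', ?_, hi⟩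
      simp only [Finset.mem_filter, Finset.mem_univ, true_and]
      exact ⟨(toClass_eq_of_samePrec hp).symm, hs⟩
  have h1 := card_colFollowed L
  have h2 := card_compl_union h
  rw [hcard]
  split_ifs with hif
  · rw [card_filter_between h.disjoint (by omega)]
    congr 1 <;> omega
  -- There are `D.card - colCount D` followed boxes, more than fit into the first `l` places.
  · rw [Finset.card_eq_zero, Finset.filter_eq_empty_iff]
    rintro A - ⟨hA, -, hAl⟩
    have := Finset.card_le_card hA
    omega

end ClassCount

end FominKirillov

/-! ### Hook coefficients and sums over classes -/

namespace FominKirillov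

section ForestCount

variable {k m : ℕ} {D : Finset (Fin k × Fin m)}

/-- Boxes are the edges of a bipartite graph on the rows and columns, and a forest has fewer edges
than vertices. Since `D` is not closed, some box is alone in its row or in its column; removing it
also removes that line. -/
theorem card_lt_rowCount_add_colCount (hD : IsForest D) (hne : D.Nonempty) :
    D.card < rowCount D + colCount D := by
  rw [isForest_iff] at hD
  induction hn : D.card generalizing D with
  | zero => rw [Finset.card_eq_zero] at hn; exact absurd hn hne.ne_empty
  | succ n ih =>
    have hcl := hD D subset_rfl hne
    rw [ClosedBoxes] at hcl
    push Not at hcl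
    obtain ⟨p, hp, hpD⟩ := hcl
    have hins := Finset.insert_erase hp
    have hr : D.image Prod.fst = insert p.1 ((D.erase p).image Prod.fst) := by
      rw [← Finset.image_insert, hins]
    have hc : D.image Prod.snd = insert p.2 ((D.erase p).image Prod.snd) := by
      rw [← Finset.image_insert, hins]
    have hcard := Finset.card_erase_of_mem hp
    have hdis : p.1 ∉ (D.erase p).image Prod.fst ∨ p.2 ∉ (D.erase p).image Prod.snd := by
      by_cases h : ∃ q ∈ D, q ≠ p ∧ q.1 = p.1
      · right
        intro h'
        obtain ⟨q, hq, hqp⟩ := Finset.mem_image.1 h'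
        rw [Finset.mem_erase] at hq
        exact hpD h q hq.2 hq.1 hqp
      · left
        intro h'
        obtain ⟨q, hq, hqp⟩ := Finset.mem_image.1 h'
        rw [Finset.mem_erase] at hq
        exact h ⟨q, hq.2, hq.1, hqp⟩
    have hle1 : (D.erase p).image Prod.fst ⊆ D.image Prod.fst :=
      Finset.image_subset_image (Finset.erase_subset _ _)
    have hle2 : (D.erase p).image Prod.snd ⊆ D.image Prod.snd :=
      Finset.image_subset_image (Finset.erase_subset _ _)
    have hle1 := Finset.card_le_card hle1
    have hle2 := Finset.card_le_card hle2
    simp only [rowCount, colCount] at ih ⊢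
    rcases (D.erase p).eq_empty_or_nonempty with he | he
    · rw [he, Finset.card_empty] at hcard
      have h1 : 0 < (D.image Prod.fst).card := (hne.image _).card_pos
      have h2 : 0 < (D.image Prod.snd).card := (hne.image _).card_pos
      omega
    · have := ih (D := D.erase p) (fun X hX => hD X (hX.trans (Finset.erase_subset _ _))) he
        (by omega)
      rcases hdis with h | h
      · rw [hr, Finset.card_insert_of_notMem h]; omega
      · rw [hc, Finset.card_insert_of_notMem h]; omega

theorem rowCount_le_card : rowCount D ≤ D.card := Finset.card_image_le

/-- Pascal's rule for x = row(D) - t and y = col(D) - s: the two coefficients are C(x+y-1, y-1) and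
C(x+y-1, y). It fails only for x = y = 0, which the forest inequality excludes. -/
theorem hookCoeff_add (hD : IsForest D) {s t : ℕ} (ht : 1 ≤ t) (hcard : D.card = s + t) :
    hookCoeff D (s + 1) t + hookCoeff D s (t + 1)
      = if D.card ≤ t + colCount D then
          (rowCount D + colCount D - D.card).choose (t + colCount D - D.card) else 0 := by
  have hne : D.Nonempty := Finset.card_pos.1 (by omega)
  have h := card_lt_rowCount_add_colCount hD hne
  simp only [hookCoeff, hcard] at *
  generalize rowCount D = r at *
  generalize colCount D = c at *
  by_cases hs : s ≤ c
  · obtain ⟨y, rfl⟩ := Nat.exists_eq_add_of_le hs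
    rw [if_pos (show s + t ≤ t + (s + y) by omega),
      show t + (s + y) - (s + t) = y by omega]
    by_cases htr : t ≤ r
    · obtain ⟨x, rfl⟩ := Nat.exists_eq_add_of_le htr
      rw [show t + x + (s + y) - (s + t) = x + y by omega]
      cases x with
      | zero =>
        cases y with
        | zero => omega
        | succ y => simp
      | succ x =>
        cases y with
        | zero => simp
        | succ y =>
          rw [if_pos (by omega), if_pos (by omega), show t + (x + 1) - t = x + 1 by omega,
            show s + (y + 1) - (s + 1) = y by omega, show t + (x + 1) - (t + 1) = x by omega,
            show s + (y + 1) - s = y + 1 by omega, show x + 1 + (y + 1) = (x + y + 1) + 1 by omega,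
            Nat.choose_succ_succ, show x + 1 + y = x + y + 1 by omega]
          rfl
    · rw [if_neg (by omega), if_neg (by omega), Nat.choose_eq_zero_of_lt (by omega)]
  · rw [if_neg (by omega), if_neg (by omega), if_neg (by omega)]

open Classical in
/-- The classes of labelings that contain a labeling which splits somewhere. -/
noncomputable def splitClasses (D : Finset (Fin k × Fin m)) : Finset (LabelingClass D) :=
  Finset.univ.filter fun c => ∃ L : Labeling D, L.toClass = c ∧ ∃ l ≤ D.card, L.SplitsAt l

/-- In the given range the binomial coefficient counting the labelings that split at `l` is
positive. -/
theorem exists_splitsAt {L : Labeling D} {l₀ : ℕ} (h : L.SplitsAt l₀) {l : ℕ} (hl : l ≤ D.card)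
    (h1 : D.card ≤ l + colCount D) (h2 : l ≤ rowCount D) :
    ∃ L' : Labeling D, L'.toClass = L.toClass ∧ L'.SplitsAt l := by
  classical
  have hc := card_filter_splitsAt h hl
  rw [if_pos h1] at hc
  have hpos : 0 < (rowCount D + colCount D - D.card).choose (l + colCount D - D.card) :=
    Nat.choose_pos (by omega)
  rw [← hc, Finset.card_pos] at hpos
  obtain ⟨L', hL'⟩ := hpos
  exact ⟨L', by simpa using hL'⟩

/-- A class with a split at one place also has a split at `t`. So the classes do not depend on the
hook, and the two hooks of the recursion can share them. -/
theorem hookClasses_eq_splitClasses {s t : ℕ} (hs : 1 ≤ s) (hcard : D.card + 1 = s + t)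
    (ht : t ≤ rowCount D) (hsc : s ≤ colCount D) : hookClasses D s t = splitClasses D := by
  classical
  ext c
  simp only [hookClasses, splitClasses, Finset.mem_filter, Finset.mem_univ, true_and, IsHookClass]
  constructor
  · rintro ⟨L, rfl, -, -, -, h | h⟩
    · exact ⟨L, rfl, t, by omega, h⟩
    · exact ⟨L, rfl, t - 1, by omega, h⟩
  · rintro ⟨L, rfl, l₀, -, h⟩
    obtain ⟨L', h1, h2⟩ := exists_splitsAt h (l := t) (by omega) (by omega) ht
    exact ⟨L', h1, hcard, ht, hsc, Or.inl h2⟩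

theorem hookCoeff_smul_sum_hookClasses {M : Type*} [AddCommMonoid M] (f : LabelingClass D → M)
    {s t : ℕ} (hcard : D.card + 1 = s + t) :
    hookCoeff D s t • ∑ c ∈ hookClasses D s t, f c
      = hookCoeff D s t • ∑ c ∈ splitClasses D, f c := by
  by_cases h : t ≤ rowCount D ∧ s ≤ colCount D
  -- Here `t ≤ rowCount D ≤ D.card = s + t - 1`, which forces `1 ≤ s`.
  · have := rowCount_le_card (D := D)
    rw [hookClasses_eq_splitClasses (by omega) hcard h.1 h.2]
  · simp [hookCoeff, h]

open Classical in
-- Equivalent labelings have equal monomials, so the sum over the labelings that split at `t` groups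
-- by class. Every class occurs with the same multiplicity, the sum of the two hook coefficients.
theorem sum_splitClasses (hD : IsForest D) {s t : ℕ} (ht : 1 ≤ t) (hcard : D.card = s + t)
    (rep : LabelingClass D → Labeling D) (hrep : ∀ c, (rep c).toClass = c) :
    hookCoeff D (s + 1) t • ∑ c ∈ hookClasses D (s + 1) t, (rep c).monomial
        + hookCoeff D s (t + 1) • ∑ c ∈ hookClasses D s (t + 1), (rep c).monomial
      = ∑ L ∈ Finset.univ.filter (fun L : Labeling D => L.SplitsAt t), L.monomial := by
  rw [hookCoeff_smul_sum_hookClasses _ (by omega), hookCoeff_smul_sum_hookClasses _ (by omega),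
    ← add_smul, hookCoeff_add hD ht hcard, Finset.smul_sum,
    ← Finset.sum_fiberwise_of_maps_to (s := Finset.univ.filter fun L : Labeling D => L.SplitsAt t)
      (t := splitClasses D) (g := Labeling.toClass)]
  · refine Finset.sum_congr rfl fun c hc => ?_
    simp only [splitClasses, Finset.mem_filter, Finset.mem_univ, true_and] at hc
    obtain ⟨L, rfl, l₀, -, hL⟩ := hc
    rw [← card_filter_splitsAt hL (l := t) (by omega), Finset.filter_filter,
      Finset.sum_congr rfl fun L' hL' => ?_, Finset.sum_const]
    · congr 2
      ext L'
      simp only [Finset.mem_filter, and_comm]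
    · rw [Finset.mem_filter] at hL'
      exact monomial_eq_of_toClass_eq (hL'.2.2.trans (hrep _).symm)
  · intro L hL
    simp only [splitClasses, Finset.mem_filter, Finset.mem_univ, true_and] at hL ⊢
    exact ⟨L, rfl, t, by omega, hL⟩

end ForestCount

/-! ### The product e_t h_s as a sum over forests -/

section Product

variable {k m : ℕ}

open Classical in
/-- The pairs without core are the splittings of the forests. -/
theorem sum_forests_splitsAt (l r : ℕ) :
    ∑ D ∈ (forests k m).filter (fun D => D.card = l + r),
        ∑ L ∈ Finset.univ.filter (fun L : Labeling D => L.SplitsAt l), L.monomial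
      = ∑ p ∈ (rowMaps Finset.univ Finset.univ l ×ˢ colMaps Finset.univ Finset.univ r).filter
          (fun p : Finset (Fin k × Fin m) × Finset (Fin k × Fin m) => NoCore p.1 p.2),
        sortedSum Prod.snd boxGen p.1 * sortedSum Prod.fst boxGen p.2 := by
  have h1 : ∀ D ∈ (forests k m).filter (fun D => D.card = l + r), _ := fun D hD =>
    sum_monomial_splitsAt (D := D) (l := l) (by rw [Finset.mem_filter] at hD; omega)
  rw [Finset.sum_congr rfl h1, Finset.sum_sigma']
  refine Finset.sum_bij' (fun x _ => (x.2, x.1 \ x.2)) (fun p _ => ⟨p.1 ∪ p.2, p.1⟩) ?_ ?_ ?_ ?_ ?_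
  · rintro ⟨D, A⟩ h
    simp only [Finset.mem_sigma, Finset.mem_filter, forests, Finset.mem_univ, true_and,
      Finset.mem_powersetCard, Finset.mem_product, mem_rowMaps, mem_colMaps, implies_true] at h ⊢
    obtain ⟨⟨hD, hcard⟩, ⟨hAD, hAl⟩, hA, hB⟩ := h
    refine ⟨⟨⟨hAl, hA⟩, by rw [Finset.card_sdiff_of_subset hAD]; omega, hB⟩, ?_⟩
    rw [noCore_iff hA hB, Finset.union_sdiff_of_subset hAD, ← isForest_iff]
    exact ⟨Finset.disjoint_sdiff, hD⟩
  · rintro ⟨A, B⟩ h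
    simp only [Finset.mem_sigma, Finset.mem_filter, forests, Finset.mem_univ, true_and,
      Finset.mem_powersetCard, Finset.mem_product, mem_rowMaps, mem_colMaps, implies_true] at h ⊢
    obtain ⟨⟨⟨hAl, hA⟩, hBl, hB⟩, h⟩ := h
    rw [noCore_iff hA hB, ← isForest_iff] at h
    rw [Finset.union_sdiff_cancel_left h.1, Finset.card_union_of_disjoint h.1, hAl, hBl]
    exact ⟨⟨h.2, rfl⟩, ⟨Finset.subset_union_left, rfl⟩, hA, hB⟩
  · rintro ⟨D, A⟩ h
    simp only [Finset.mem_sigma, Finset.mem_filter, Finset.mem_powersetCard] at h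
    simp only [Finset.union_sdiff_of_subset h.2.1.1]
  · rintro ⟨A, B⟩ h
    simp only [Finset.mem_filter, Finset.mem_product, mem_rowMaps, mem_colMaps] at h
    have h' := (noCore_iff h.1.1.2.2 h.1.2.2.2).1 h.2
    simp only [Finset.union_sdiff_cancel_left h'.1]
  · rintro ⟨D, A⟩ h
    rfl

theorem isDunklSystem_skewGen {n : ℕ} : IsDunklSystem (skewGen (n := n)) where
  skew := skewGen_symm
  diag := skewGen_self
  sq i j := by
    have h : ∀ {i j : Fin n}, i < j → skewGen i j * skewGen i j = 0 := fun {i j} h => by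
      rw [skewGen_of_lt h, gen_of_lt h]
      simpa using quotMap_rel (Rel.square i j h)
    rcases lt_trichotomy i j with hij | rfl | hij
    · exact h hij
    · rw [skewGen_self, zero_mul]
    · rw [skewGen_symm j i, neg_mul_neg, h hij]
  comm := skewGen_comm
  triple := skewGen_triple

/-- The Dunkl elements `θ_1, …, θ_k`. -/
noncomputable def rowDunkls (k m : ℕ) : List (FKAlgebra (k + m)) :=
  (List.finRange k).map fun i => dunkl (Fin.castAdd m i)

theorem boxGen_eq (p : Fin k × Fin m) :
    skewGen (Fin.castAddEmb m p.1) (Fin.natAddEmb k p.2) = boxGen p :=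
  skewGen_of_lt (by simp [Fin.lt_def]; omega)

theorem localDunkl_skewGen {n : ℕ} :
    localDunkl (skewGen (n := n)) Finset.univ = dunkl := by
  funext i
  rw [dunkl_eq_sum_skewGen, localDunkl]

/-- The Pieri formula on the full vertex set, where the relative Dunkl elements are the true ones.
-/
theorem sum_rowMaps_eq_listESymm (r : ℕ) :
    ∑ A ∈ rowMaps Finset.univ Finset.univ r, sortedSum Prod.snd (boxGen (k := k) (m := m)) A
      = listESymm (rowDunkls k m) r := by
  have h := columnSumDeg_eq_sum_rowMaps (skewGen (n := k + m)) (Fin.castAddEmb m)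
    (Fin.natAddEmb k) Finset.univ Finset.univ r
  simp only [boxGen_eq] at h
  have h2 := columnSumDeg_eq_listESymm (isDunklSystem_skewGen (n := k + m)) Finset.univ
    ((List.finRange k).map (Fin.castAddEmb m)) ((Finset.univ.sort).map (Fin.natAddEmb k))
    ((List.nodup_finRange k).map (Fin.castAddEmb m).injective)
    ((Finset.sort_nodup _ _).map (Fin.natAddEmb k).injective) (by
      simp only [List.mem_map]
      rintro _ ⟨j, _, rfl⟩ ⟨i, _, h⟩
      have := congrArg Fin.val h
      simp at this; omega) (by
      ext v
      simp only [Finset.mem_union, List.mem_toFinset, List.mem_map, List.mem_finRange, true_and,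
        Finset.mem_sort, Finset.mem_univ, iff_true]
      exact v.addCases (fun i => Or.inl ⟨i, rfl⟩) fun j => Or.inr ⟨j, rfl⟩) r
  rw [localDunkl_skewGen, List.map_map] at h2
  rw [← h, rowDunkls]
  refine Eq.trans ?_ h2
  congr 1
  ext v
  simp

theorem sum_colMaps_eq_listHSymm (r : ℕ) :
    ∑ A ∈ colMaps Finset.univ Finset.univ r, sortedSum Prod.fst (boxGen (k := k) (m := m)) A
      = listHSymm (rowDunkls k m) r := by
  have h := columnSumDeg_eq_sum_colMaps (isDunklSystem_skewGen (n := k + m)) (Fin.castAddEmb m)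
    (Fin.natAddEmb k) Finset.univ Finset.univ r
  simp only [boxGen_eq] at h
  have h2 := columnSumDeg_eq_listHSymm (isDunklSystem_skewGen (n := k + m)) Finset.univ
    ((Finset.univ.sort).map (Fin.castAddEmb m)) (Finset.univ.map (Fin.natAddEmb k))
    ((Finset.sort_nodup _ _).map (Fin.castAddEmb m).injective) (by
      simp only [List.mem_map, Finset.mem_map]
      rintro _ ⟨j, _, rfl⟩ ⟨i, _, h⟩
      have := congrArg Fin.val h
      simp at this; omega) (by
      ext v
      simp only [Finset.mem_union, List.mem_toFinset, List.mem_map,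
        Finset.mem_sort, Finset.mem_univ, iff_true, true_and, Finset.mem_map]
      exact v.addCases (fun i => Or.inl ⟨i, rfl⟩) fun j => Or.inr ⟨j, rfl⟩) r
  -- The sign from inverting the factors 1 + θ_v X cancels the sign from reversing the generators.
  -- This is why h_r is a nonnegative combination of monomials.
  rw [localDunkl_skewGen, List.map_map, h, ← mul_assoc, ← pow_add, Even.neg_one_pow ⟨r, rfl⟩,
    one_mul, Fin.sort_univ] at h2
  exact h2

/-- The sum over the forests of the monomials of the classes of labelings for a hook. -/
noncomputable def hookSum
    (rep : ∀ D : Finset (Fin k × Fin m), LabelingClass D → Labeling D) (s t : ℕ) :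
    FKAlgebra (k + m) :=
  ∑ D ∈ forests k m, hookCoeff D s t • ∑ c ∈ hookClasses D s t, (rep D c).monomial

theorem hookClasses_eq_empty {D : Finset (Fin k × Fin m)} {s t : ℕ} (h : D.card + 1 ≠ s + t) :
    hookClasses D s t = ∅ := by
  classical
  rw [hookClasses, Finset.filter_eq_empty_iff]
  rintro c - ⟨L, -, hL, -⟩
  exact h hL

/-- Expand both factors by the Pieri formulas, cancel the pairs with a core, read the others as
splitting labelings of forests, and group these by class. -/
theorem hookSum_add (rep : ∀ D : Finset (Fin k × Fin m), LabelingClass D → Labeling D)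
    (hrep : ∀ (D : Finset (Fin k × Fin m)) (c : LabelingClass D), (rep D c).toClass = c) (s : ℕ) {t : ℕ} (ht : 1 ≤ t) :
    hookSum rep (s + 1) t + hookSum rep s (t + 1)
      = listESymm (rowDunkls k m) t * listHSymm (rowDunkls k m) s := by
  classical
  rw [← sum_rowMaps_eq_listESymm, ← sum_colMaps_eq_listHSymm,
    sum_rowMaps_mul_sum_colMaps_eq_sum_noCore, ← sum_forests_splitsAt, hookSum, hookSum,
    ← Finset.sum_add_distrib, Finset.sum_filter]
  · refine Finset.sum_congr rfl fun D hD => ?_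
    split_ifs with hcard
    · exact sum_splitClasses (by simpa [forests] using hD) ht (by omega) (rep D) (hrep D)
    · rw [hookClasses_eq_empty (by omega), hookClasses_eq_empty (by omega)]
      simp
  · intro p q h1 h2
    refine gen_comm _ _ _ _ (fun e => h1 (Fin.castAdd_injective _ _ e)) ?_ ?_
      (fun e => h2 (Fin.natAdd_injective _ _ e))
    · intro e; have := congrArg Fin.val e; simp at this; omega
    · intro e; have := congrArg Fin.val e; simp at this; omega
  · intro P Q hne
    have := sum_rowMaps_mul_sum_colMaps (isDunklSystem_skewGen (n := k + m)) (Fin.castAddEmb m)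
      (Fin.natAddEmb k) (fun i j e => by have := congrArg Fin.val e; simp at this; omega) P Q hne
    simpa only [boxGen_eq] using this

variable (rep : ∀ D : Finset (Fin k × Fin m), LabelingClass D → Labeling D)

/-- The start of the recursion: a diagram with `t` boxes cannot meet `t + 1` rows. -/
theorem hookSum_zero (t : ℕ) : hookSum rep 0 (t + 1) = 0 := by
  refine Finset.sum_eq_zero fun D _ => ?_
  by_cases hcard : D.card + 1 = 0 + (t + 1)
  · have := rowCount_le_card (D := D)
    rw [hookCoeff, if_neg (by omega), zero_smul]
  · rw [hookClasses_eq_empty hcard, Finset.sum_empty, smul_zero]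

theorem monomial_mem_nonnegCone {D : Finset (Fin k × Fin m)} (L : Labeling D) :
    L.monomial ∈ nonnegCone (k + m) := by
  refine AddSubmonoid.subset_closure ⟨1, zero_le_one, List.ofFn fun p =>
    ⟨(Fin.castAdd m (L.row p), Fin.natAdd k (L.col p)), by simp [Fin.lt_def]; omega⟩, ?_⟩
  rw [List.map_ofFn, Complex.ofReal_one, one_smul]
  rfl

theorem hookSum_mem_nonnegCone (s t : ℕ) : hookSum rep s t ∈ nonnegCone (k + m) :=
  AddSubmonoid.sum_mem _ fun _ _ => AddSubmonoid.nsmul_mem _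
    (AddSubmonoid.sum_mem _ fun _ _ => monomial_mem_nonnegCone _) _

end Product

end FominKirillov

/-! ### Hook Schur polynomials -/

namespace FominKirillov

section HookList

variable {R : Type*} [CommRing R]

/-- The Schur polynomial of the hook `(a + 1, 1^b)` in the entries of a list. -/
def listHook : List R → ℕ → ℕ → R
  | [], _, _ => 0
  -- The last term has `x` in the corner: the arm may repeat `x`, the leg may not.
  | x :: l, a, b => listHook l a b + x * listHSymm (x :: l) a * listESymm l b

theorem listHook_nil (a b : ℕ) : listHook ([] : List R) a b = 0 := rfl

theorem listHook_cons (x : R) (l : List R) (a b : ℕ) :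
    listHook (x :: l) a b = listHook l a b + x * listHSymm (x :: l) a * listESymm l b := rfl

theorem listHook_zero (l : List R) (b : ℕ) : listHook l 0 b = listESymm l (b + 1) := by
  induction l with
  | nil => rw [listHook_nil, listESymm_nil]
  | cons x l ih => rw [listHook_cons, ih, listHSymm_zero, listESymm_cons, mul_one, mul_comm x]

/-- The commutative counterpart of `hookSum_add`. -/
theorem listHook_add (l : List R) (a b : ℕ) :
    listHook l (a + 1) b + listHook l a (b + 1) = listESymm l (b + 1) * listHSymm l (a + 1) := by
  induction l with
  | nil => rw [listHook_nil, listHook_nil, listESymm_nil, add_zero, zero_mul]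
  | cons x l ih =>
    have h : listHook l (a + 1) b = listESymm l (b + 1) * listHSymm l (a + 1)
        - listHook l a (b + 1) := eq_sub_of_add_eq ih
    rw [listHook_cons, listHook_cons, listESymm_cons, h, listHSymm_cons]
    ring

end HookList

section Chains

variable {k : ℕ} {R : Type*} [CommRing R]

open Classical in
/-- The sum over the chains of length `a` above `c` for the relation `r`. -/
noncomputable def chainSum (r : Fin k → Fin k → Prop) (x : Fin k → R) (c : Fin k) (a : ℕ) : R :=
  ∑ f : Fin a → Fin k,
    if (∀ i, r c (f i)) ∧ ∀ i j, i < j → r (f i) (f j) then ∏ i, x (f i) else 0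

theorem chainSum_zero (r : Fin k → Fin k → Prop) (x : Fin k → R) (c : Fin k) :
    chainSum r x c 0 = 1 := by
  simp [chainSum]

/-- By transitivity only the first element of the chain has to be compared with `c`. -/
theorem chainSum_succ {r : Fin k → Fin k → Prop} [DecidableRel r] (hr : ∀ a b c, r a b → r b c → r a c)
    (x : Fin k → R) (c : Fin k) (a : ℕ) :
    chainSum r x c (a + 1) = ∑ d, if r c d then x d * chainSum r x d a else 0 := by
  rw [chainSum, ← (Fin.consEquiv fun _ : Fin (a + 1) => Fin k).sum_comp, Fintype.sum_prod_type]
  refine Finset.sum_congr rfl fun d _ => ?_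
  have hiff : ∀ f : Fin a → Fin k,
      ((∀ i : Fin (a + 1), r c (Fin.cons (α := fun _ => Fin k) d f i)) ∧
        ∀ i j : Fin (a + 1), i < j →
          r (Fin.cons (α := fun _ => Fin k) d f i) (Fin.cons (α := fun _ => Fin k) d f j)) ↔
      r c d ∧ (∀ i, r d (f i)) ∧ ∀ i j, i < j → r (f i) (f j) := by
    intro f
    simp only [Fin.forall_fin_succ, Fin.cons_zero, Fin.cons_succ, Fin.succ_lt_succ_iff,
      Fin.succ_pos, Fin.not_lt_zero, forall_true_left, false_imp_iff, true_and]
    constructor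
    · rintro ⟨⟨h1, -⟩, h2, h3⟩; exact ⟨h1, h2, h3⟩
    · rintro ⟨h1, h2, h3⟩; exact ⟨⟨h1, fun i => hr _ _ _ h1 (h2 i)⟩, h2, h3⟩
  simp only [Fin.consEquiv, Equiv.coe_fn_mk, hiff]
  split_ifs with hcd
  · rw [chainSum, Finset.mul_sum]
    refine Finset.sum_congr rfl fun f _ => ?_
    rw [mul_ite, mul_zero]
    simp only [hcd, true_and, Fin.prod_univ_succ, Fin.cons_zero, Fin.cons_succ]
    congr 1
  · simp [hcd]

/-- The entries from the index `i` on. -/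
def tailList (x : Fin k → R) (i : ℕ) : List R := ((List.finRange k).drop i).map x

set_option linter.unusedSectionVars false in
theorem tailList_of_le (x : Fin k → R) {i : ℕ} (h : k ≤ i) : tailList x i = [] := by
  rw [tailList, List.drop_eq_nil_of_le (by simpa using h), List.map_nil]

set_option linter.unusedSectionVars false in
theorem tailList_of_lt (x : Fin k → R) {i : ℕ} (h : i < k) :
    tailList x i = x ⟨i, h⟩ :: tailList x (i + 1) := by
  rw [tailList, List.drop_eq_getElem_cons (by simpa using h), List.map_cons]
  simp [tailList]

/-- A function of the tails that grows by `G d` at `d` is a sum over the indices. -/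
theorem eq_sum_of_tail (F : ℕ → R) (G : Fin k → R) (h0 : F k = 0)
    (h : ∀ d : Fin k, F d = F (d + 1) + G d) (i : ℕ) (hi : i ≤ k) :
    F i = ∑ d : Fin k, if i ≤ (d : ℕ) then G d else 0 := by
  induction hn : k - i generalizing i with
  | zero =>
    have : i = k := by omega
    subst this
    rw [h0, Finset.sum_eq_zero fun d _ => if_neg (not_le.2 d.2)]
  | succ n ih =>
    have hik : i < k := by omega
    rw [h ⟨i, hik⟩, ih (i + 1) hik (by omega),
      ← Finset.add_sum_erase _ _ (Finset.mem_univ (⟨i, hik⟩ : Fin k)),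
      ← Finset.add_sum_erase Finset.univ (fun d : Fin k => if i ≤ (d : ℕ) then G d else 0)
        (Finset.mem_univ (⟨i, hik⟩ : Fin k)),
      if_neg (by simp), if_pos le_rfl, zero_add, add_comm]
    congr 1
    refine Finset.sum_congr rfl fun d hd => ?_
    have hd' : (d : ℕ) ≠ i := fun e => (Finset.mem_erase.1 hd).1 (Fin.ext e)
    exact if_congr (by omega) rfl rfl

theorem chainSum_le (x : Fin k → R) (c : Fin k) (a : ℕ) :
    chainSum (fun c d => c ≤ d) x c a = listHSymm (tailList x c) a := by
  induction a generalizing c with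
  | zero => rw [chainSum_zero, listHSymm_zero]
  | succ a ih =>
    rw [chainSum_succ (r := fun c d => c ≤ d) (fun _ _ _ => le_trans),
      eq_sum_of_tail (fun i => listHSymm (tailList x i) (a + 1))
        (fun d => x d * listHSymm (tailList x d) a) _ _ c c.2.le]
    · exact Finset.sum_congr rfl fun d _ => by rw [ih]; exact if_congr Fin.le_def rfl rfl
    · rw [tailList_of_le x le_rfl, listHSymm_nil]
    · intro d
      rw [tailList_of_lt x d.2, listHSymm_cons, mul_comm]

theorem chainSum_lt (x : Fin k → R) (c : Fin k) (a : ℕ) :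
    chainSum (fun c d => c < d) x c a = listESymm (tailList x (c + 1)) a := by
  induction a generalizing c with
  | zero => rw [chainSum_zero, listESymm_zero]
  | succ a ih =>
    rw [chainSum_succ (r := fun c d => c < d) (fun _ _ _ => lt_trans),
      eq_sum_of_tail (fun i => listESymm (tailList x i) (a + 1))
        (fun d => x d * listESymm (tailList x (d + 1)) a) _ _ (c + 1) c.2]
    · exact Finset.sum_congr rfl fun d _ => by rw [ih]; exact if_congr Fin.lt_def rfl rfl
    · rw [tailList_of_le x le_rfl, listESymm_nil]
    · intro d
      rw [tailList_of_lt x d.2, listESymm_cons, mul_comm]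

theorem listHook_eq_sum (x : Fin k → R) (a b : ℕ) :
    listHook (tailList x 0) a b
      = ∑ c : Fin k, x c * chainSum (fun c d => c ≤ d) x c a * chainSum (fun c d => c < d) x c b := by
  rw [eq_sum_of_tail (fun i => listHook (tailList x i) a b) (fun d => x d *
    chainSum (fun c d => c ≤ d) x d a * chainSum (fun c d => c < d) x d b) _ _ 0 (Nat.zero_le k)]
  · simp
  · rw [tailList_of_le x le_rfl, listHook_nil]
  · intro d
    rw [chainSum_le, chainSum_lt, tailList_of_lt x d.2, listHook_cons]

end Chains

/-! ### Semistandard tableaux of hook shape -/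

section Tableaux

variable {k : ℕ}

/-- The boxes of a hook: the corner, the arm and the leg. -/
def hookBox (a b : ℕ) : Option (Fin a ⊕ Fin b) → (hookShape (a + 1) (b + 1)).cells
  | none => ⟨(0, 0), (YoungDiagram.mem_cells _).2 (mem_hookShape.2 (Or.inl ⟨rfl, by omega⟩))⟩
  | some (Sum.inl i) =>
    ⟨(0, i + 1), (YoungDiagram.mem_cells _).2 (mem_hookShape.2 (Or.inl ⟨rfl, by omega⟩))⟩
  | some (Sum.inr i) =>
    ⟨(i + 1, 0), (YoungDiagram.mem_cells _).2 (mem_hookShape.2 (Or.inr ⟨rfl, by omega⟩))⟩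

theorem hookBox_bijective (a b : ℕ) : Function.Bijective (hookBox a b) := by
  constructor
  · rintro (_ | _ | _) (_ | _ | _) h <;>
      simp [hookBox, Fin.ext_iff] at h ⊢ <;> exact h
  · rintro ⟨⟨i, j⟩, h⟩
    rcases mem_hookShape.1 ((YoungDiagram.mem_cells _).1 h) with ⟨rfl, hj⟩ | ⟨rfl, hi⟩
    · cases j with
      | zero => exact ⟨none, rfl⟩
      | succ j => exact ⟨some (Sum.inl ⟨j, by omega⟩), rfl⟩
    · cases i with
      | zero => exact ⟨none, rfl⟩
      | succ i => exact ⟨some (Sum.inr ⟨i, by omega⟩), rfl⟩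

theorem isSemistandard_hook_iff {a b : ℕ} (T : (hookShape (a + 1) (b + 1)).cells → Fin k) :
    IsSemistandard (hookShape (a + 1) (b + 1)) T ↔
      ((∀ i, T (hookBox a b none) ≤ T (hookBox a b (some (Sum.inl i)))) ∧
        ∀ i j, i < j → T (hookBox a b (some (Sum.inl i))) ≤ T (hookBox a b (some (Sum.inl j)))) ∧
      ((∀ i, T (hookBox a b none) < T (hookBox a b (some (Sum.inr i)))) ∧
        ∀ i j, i < j →
          T (hookBox a b (some (Sum.inr i))) < T (hookBox a b (some (Sum.inr j)))) := by
  constructor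
  · rintro ⟨h1, h2⟩
    exact ⟨⟨fun i => h1 _ _ rfl (by simp [hookBox]), fun i j hij => h1 _ _ rfl (by
      simpa [hookBox] using hij)⟩, ⟨fun i => h2 _ _ rfl (by simp [hookBox]), fun i j hij =>
        h2 _ _ rfl (by simpa [hookBox] using hij)⟩⟩
  · rintro ⟨⟨h1, h2⟩, h3, h4⟩
    constructor
    · intro u v huv huv'
      obtain ⟨p, rfl⟩ := (hookBox_bijective a b).2 u
      obtain ⟨q, rfl⟩ := (hookBox_bijective a b).2 v
      rcases p with _ | p | p <;> rcases q with _ | q | q <;> simp [hookBox] at huv huv'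
      · exact h1 q
      · exact h2 p q huv'
    · intro u v huv huv'
      obtain ⟨p, rfl⟩ := (hookBox_bijective a b).2 u
      obtain ⟨q, rfl⟩ := (hookBox_bijective a b).2 v
      rcases p with _ | p | p <;> rcases q with _ | q | q <;> simp [hookBox] at huv huv'
      · exact h3 q
      · exact h4 p q huv'

-- Once the corner entry is fixed, the arm is a weakly increasing chain above it and the leg a
-- strictly increasing one, chosen independently.
open MvPolynomial in
theorem schur_hookShape (a b : ℕ) :
    schur (hookShape (a + 1) (b + 1)) k
      = listHook ((List.finRange k).map (X : Fin k → MvPolynomial (Fin k) ℂ)) a b := by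
  classical
  have h0 : (List.finRange k).map (X : Fin k → MvPolynomial (Fin k) ℂ) = tailList X 0 := rfl
  let e := Equiv.ofBijective _ (hookBox_bijective a b)
  let φ : (Fin k × (Fin a → Fin k) × (Fin b → Fin k))
      ≃ ((hookShape (a + 1) (b + 1)).cells → Fin k) :=
    { toFun := fun y z => Option.elim (e.symm z) y.1 (Sum.elim y.2.1 y.2.2)
      invFun := fun T => (T (hookBox a b none), fun i => T (hookBox a b (some (Sum.inl i))),
        fun i => T (hookBox a b (some (Sum.inr i))))
      left_inv := by
        rintro ⟨c, f, g⟩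
        have : ∀ p, e.symm (hookBox a b p) = p := e.symm_apply_apply
        simp [this]
      right_inv := by
        intro T
        funext z
        obtain ⟨p, rfl⟩ := (hookBox_bijective a b).2 z
        have : ∀ p, e.symm (hookBox a b p) = p := e.symm_apply_apply
        rcases p with _ | p | p <;> simp [this] }
  have hφ : ∀ y p, φ y (hookBox a b p) = Option.elim p y.1 (Sum.elim y.2.1 y.2.2) := by
    intro y p
    change Option.elim (e.symm (e p)) _ _ = _
    rw [e.symm_apply_apply]
  rw [h0, listHook_eq_sum, schur, Finset.sum_filter, ← φ.sum_comp, Fintype.sum_prod_type]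
  refine Finset.sum_congr rfl fun c _ => ?_
  rw [Fintype.sum_prod_type, mul_assoc, chainSum, chainSum, Finset.sum_mul_sum, Finset.mul_sum]
  refine Finset.sum_congr rfl fun f _ => ?_
  rw [Finset.mul_sum]
  refine Finset.sum_congr rfl fun g _ => ?_
  rw [isSemistandard_hook_iff, ← e.prod_comp]
  have he : ∀ p, e p = hookBox a b p := fun _ => rfl
  simp only [he, hφ, Option.elim_none, Option.elim_some, Sum.elim_inl, Sum.elim_inr,
    Fintype.prod_option, Fintype.prod_sum_type]
  split_ifs <;> simp_all

end Tableaux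

end FominKirillov

/-! ### Divided differences and the operator ∂_{w_0} -/

namespace FominKirillov

open MvPolynomial

section DividedDifferences

variable {σ τ : Type*} [DecidableEq σ] [DecidableEq τ]

theorem X_sub_X_ne_zero {σ : Type*} {i j : σ} (h : i ≠ j) : (X i - X j : MvPolynomial σ ℂ) ≠ 0 :=
  sub_ne_zero.2 fun e => h (X_injective e)

/-- The polynomial ring is a domain, so the defining equation determines the quotient. -/
theorem divDiff_eq_iff {i j : σ} (h : i ≠ j) {f g : MvPolynomial σ ℂ} :
    divDiff i j f = g ↔ (X i - X j) * g = f - rename (Equiv.swap i j) f := by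
  rw [← divDiff_spec]
  exact ⟨fun e => by rw [e], fun e => (mul_left_cancel₀ (X_sub_X_ne_zero h) e).symm⟩

/-- Allows all computations to be done with variables indexed by ℕ, independently of `n` and `k`. -/
theorem rename_divDiff {e : σ → τ} (he : Function.Injective e) {i j : σ} (h : i ≠ j)
    (f : MvPolynomial σ ℂ) :
    rename e (divDiff i j f) = divDiff (e i) (e j) (rename e f) := by
  symm
  rw [divDiff_eq_iff (he.ne h), ← rename_X, ← rename_X, ← map_sub, ← map_mul, divDiff_spec,
    map_sub, rename_rename, rename_rename]
  congr 2
  congr 1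
  funext a
  simp only [Function.comp_apply]
  exact he.map_swap i j a

theorem divDiff_mul_of_invariant {i j : σ} (h : i ≠ j) {g : MvPolynomial σ ℂ}
    (hg : rename (Equiv.swap i j) g = g) (f : MvPolynomial σ ℂ) :
    divDiff i j (g * f) = g * divDiff i j f := by
  rw [divDiff_eq_iff h, mul_left_comm, divDiff_spec, map_mul, hg, mul_sub]

theorem divDiff_eq_zero {i j : σ} (h : i ≠ j) {f : MvPolynomial σ ℂ}
    (hf : rename (Equiv.swap i j) f = f) : divDiff i j f = 0 := by
  rw [divDiff_eq_iff h, hf, mul_zero, sub_self]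

theorem divDiff_X {i j : σ} (h : i ≠ j) : divDiff i j (X i) = 1 := by
  rw [divDiff_eq_iff h, rename_X, Equiv.swap_apply_left, mul_one]

/-- The divided difference for the variables `x_i` and `x_{i+1}`. -/
noncomputable def adjDiff (i : ℕ) : MvPolynomial ℕ ℂ →ₗ[ℂ] MvPolynomial ℕ ℂ where
  toFun := divDiff i (i + 1)
  map_add' f g := by
    rw [divDiff_eq_iff (Nat.succ_ne_self i).symm, mul_add, divDiff_spec, divDiff_spec, map_add]
    ring
  map_smul' c f := by
    rw [divDiff_eq_iff (Nat.succ_ne_self i).symm, map_smul, RingHom.id_apply, mul_smul_comm,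
      divDiff_spec, smul_sub]

theorem adjDiff_apply (i : ℕ) (f : MvPolynomial ℕ ℂ) : adjDiff i f = divDiff i (i + 1) f := rfl

/-- The exchange of the variables `x_i` and `x_{i+1}`. -/
noncomputable def adjSwap (i : ℕ) : MvPolynomial ℕ ℂ →ₐ[ℂ] MvPolynomial ℕ ℂ :=
  rename (Equiv.swap i (i + 1))

theorem adjDiff_spec (i : ℕ) (f : MvPolynomial ℕ ℂ) :
    (X i - X (i + 1)) * adjDiff i f = f - adjSwap i f := divDiff_spec _ _ _

theorem adjDiff_mul {i : ℕ} {g : MvPolynomial ℕ ℂ} (hg : adjSwap i g = g)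
    (f : MvPolynomial ℕ ℂ) : adjDiff i (g * f) = g * adjDiff i f :=
  divDiff_mul_of_invariant (Nat.succ_ne_self i).symm hg f

theorem adjDiff_eq_zero {i : ℕ} {f : MvPolynomial ℕ ℂ} (hf : adjSwap i f = f) :
    adjDiff i f = 0 := divDiff_eq_zero (Nat.succ_ne_self i).symm hf

theorem adjDiff_X (i : ℕ) : adjDiff i (X i) = 1 := divDiff_X (Nat.succ_ne_self i).symm

theorem adjSwap_comm {i j : ℕ} (h : j + 1 < i) (f : MvPolynomial ℕ ℂ) :
    adjSwap i (adjSwap j f) = adjSwap j (adjSwap i f) := by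
  simp only [adjSwap, rename_rename]
  congr 1
  congr 1
  funext a
  simp only [Function.comp_apply, Equiv.swap_apply_def]
  split_ifs <;> omega

theorem adjSwap_braid (i : ℕ) (f : MvPolynomial ℕ ℂ) :
    adjSwap i (adjSwap (i + 1) (adjSwap i f))
      = adjSwap (i + 1) (adjSwap i (adjSwap (i + 1) f)) := by
  simp only [adjSwap, rename_rename]
  congr 1
  congr 1
  funext a
  simp only [Function.comp_apply, Equiv.swap_apply_def]
  split_ifs <;> omega

theorem adjSwap_adjSwap (i : ℕ) (f : MvPolynomial ℕ ℂ) : adjSwap i (adjSwap i f) = f := by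
  rw [adjSwap, rename_rename]
  convert rename_id_apply f using 3
  funext a
  simp

theorem adjSwap_X_of_ne {i j : ℕ} (h1 : j ≠ i) (h2 : j ≠ i + 1) : adjSwap i (X j) = X j := by
  rw [adjSwap, rename_X, Equiv.swap_apply_of_ne_of_ne h1 h2]

theorem adjSwap_X_left (i : ℕ) : adjSwap i (X i) = X (i + 1) := by
  rw [adjSwap, rename_X, Equiv.swap_apply_left]

theorem adjSwap_X_right (i : ℕ) : adjSwap i (X (i + 1)) = X i := by
  rw [adjSwap, rename_X, Equiv.swap_apply_right]

theorem adjSwap_adjDiff_comm {i j : ℕ} (h : j + 1 < i ∨ i + 1 < j) (f : MvPolynomial ℕ ℂ) :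
    adjSwap i (adjDiff j f) = adjDiff j (adjSwap i f) := by
  refine mul_left_cancel₀ (X_sub_X_ne_zero (Nat.succ_ne_self j).symm) ?_
  have hc : adjSwap i (adjSwap j f) = adjSwap j (adjSwap i f) := by
    rcases h with h | h
    · exact adjSwap_comm h f
    · exact (adjSwap_comm h f).symm
  rw [adjDiff_spec, ← hc, ← map_sub, ← adjDiff_spec, map_mul, map_sub,
    adjSwap_X_of_ne (by omega) (by omega), adjSwap_X_of_ne (by omega) (by omega)]

/-- What the braid relation for the ∂'s would give, as ∂_{i+1} g = 0. Here it is obtained directly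
by clearing denominators. -/
theorem adjSwap_adjDiff_adjDiff {i : ℕ} {g : MvPolynomial ℕ ℂ} (hg : adjSwap (i + 1) g = g) :
    adjSwap i (adjDiff (i + 1) (adjDiff i g)) = adjDiff (i + 1) (adjDiff i g) := by
  have e1 := adjDiff_spec i g
  have e2 := adjDiff_spec (i + 1) (adjDiff i g)
  have e3 := congrArg (adjSwap (i + 1)) e1
  have h0 : adjSwap (i + 1) (X i) = X i := adjSwap_X_of_ne (by omega) (by omega)
  have h1 : adjSwap i (X (i + 2)) = X (i + 2) := adjSwap_X_of_ne (by omega) (by omega)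
  rw [map_mul, map_sub, map_sub, hg, h0, adjSwap_X_left] at e3
  -- The Vandermonde factor and the right-hand side both change sign under the exchange of `X i` and
  -- `X (i + 1)`; for the last term this uses the braid relation of the exchanges and `hg`.
  have e4 : (X i - X (i + 1)) * (X i - X (i + 2)) * (X (i + 1) - X (i + 2))
      * adjDiff (i + 1) (adjDiff i g)
      = g * (X (i + 1) - X (i + 2)) - adjSwap i g * (X i - X (i + 2))
        + adjSwap (i + 1) (adjSwap i g) * (X i - X (i + 1)) := by
    linear_combination (X i - X (i + 1)) * (X i - X (i + 2)) * e2 + (X i - X (i + 2)) * e1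
      - (X i - X (i + 1)) * e3
  have hbraid : adjSwap i (adjSwap (i + 1) (adjSwap i g)) = adjSwap (i + 1) (adjSwap i g) := by
    rw [adjSwap_braid, hg]
  have e5 := congrArg (adjSwap i) e4
  simp only [map_mul, map_sub, map_add, adjSwap_X_left, adjSwap_X_right, h1, adjSwap_adjSwap, hbraid] at e5
  have hne : (X i - X (i + 1)) * (X i - X (i + 2)) * (X (i + 1) - X (i + 2))
      ≠ (0 : MvPolynomial ℕ ℂ) :=
    mul_ne_zero (mul_ne_zero (X_sub_X_ne_zero (by omega)) (X_sub_X_ne_zero (by omega)))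
      (X_sub_X_ne_zero (by omega))
  refine mul_left_cancel₀ hne ?_
  linear_combination -e5 - e4

/-- The operator `∂_{q-1} ⋯ ∂_1 ∂_0`. -/
noncomputable def insertDiff : ℕ → MvPolynomial ℕ ℂ →ₗ[ℂ] MvPolynomial ℕ ℂ
  | 0 => LinearMap.id
  | q + 1 => adjDiff q ∘ₗ insertDiff q

theorem insertDiff_succ (q : ℕ) (f : MvPolynomial ℕ ℂ) :
    insertDiff (q + 1) f = adjDiff q (insertDiff q f) := rfl

/-- The operator of the longest permutation of the first `k` variables. -/
noncomputable def sortDiff : ℕ → MvPolynomial ℕ ℂ →ₗ[ℂ] MvPolynomial ℕ ℂ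
  | 0 => LinearMap.id
  | k + 1 => sortDiff k ∘ₗ insertDiff k

theorem sortDiff_succ (k : ℕ) (f : MvPolynomial ℕ ℂ) :
    sortDiff (k + 1) f = sortDiff k (insertDiff k f) := rfl

theorem insertDiff_mul {q : ℕ} {g : MvPolynomial ℕ ℂ} (hg : ∀ i < q, adjSwap i g = g)
    (f : MvPolynomial ℕ ℂ) : insertDiff q (g * f) = g * insertDiff q f := by
  induction q with
  | zero => rfl
  | succ q ih =>
    rw [insertDiff_succ, ih fun i hi => hg i (by omega), adjDiff_mul (hg q (by omega)),
      insertDiff_succ]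

theorem sortDiff_mul {k : ℕ} {g : MvPolynomial ℕ ℂ} (hg : ∀ i, i + 1 < k → adjSwap i g = g)
    (f : MvPolynomial ℕ ℂ) : sortDiff k (g * f) = g * sortDiff k f := by
  induction k generalizing f with
  | zero => rfl
  | succ k ih =>
    rw [sortDiff_succ, insertDiff_mul fun i hi => hg i (by omega),
      ih fun i hi => hg i (by omega), sortDiff_succ]

theorem adjSwap_insertDiff_comm {i q : ℕ} (h : q < i) (f : MvPolynomial ℕ ℂ) :
    adjSwap i (insertDiff q f) = insertDiff q (adjSwap i f) := by
  induction q with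
  | zero => rfl
  | succ q ih =>
    rw [insertDiff_succ, adjSwap_adjDiff_comm (by omega), ih (by omega), insertDiff_succ]

theorem insertDiff_eq_zero {q : ℕ} (hq : 0 < q) {f : MvPolynomial ℕ ℂ} (hf : adjSwap 0 f = f) :
    insertDiff q f = 0 := by
  induction q, hq using Nat.le_induction with
  | base => exact adjDiff_eq_zero hf
  | succ q _ ih => rw [insertDiff_succ, ih, map_zero]

/-- Passing through ∂_{q-1} ⋯ ∂_0 lowers the index of a symmetry by one. The factor ∂_{i+1} ∂_i does
this, and the other factors commute with the exchange. -/
theorem adjSwap_insertDiff {i q : ℕ} (hq : i + 1 < q) {f : MvPolynomial ℕ ℂ}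
    (hf : adjSwap (i + 1) f = f) : adjSwap i (insertDiff q f) = insertDiff q f := by
  induction q, hq using Nat.le_induction with
  | base =>
    rw [insertDiff_succ, insertDiff_succ, adjSwap_adjDiff_adjDiff]
    rw [adjSwap_insertDiff_comm (by omega), hf]
  | succ q hq ih => rw [insertDiff_succ, adjSwap_adjDiff_comm (by omega), ih]

/-- The symmetry index drops by one at each stage until it is 0, where ∂_0 is applied first and
kills the polynomial. -/
theorem sortDiff_eq_zero {i k : ℕ} (h : i + 1 < k) {f : MvPolynomial ℕ ℂ}
    (hf : adjSwap i f = f) : sortDiff k f = 0 := by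
  induction k generalizing i f with
  | zero => omega
  | succ k ih =>
    rw [sortDiff_succ]
    cases i with
    | zero => rw [insertDiff_eq_zero (by omega) hf, map_zero]
    | succ i => exact ih (by omega) (adjSwap_insertDiff (by omega) hf)

end DividedDifferences

/-! ### Monomials and elementary symmetric polynomials -/

section Monomials

/-- The monomial with the exponents `d`. -/
noncomputable def powProd (n : ℕ) (d : ℕ → ℕ) : MvPolynomial ℕ ℂ :=
  ∏ i ∈ Finset.range n, X i ^ d i

theorem powProd_congr {n : ℕ} {d d' : ℕ → ℕ} (h : ∀ i < n, d i = d' i) :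
    powProd n d = powProd n d' :=
  Finset.prod_congr rfl fun i hi => by rw [h i (Finset.mem_range.1 hi)]

theorem adjSwap_powProd {n i : ℕ} {d : ℕ → ℕ} (hi : i + 1 < n) (h : d i = d (i + 1)) :
    adjSwap i (powProd n d) = powProd n d := by
  simp only [powProd, map_prod, map_pow, adjSwap, rename_X]
  refine Finset.prod_bij' (fun j _ => Equiv.swap i (i + 1) j) (fun j _ => Equiv.swap i (i + 1) j)
    ?_ ?_ ?_ ?_ ?_
  · intro j hj
    rw [Finset.mem_range] at hj ⊢
    rw [Equiv.swap_apply_def]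
    split_ifs <;> omega
  · intro j hj
    rw [Finset.mem_range] at hj ⊢
    rw [Equiv.swap_apply_def]
    split_ifs <;> omega
  · intro j _; simp
  · intro j _; simp
  · intro j _
    congr 1
    rw [Equiv.swap_apply_def]
    split_ifs with h1 h2
    · rw [h1, h]
    · rw [h2, h]
    · rfl

theorem powProd_add (n : ℕ) (d d' : ℕ → ℕ) :
    powProd n (fun i => d i + d' i) = powProd n d * powProd n d' := by
  simp only [powProd, pow_add, Finset.prod_mul_distrib]

theorem powProd_indicator {n : ℕ} {S : Finset ℕ} (hS : S ⊆ Finset.range n) :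
    powProd n (fun i => if i ∈ S then 1 else 0) = ∏ i ∈ S, X i := by
  rw [powProd, ← Finset.prod_subset hS fun i _ hi => by rw [if_neg hi, pow_zero]]
  exact Finset.prod_congr rfl fun i hi => by rw [if_pos hi, pow_one]

/-- The monomial is `X i` times a monomial symmetric in `X i` and `X (i + 1)`, and ∂_i sends `X i`
to 1. -/
theorem adjDiff_powProd {n i : ℕ} {d d' : ℕ → ℕ} (hi : i + 1 < n) (h : d i = d (i + 1))
    (h1 : d' i = d i + 1) (h2 : ∀ j < n, j ≠ i → d' j = d j) :
    adjDiff i (powProd n d') = powProd n d := by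
  have : powProd n d' = powProd n d * X i := by
    have := powProd_indicator (n := n) (S := {i}) (by simp; omega)
    rw [Finset.prod_singleton] at this
    rw [← this, ← powProd_add]
    refine powProd_congr fun j hj => ?_
    by_cases hji : j = i
    · subst hji; simp [h1]
    · simp [hji, h2 j hj hji]
  rw [this, adjDiff_mul (adjSwap_powProd hi h), adjDiff_X, mul_one]

theorem listESymm_eq_sum {R : Type*} [CommRing R] {α : Type*} [DecidableEq α] (f : α → R)
    {l : List α} (hl : l.Nodup) (r : ℕ) :
    listESymm (l.map f) r = ∑ S ∈ l.toFinset.powersetCard r, ∏ i ∈ S, f i := by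
  induction l generalizing r with
  | nil =>
    cases r with
    | zero => simp [listESymm_zero]
    | succ r =>
      rw [List.map_nil, listESymm_nil, List.toFinset_nil,
        Finset.powersetCard_eq_empty.2 (by simp), Finset.sum_empty]
  | cons x l ih =>
    rw [List.nodup_cons] at hl
    cases r with
    | zero => simp [listESymm_zero]
    | succ r =>
      have hx : x ∉ l.toFinset := by simpa using hl.1
      have hxS : ∀ {S : Finset α} {q : ℕ}, S ∈ l.toFinset.powersetCard q → x ∉ S := fun h h' =>
        hx ((Finset.mem_powersetCard.1 h).1 h')
      rw [List.map_cons, listESymm_cons, ih hl.2, ih hl.2, List.toFinset_cons,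
        Finset.powersetCard_succ_insert hx, Finset.sum_union, Finset.sum_image]
      · congr 1
        rw [Finset.sum_mul]
        refine Finset.sum_congr rfl fun S hS => ?_
        rw [Finset.prod_insert (hxS hS), mul_comm]
      · intro S hS T hT h
        rw [← Finset.erase_insert (hxS hS), h, Finset.erase_insert (hxS hT)]
      · rw [Finset.disjoint_left]
        intro S hS hS'
        obtain ⟨T, -, rfl⟩ := Finset.mem_image.1 hS'
        exact hxS hS (Finset.mem_insert_self _ _)

/-- The variables `x_0, …, x_{k-1}`. -/
noncomputable def firstVars (k : ℕ) : List (MvPolynomial ℕ ℂ) := (List.range k).map X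

theorem listESymm_firstVars (k r : ℕ) :
    listESymm (firstVars k) r = ∑ S ∈ (Finset.range k).powersetCard r, ∏ i ∈ S, X i := by
  rw [firstVars, listESymm_eq_sum _ List.nodup_range, List.toFinset_range]

theorem adjSwap_listESymm {k i : ℕ} (hi : i + 1 < k) (r : ℕ) :
    adjSwap i (listESymm (firstVars k) r) = listESymm (firstVars k) r := by
  rw [listESymm_firstVars, map_sum]
  have hmem : ∀ S ∈ (Finset.range k).powersetCard r,
      S.map (Equiv.swap i (i + 1)).toEmbedding ∈ (Finset.range k).powersetCard r := by
    intro S hS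
    rw [Finset.mem_powersetCard] at hS ⊢
    refine ⟨fun j hj => ?_, by rw [Finset.card_map, hS.2]⟩
    obtain ⟨p, hp, rfl⟩ := Finset.mem_map.1 hj
    have := Finset.mem_range.1 (hS.1 hp)
    rw [Finset.mem_range, Equiv.coe_toEmbedding, Equiv.swap_apply_def]
    split_ifs <;> omega
  have hinv : ∀ S : Finset ℕ, (S.map (Equiv.swap i (i + 1)).toEmbedding).map
      (Equiv.swap i (i + 1)).toEmbedding = S := by
    intro S
    ext j
    simp only [Finset.mem_map_equiv, Equiv.symm_swap, Equiv.swap_apply_self]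
  refine Finset.sum_bij' (fun S _ => S.map (Equiv.swap i (i + 1)).toEmbedding)
    (fun S _ => S.map (Equiv.swap i (i + 1)).toEmbedding) hmem hmem (fun S _ => hinv S)
    (fun S _ => hinv S) fun S _ => ?_
  rw [Finset.prod_map, map_prod]
  simp only [adjSwap, rename_X, Equiv.coe_toEmbedding]

end Monomials

/-! ### The hook recursion for ∂_{w_0} of monomials -/

section Pieri

/-- The exponents `λ_i + k - i` for the hook `λ = (s, 1^{t-1})`, with `i` counted from `0`. -/
def hookExp (k s t i : ℕ) : ℕ := (if i = 0 then s else if i < t then 1 else 0) + (k - 1 - i)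

/-- Symmetric factors pass through ∂_{w_0}. Most of the resulting terms have two equal adjacent
exponents and vanish. -/
theorem listESymm_mul_sortDiff (k t : ℕ) (d : ℕ → ℕ) :
    listESymm (firstVars k) t * sortDiff k (powProd k d)
      = ∑ S ∈ (Finset.range k).powersetCard t,
          sortDiff k (powProd k fun i => d i + if i ∈ S then 1 else 0) := by
  rw [← sortDiff_mul fun i hi => adjSwap_listESymm hi t, listESymm_firstVars, Finset.sum_mul,
    map_sum]
  refine Finset.sum_congr rfl fun S hS => ?_
  rw [powProd_add, powProd_indicator (Finset.mem_powersetCard.1 hS).1, mul_comm]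

/-- A set of naturals that contains `i` with `i + 1` above `a` is an interval. -/
theorem eq_Ico_of_forall {a k : ℕ} {S : Finset ℕ} (hS : ∀ i ∈ S, a ≤ i ∧ i < k)
    (h : ∀ i, a ≤ i → i + 1 < k → i + 1 ∈ S → i ∈ S) : S = Finset.Ico a (a + S.card) := by
  have hdown : ∀ q p, a ≤ p → p + q ∈ S → p ∈ S := by
    intro q
    induction q with
    | zero => exact fun p _ hp => hp
    | succ q ih => exact fun p hap hp => ih p hap (h (p + q) (by omega) (hS _ hp).2 hp)
  refine Finset.eq_of_subset_of_card_le (fun p hp => ?_) (by simp)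
  have hsub : Finset.Icc a p ⊆ S := fun j hj => by
    rw [Finset.mem_Icc] at hj
    exact hdown (p - j) j hj.1 (by rwa [Nat.add_sub_cancel' hj.2])
  have := Finset.card_le_card hsub
  have hap := (hS p hp).1
  rw [Nat.card_Icc] at this
  rw [Finset.mem_Ico]
  omega

theorem sortDiff_pieri_zero {k t : ℕ} (ht : t ≤ k) :
    listESymm (firstVars k) t * sortDiff k (powProd k (hookExp k 0 1))
      = sortDiff k (powProd k fun i => (k - 1 - i) + if i < t then 1 else 0) := by
  rw [listESymm_mul_sortDiff, Finset.sum_eq_single (Finset.range t)]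
  · congr 1
    refine powProd_congr fun i _ => ?_
    simp only [hookExp, Finset.mem_range]
    congr 1
    split_ifs <;> omega
  · intro S hS hne
    rw [Finset.mem_powersetCard] at hS
    by_cases h : ∀ i, 0 ≤ i → i + 1 < k → i + 1 ∈ S → i ∈ S
    · refine absurd ?_ hne
      rw [eq_Ico_of_forall (fun i hi => ⟨Nat.zero_le i, Finset.mem_range.1 (hS.1 hi)⟩) h,
        hS.2, zero_add, Finset.range_eq_Ico]
    · push Not at h
      obtain ⟨i, -, hik, hi1, hi⟩ := h
      refine sortDiff_eq_zero hik (adjSwap_powProd hik ?_)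
      rw [if_neg hi, if_pos hi1]
      simp only [hookExp]
      split_ifs <;> omega
  · intro h
    exact absurd (Finset.mem_powersetCard.2 ⟨Finset.range_subset_range.2 ht, Finset.card_range t⟩) h

theorem sortDiff_pieri {k s t : ℕ} (ht : 1 ≤ t) (htk : t ≤ k) :
    listESymm (firstVars k) t * sortDiff k (powProd k (hookExp k s 1))
      = sortDiff k (powProd k (hookExp k (s + 1) t))
        + if t + 1 ≤ k then sortDiff k (powProd k (hookExp k s (t + 1))) else 0 := by
  have h1 : Finset.range t ∈ (Finset.range k).powersetCard t :=
    Finset.mem_powersetCard.2 ⟨Finset.range_subset_range.2 htk, Finset.card_range t⟩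
  rw [listESymm_mul_sortDiff, ← Finset.add_sum_erase _ _ h1]
  congr 1
  · congr 1
    refine powProd_congr fun i _ => ?_
    simp only [hookExp, Finset.mem_range]
    split_ifs <;> omega
  have hzero : ∀ S ∈ (Finset.range k).powersetCard t, S ≠ Finset.range t →
      S ≠ Finset.Ico 1 (1 + t) →
      sortDiff k (powProd k fun i => hookExp k s 1 i + if i ∈ S then 1 else 0) = 0 := by
    intro S hS hne1 hne2
    rw [Finset.mem_powersetCard] at hS
    by_cases h : ∀ i, 1 ≤ i → i + 1 < k → i + 1 ∈ S → i ∈ S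
    · exfalso
      by_cases h0 : 0 ∈ S
      · have hcard := Finset.card_erase_of_mem h0
        have := eq_Ico_of_forall (a := 1) (k := k) (S := S.erase 0) (fun i hi => by
          rw [Finset.mem_erase] at hi
          exact ⟨by omega, Finset.mem_range.1 (hS.1 hi.2)⟩) (fun i h1 h2 h3 =>
            Finset.mem_erase.2 ⟨by omega, h i h1 h2 (Finset.mem_of_mem_erase h3)⟩)
        refine hne1 ?_
        rw [← Finset.insert_erase h0, this, hcard, hS.2]
        ext j
        simp only [Finset.mem_insert, Finset.mem_Ico, Finset.mem_range]
        omega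
      · refine hne2 ?_
        rw [eq_Ico_of_forall (a := 1) (k := k) (fun i hi => ⟨Nat.pos_of_ne_zero fun e =>
          h0 (e ▸ hi), Finset.mem_range.1 (hS.1 hi)⟩) h, hS.2]
    · push Not at h
      -- Beyond index 0 the exponents of a one-row shape drop by one at each step, so adding 1 at `i
      -- + 1` but not at `i` makes two adjacent exponents equal. Only {0, …, t-1} and {1, …, t}
      -- survive.
      obtain ⟨i, hi1, hik, hi2, hi⟩ := h
      refine sortDiff_eq_zero hik (adjSwap_powProd hik ?_)
      rw [if_neg hi, if_pos hi2]
      simp only [hookExp]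
      rw [if_neg (by omega), if_neg (by omega), if_neg (by omega), if_neg (by omega)]
      clear hS hne1 hne2 htk
      omega
  split_ifs with hk
  · rw [Finset.sum_eq_single (Finset.Ico 1 (1 + t))]
    · congr 1
      refine powProd_congr fun i _ => ?_
      simp only [hookExp, Finset.mem_Ico]
      split_ifs <;> omega
    · intro S hS hne
      rw [Finset.mem_erase] at hS
      exact hzero S hS.2 hS.1 hne
    · intro h
      refine absurd (Finset.mem_erase.2 ⟨fun e => ?_, Finset.mem_powersetCard.2
        ⟨fun j hj => ?_, by simp⟩⟩) h
      · have : 0 ∈ Finset.Ico 1 (1 + t) := by rw [e]; exact Finset.mem_range.2 ht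
        simp at this
      · rw [Finset.mem_Ico] at hj
        rw [Finset.mem_range]; omega
  · refine Finset.sum_eq_zero fun S hS => ?_
    rw [Finset.mem_erase] at hS
    refine hzero S hS.2 hS.1 fun e => ?_
    have := (Finset.mem_powersetCard.1 hS.2).1
    rw [e] at this
    have := Finset.mem_range.1 (this (Finset.mem_Ico.2 ⟨ht, (by omega : t < 1 + t)⟩))
    omega

theorem listHook_leg_zero {R : Type*} [CommRing R] (l : List R) (a : ℕ) :
    listHook l a 0 = listHSymm l (a + 1) := by
  induction l with
  | nil => rw [listHook_nil, listHSymm_nil]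
  | cons x l ih => rw [listHook_cons, ih, listESymm_zero, mul_one, listHSymm_cons, mul_comm x]

theorem listHook_of_length_le {R : Type*} [CommRing R] (l : List R) (a b : ℕ)
    (h : l.length ≤ b) : listHook l a b = 0 := by
  induction l with
  | nil => rfl
  | cons x l ih =>
    rw [List.length_cons] at h
    rw [listHook_cons, ih (by omega), listESymm_of_length_lt l (r := b) (by omega), mul_zero, add_zero]

/-- Induction on the arm, comparing `sortDiff_pieri` with `listHook_add`. For a leg that fills all
`k` rows the second hook is absent on one side and zero on the other. The value on the staircase is
a hypothesis here; it is established as a Schubert polynomial in `sortDiff_staircase`. -/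
theorem sortDiff_hookExp {k : ℕ} (h1 : sortDiff k (powProd k fun i => k - 1 - i) = 1) (a : ℕ)
    {b : ℕ} (hb : b + 1 ≤ k) :
    sortDiff k (powProd k (hookExp k (a + 1) (b + 1))) = listHook (firstVars k) a b := by
  induction a generalizing b with
  | zero =>
    have h := sortDiff_pieri_zero hb
    have h0 : powProd k (hookExp k 0 1) = powProd k fun i => k - 1 - i :=
      powProd_congr fun i _ => by simp only [hookExp]; split_ifs <;> omega
    rw [h0, h1, mul_one] at h
    rw [listHook_zero, h]
    congr 1
    refine powProd_congr fun i _ => ?_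
    simp only [hookExp]
    split_ifs <;> omega
  | succ a ih =>
    have h := sortDiff_pieri (s := a + 1) (by omega : 1 ≤ b + 1) hb
    have h2 := ih (b := 0) (by omega)
    rw [zero_add] at h2
    rw [h2, listHook_leg_zero, ← listHook_add] at h
    split_ifs at h with hk
    · rw [ih hk] at h
      exact (add_right_cancel h).symm
    · rw [listHook_of_length_le _ a (b + 1) (by simp [firstVars]; omega)] at h
      exact (add_right_cancel h).symm

end Pieri

end FominKirillov

/-! ### Schubert polynomials of dominant and Grassmannian permutations -/

namespace FominKirillov

open MvPolynomial

section Words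

variable {n : ℕ}

/-- The word of a permutation of `Fin n` as a function on the natural numbers. -/
def permWord (w : Equiv.Perm (Fin n)) (i : ℕ) : ℕ := if h : i < n then w ⟨i, h⟩ else i

theorem permWord_of_lt (w : Equiv.Perm (Fin n)) {i : ℕ} (h : i < n) :
    permWord w i = w ⟨i, h⟩ := dif_pos h

theorem permWord_val (w : Equiv.Perm (Fin n)) (i : Fin n) : permWord w i = w i :=
  permWord_of_lt w i.2

theorem permWord_mul_swap (w : Equiv.Perm (Fin n)) {i : ℕ} (hi : i + 1 < n) (j : ℕ) :
    permWord (w * Equiv.swap ⟨i, Nat.lt_of_succ_lt hi⟩ ⟨i + 1, hi⟩) j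
      = permWord w (Equiv.swap i (i + 1) j) := by
  rcases lt_or_ge j n with hj | hj
  · have h : Equiv.swap i (i + 1) j
        = (Equiv.swap (⟨i, Nat.lt_of_succ_lt hi⟩ : Fin n) ⟨i + 1, hi⟩ ⟨j, hj⟩ : Fin n) := by
      simp only [Equiv.swap_apply_def, Fin.ext_iff]
      split_ifs <;> rfl
    rw [permWord_of_lt _ hj, h, permWord_val, Equiv.Perm.mul_apply]
  · rw [Equiv.swap_apply_of_ne_of_ne (by omega) (by omega), permWord, permWord,
      dif_neg (not_lt.2 hj), dif_neg (not_lt.2 hj)]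

/-- The Schubert polynomial with variables indexed by the natural numbers. -/
noncomputable def natSchubert (w : Equiv.Perm (Fin n)) : MvPolynomial ℕ ℂ :=
  rename (Fin.val : Fin n → ℕ) (schubert w)

/-- The definition resolves the first ascent. All later arguments do the same, so independence of
the choice of the ascent is not needed. -/
theorem natSchubert_of_first_ascent (w : Equiv.Perm (Fin n)) {i : ℕ} (hi : i + 1 < n)
    (h : permWord w i < permWord w (i + 1)) (hmin : ∀ j < i, permWord w (j + 1) < permWord w j) :
    natSchubert w = adjDiff i
      (natSchubert (w * Equiv.swap ⟨i, Nat.lt_of_succ_lt hi⟩ ⟨i + 1, hi⟩)) := by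
  classical
  have hasc : HasAscentAt w i := ⟨hi, by
    rwa [permWord_of_lt w (Nat.lt_of_succ_lt hi), permWord_of_lt w hi] at h⟩
  have hex : ∃ i, HasAscentAt w i := ⟨i, hasc⟩
  have hno : ∀ j < i, ¬ HasAscentAt w j := by
    rintro j hj ⟨hj1, hlt⟩
    have := hmin j hj
    rw [permWord_of_lt w hj1, permWord_of_lt w (Nat.lt_of_succ_lt hj1)] at this
    exact absurd (Fin.lt_def.1 hlt) (not_lt.2 this.le)
  have hS : schubert w = divDiff (⟨i, Nat.lt_of_succ_lt hi⟩ : Fin n) ⟨i + 1, hi⟩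
      (schubert (w * Equiv.swap ⟨i, Nat.lt_of_succ_lt hi⟩ ⟨i + 1, hi⟩)) := by
    rw [schubert, dif_pos hex]
    have hf : Nat.find hex = i := (Nat.find_eq_iff hex).2 ⟨hasc, hno⟩
    congr!
  rw [natSchubert, hS, rename_divDiff Fin.val_injective (by simp), adjDiff_apply]
  rfl

theorem natSchubert_of_no_ascent (w : Equiv.Perm (Fin n))
    (h : ∀ i, i + 1 < n → permWord w (i + 1) < permWord w i) :
    natSchubert w = powProd n fun i => n - 1 - i := by
  have hno : ¬ ∃ i, HasAscentAt w i := by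
    rintro ⟨i, hi, hlt⟩
    have := h i hi
    rw [permWord_of_lt w hi, permWord_of_lt w (Nat.lt_of_succ_lt hi)] at this
    exact absurd (Fin.lt_def.1 hlt) (not_lt.2 this.le)
  rw [natSchubert, schubert, dif_neg hno, map_prod, powProd, Finset.prod_range]
  simp only [map_pow, rename_X]

end Words

/-! ### Lehmer codes -/

section Codes

/-- The Lehmer code of a word of length `n`. -/
def code (n : ℕ) (W : ℕ → ℕ) (i : ℕ) : ℕ :=
  ((Finset.range n).filter fun j => i < j ∧ W j < W i).card

variable {n : ℕ} {W W' : ℕ → ℕ} {i : ℕ}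

theorem code_le_succ (h : W i < W (i + 1)) : code n W i ≤ code n W (i + 1) := by
  refine Finset.card_le_card fun j hj => ?_
  simp only [Finset.mem_filter] at hj ⊢
  refine ⟨hj.1, lt_of_le_of_ne hj.2.1 fun e => ?_, hj.2.2.trans h⟩
  rw [← e] at hj; omega

theorem code_succ_lt (hi : i + 1 < n) (h : W (i + 1) < W i) : code n W (i + 1) < code n W i := by
  refine Finset.card_lt_card (Finset.ssubset_iff.2 ⟨i + 1, by simp, fun j hj => ?_⟩)
  rw [Finset.mem_insert] at hj
  rcases hj with rfl | hj
  · simp [hi, h]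
  · simp only [Finset.mem_filter] at hj ⊢
    exact ⟨hj.1, by omega, by omega⟩

/-- Together with `code_swap_right` and `code_swap_of_ne`: exchanging an ascent turns the code
entries (p, q) at `i`, `i + 1` into (q + 1, p) and leaves the others alone. -/
theorem code_swap_left (hi : i + 1 < n) (h : W i < W (i + 1))
    (hW : ∀ j, W' j = W (Equiv.swap i (i + 1) j)) : code n W' i = code n W (i + 1) + 1 := by
  have hset : (Finset.range n).filter (fun j => i < j ∧ W' j < W' i)
      = insert (i + 1) ((Finset.range n).filter fun j => i + 1 < j ∧ W j < W (i + 1)) := by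
    ext j
    simp only [Finset.mem_insert, Finset.mem_filter, Finset.mem_range, hW, Equiv.swap_apply_left]
    rcases lt_trichotomy j (i + 1) with hj | rfl | hj
    · omega
    · simp [hi, h]
    · rw [Equiv.swap_apply_of_ne_of_ne (by omega) (by omega)]
      omega
  rw [code, hset, Finset.card_insert_of_notMem (by simp), code]

theorem code_swap_right (h : W i < W (i + 1))
    (hW : ∀ j, W' j = W (Equiv.swap i (i + 1) j)) : code n W' (i + 1) = code n W i := by
  rw [code, code]
  congr 1
  ext j
  simp only [Finset.mem_filter, Finset.mem_range, hW, Equiv.swap_apply_right]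
  rcases lt_trichotomy j (i + 1) with hj | rfl | hj
  · omega
  · have := h.le; omega
  · rw [Equiv.swap_apply_of_ne_of_ne (by omega) (by omega)]
    omega

theorem code_swap_of_ne (hi : i + 1 < n) (hW : ∀ j, W' j = W (Equiv.swap i (i + 1) j)) {p : ℕ}
    (h1 : p ≠ i) (h2 : p ≠ i + 1) : code n W' p = code n W p := by
  have hp : W' p = W p := by rw [hW, Equiv.swap_apply_of_ne_of_ne h1 h2]
  have hlt : ∀ j, (p < Equiv.swap i (i + 1) j ↔ p < j)
      ∧ (Equiv.swap i (i + 1) j < n ↔ j < n) := fun j => by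
    rw [Equiv.swap_apply_def]
    split_ifs <;> omega
  refine Finset.card_bij' (fun j _ => Equiv.swap i (i + 1) j) (fun j _ => Equiv.swap i (i + 1) j)
    ?_ ?_ ?_ ?_
  · intro j hj
    simp only [Finset.mem_filter, Finset.mem_range, hp, hW] at hj ⊢
    rwa [(hlt j).1, (hlt j).2]
  · intro j hj
    simp only [Finset.mem_filter, Finset.mem_range, hp, hW, Equiv.swap_apply_self] at hj ⊢
    rwa [(hlt j).1, (hlt j).2]
  · intro j _; simp
  · intro j _; simp

/-- The Schubert polynomial of a dominant permutation is a monomial. -/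
theorem natSchubert_of_dominant (w : Equiv.Perm (Fin n))
    (hdom : ∀ i, i + 1 < n → code n (permWord w) (i + 1) ≤ code n (permWord w) i) :
    natSchubert w = powProd n (code n (permWord w)) := by
  classical
  induction hN : ∑ x : Fin n, (x : ℕ) * (w x : ℕ) using Nat.strong_induction_on
    generalizing w with
  | _ N ih =>
    by_cases hex : ∃ i, i + 1 < n ∧ permWord w i < permWord w (i + 1)
    · set i := Nat.find hex with hidef
      obtain ⟨hi, hasc⟩ := Nat.find_spec hex
      rw [← hidef] at hi hasc
      have hmin : ∀ j < i, permWord w (j + 1) < permWord w j := fun j hj => by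
        have := Nat.find_min hex hj
        refine lt_of_le_of_ne (not_lt.1 fun h => this ⟨by omega, h⟩) fun e => ?_
        rw [permWord_of_lt w (by omega : j + 1 < n), permWord_of_lt w (by omega : j < n)] at e
        have := congrArg Fin.val (w.injective (Fin.ext e))
        simp at this
      set w' := w * Equiv.swap (⟨i, Nat.lt_of_succ_lt hi⟩ : Fin n) ⟨i + 1, hi⟩ with hw'
      have hW := permWord_mul_swap w hi
      rw [← hw'] at hW
      have c1 := code_swap_left hi hasc hW
      have c2 := code_swap_right (n := n) hasc hW
      have c3 := fun p => code_swap_of_ne (p := p) hi hW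
      -- At an ascent the code weakly increases, so dominance forces equality. The code of `w'` is
      -- then that of `w` with 1 added at `i`, as `adjDiff_powProd` requires.
      have ceq : code n (permWord w) i = code n (permWord w) (i + 1) :=
        le_antisymm (code_le_succ hasc) (hdom i hi)
      rw [natSchubert_of_first_ascent w hi hasc hmin, ← hw', ih _ ?_ w' ?_ rfl]
      · refine adjDiff_powProd hi ceq (by rw [c1, ceq]) fun j hj hji => ?_
        by_cases hj' : j = i + 1
        · rw [hj', c2, ceq]
        · exact c3 j hji hj'
      · rw [← hN]
        refine sum_mul_swap_lt w _ _ (Fin.mk_lt_mk.2 (Nat.lt_succ_self _)) ?_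
        rw [permWord_of_lt w (Nat.lt_of_succ_lt hi), permWord_of_lt w hi] at hasc
        exact Fin.lt_def.2 hasc
      · intro p hp
        have hdp := hdom p hp
        rcases lt_trichotomy (p + 1) i with h | h | h
        · rw [c3 p (by omega) (by omega), c3 (p + 1) (by omega) (by omega)]
          exact hdp
        -- Before the first ascent the code drops strictly, which leaves room for the added 1.
        · have := code_succ_lt (n := n) hp (hmin p (by omega))
          rw [h] at this ⊢
          rw [c3 p (by omega) (by omega), c1]
          omega
        · rcases Nat.eq_or_lt_of_le (Nat.lt_succ_iff.1 h) with h | h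
          · rw [← h, c1, c2]; omega
          · rcases Nat.eq_or_lt_of_le (Nat.succ_le_of_lt h) with h | h
            · rw [← h, Nat.succ_eq_add_one, c2, c3 _ (by omega) (by omega), ceq]
              exact hdom _ (by omega)
            · rw [c3 p (by omega) (by omega), c3 (p + 1) (by omega) (by omega)]
              exact hdp
    · push Not at hex
      have hdesc : ∀ i, i + 1 < n → permWord w (i + 1) < permWord w i := fun i hi => by
        refine lt_of_le_of_ne (hex i hi) fun e => ?_
        rw [permWord_of_lt w hi, permWord_of_lt w (Nat.lt_of_succ_lt hi)] at e
        have := congrArg Fin.val (w.injective (Fin.ext e))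
        simp at this
      have hanti : ∀ d i, i + d + 1 < n → permWord w (i + d + 1) < permWord w i := by
        intro d
        induction d with
        | zero => exact fun i hi => hdesc i hi
        | succ d ihd => exact fun i hi => (hdesc (i + d + 1) hi).trans (ihd i (by omega))
      rw [natSchubert_of_no_ascent w hdesc]
      refine powProd_congr fun i hi => ?_
      have : (Finset.range n).filter (fun j => i < j ∧ permWord w j < permWord w i)
          = Finset.Ico (i + 1) n := by
        ext j
        simp only [Finset.mem_filter, Finset.mem_range, Finset.mem_Ico]
        constructor
        · omega
        · intro hj
          have := hanti (j - i - 1) i (by omega)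
          rw [show i + (j - i - 1) + 1 = j by omega] at this
          exact ⟨hj.2, by omega, this⟩
      rw [code, this, Nat.card_Ico]
      omega

end Codes

/-! ### Sorting the first k entries into decreasing order -/

section Sorting

variable {n : ℕ}

/-- The entry at `p` exceeds the decreasing entries before it, so the first ascent is just to its
left. Resolving it moves the entry one place to the left, and this repeats until the entry is in
front. -/
theorem natSchubert_insert (p : ℕ) (hp : p < n) (w : Equiv.Perm (Fin n))
    (h1 : ∀ i, i + 1 < p → permWord w (i + 1) < permWord w i)
    (h2 : ∀ i < p, permWord w i < permWord w p) :
    ∃ w' : Equiv.Perm (Fin n), permWord w' 0 = permWord w p ∧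
      (∀ i < p, permWord w' (i + 1) = permWord w i) ∧
      (∀ i, p < i → permWord w' i = permWord w i) ∧
      natSchubert w = insertDiff p (natSchubert w') := by
  induction p generalizing w with
  | zero => exact ⟨w, rfl, by simp, fun _ _ => rfl, rfl⟩
  | succ p ih =>
    have hW := permWord_mul_swap w hp
    set v := w * Equiv.swap (⟨p, Nat.lt_of_succ_lt hp⟩ : Fin n) ⟨p + 1, hp⟩ with hv
    have e1 : permWord v p = permWord w (p + 1) := by rw [hW, Equiv.swap_apply_left]
    have e2 : permWord v (p + 1) = permWord w p := by rw [hW, Equiv.swap_apply_right]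
    have e3 : ∀ i, i ≠ p → i ≠ p + 1 → permWord v i = permWord w i := fun i a b => by
      rw [hW, Equiv.swap_apply_of_ne_of_ne a b]
    obtain ⟨w', a1, a2, a3, a4⟩ := ih (by omega) v (fun i hi => by
      rw [e3 _ (by omega) (by omega), e3 _ (by omega) (by omega)]
      exact h1 i (by omega)) (fun i hi => by
      rw [e1, e3 _ (by omega) (by omega)]
      exact h2 i (by omega))
    refine ⟨w', by rw [a1, e1], fun i hi => ?_, fun i hi => ?_, ?_⟩
    · rcases Nat.lt_succ_iff_lt_or_eq.1 hi with h | rfl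
      · rw [a2 i h, e3 _ (by omega) (by omega)]
      · rw [a3 _ (by omega), e2]
    · rw [a3 i (by omega), e3 _ (by omega) (by omega)]
    · rw [natSchubert_of_first_ascent w hp (h2 p (by omega)) (fun j hj => h1 j (by omega)), ← hv,
        a4, insertDiff_succ]

/-- Insert the entries one after another at the front: after `q` insertions the first `q` entries
are reversed, and the next one is larger than all of them. -/
theorem natSchubert_sort {k : ℕ} (hk : k ≤ n) (w : Equiv.Perm (Fin n))
    (h : ∀ i j, i < j → j < k → permWord w i < permWord w j) (q : ℕ) (hq : q ≤ k) :
    ∃ v : Equiv.Perm (Fin n), (∀ i < q, permWord v i = permWord w (q - 1 - i)) ∧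
      (∀ i, q ≤ i → permWord v i = permWord w i) ∧
      natSchubert w = sortDiff q (natSchubert v) := by
  induction q with
  | zero => exact ⟨w, by simp, fun _ _ => rfl, rfl⟩
  | succ q ih =>
    obtain ⟨v, b1, b2, b3⟩ := ih (by omega)
    obtain ⟨v', a1, a2, a3, a4⟩ := natSchubert_insert q (by omega) v (fun i hi => by
      rw [b1 i (by omega), b1 (i + 1) (by omega)]
      exact h _ _ (by omega) (by omega)) (fun i hi => by
      rw [b1 i hi, b2 q le_rfl]
      exact h _ _ (by omega) (by omega))
    refine ⟨v', fun i hi => ?_, fun i hi => ?_, ?_⟩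
    · cases i with
      | zero => rw [a1, b2 q le_rfl]; rfl
      | succ i =>
        rw [a2 i (by omega), b1 i (by omega)]
        congr 1
        omega
    · rw [a3 i (by omega), b2 i (by omega)]
    · rw [b3, a4, sortDiff_succ]

theorem card_filter_permWord_lt (w : Equiv.Perm (Fin n)) {i : ℕ} (hi : i < n) :
    ((Finset.range n).filter fun j => permWord w j < permWord w i).card = permWord w i := by
  have hb : permWord w i < n := by rw [permWord_of_lt w hi]; exact (w _).2
  conv_rhs => rw [← Finset.card_range (permWord w i)]
  refine Finset.card_bij (fun j _ => permWord w j) ?_ ?_ ?_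
  · intro j hj
    exact Finset.mem_range.2 (Finset.mem_filter.1 hj).2
  · intro j hj j' hj' e
    simp only [Finset.mem_filter, Finset.mem_range] at hj hj'
    rw [permWord_of_lt w hj.1, permWord_of_lt w hj'.1] at e
    exact congrArg Fin.val (w.injective (Fin.ext e))
  · intro b hb'
    rw [Finset.mem_range] at hb'
    have hbn : b < n := by omega
    refine ⟨w.symm ⟨b, hbn⟩, ?_, ?_⟩
    · simp only [Finset.mem_filter, Finset.mem_range]
      refine ⟨(w.symm _).2, ?_⟩
      rw [permWord_val, Equiv.apply_symm_apply]
      exact hb'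
    · rw [permWord_val, Equiv.apply_symm_apply]

/-- The Schubert polynomial of a Grassmannian permutation. -/
theorem natSchubert_grassmannian {k : ℕ} (hk : k ≤ n) (w : Equiv.Perm (Fin n))
    (h1 : ∀ i j, i < j → j < k → permWord w i < permWord w j)
    (h2 : ∀ i j, k ≤ i → i < j → j < n → permWord w i < permWord w j) :
    natSchubert w = sortDiff k (powProd k fun i => permWord w (k - 1 - i)) := by
  obtain ⟨v, b1, b2, b3⟩ := natSchubert_sort hk w h1 k le_rfl
  -- The first `k` entries of `v` decrease, so all values smaller than one of them stand to its
  -- right.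
  have c1 : ∀ i < k, code n (permWord v) i = permWord v i := fun i hi => by
    rw [← card_filter_permWord_lt v (by omega : i < n), code]
    congr 1
    refine Finset.filter_congr fun j _ => and_iff_right_of_imp fun hlt => ?_
    by_contra hn
    rcases Nat.eq_or_lt_of_le (not_lt.1 hn) with rfl | hji
    · exact lt_irrefl _ hlt
    · rw [b1 j (by omega), b1 i hi] at hlt
      exact lt_asymm hlt (h1 _ _ (by omega) (by omega))
  -- The remaining entries increase, so nothing smaller follows them. Hence `v` is dominant.
  have c2 : ∀ i, k ≤ i → code n (permWord v) i = 0 := fun i hi => by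
    rw [code, Finset.card_eq_zero, Finset.filter_eq_empty_iff]
    rintro j hj ⟨hij, hlt⟩
    rw [b2 i hi, b2 j (by omega)] at hlt
    exact lt_asymm hlt (h2 i j hi hij (Finset.mem_range.1 hj))
  rw [b3, natSchubert_of_dominant v]
  · congr 1
    rw [powProd, ← Finset.prod_subset (Finset.range_subset_range.2 hk)]
    · refine Finset.prod_congr rfl fun i hi => ?_
      rw [c1 i (Finset.mem_range.1 hi), b1 i (Finset.mem_range.1 hi)]
    · intro i _ hi
      rw [c2 i (by simpa using hi), pow_zero]
  · intro i hi
    rcases lt_or_ge (i + 1) k with h | h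
    · rw [c1 i (by omega), c1 _ h, b1 i (by omega), b1 _ h]
      exact (h1 _ _ (by omega) (by omega)).le
    · rw [c2 _ h]; exact Nat.zero_le _

/-- Computes the Schubert polynomial of the identity of S_k in two ways: as a Grassmannian
permutation with `n = k`, and as a dominant one with zero code. -/
theorem sortDiff_staircase (k : ℕ) : sortDiff k (powProd k fun i => k - 1 - i) = 1 := by
  have hid : ∀ i, permWord (1 : Equiv.Perm (Fin k)) i = i := fun i => by
    rw [permWord]; split_ifs <;> rfl
  have h := natSchubert_grassmannian (k := k) le_rfl (1 : Equiv.Perm (Fin k))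
    (fun i j hij _ => by simpa only [hid] using hij) (fun i j _ hij _ => by
      simpa only [hid] using hij)
  simp only [hid] at h
  have hc : ∀ i, code k (permWord (1 : Equiv.Perm (Fin k))) i = 0 := fun i => by
    rw [code, Finset.card_eq_zero, Finset.filter_eq_empty_iff]
    rintro j - ⟨hij, hlt⟩
    rw [hid, hid] at hlt
    omega
  rw [← h, natSchubert_of_dominant _ fun i _ => by rw [hc, hc], powProd]
  exact Finset.prod_eq_one fun i _ => by rw [hc, pow_zero]

/-- The Schubert polynomial of the Grassmannian permutation of a hook is a Schur polynomial. -/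
theorem schubert_grassmannianPerm_hookShape {k m a b : ℕ} (ha : a + 1 ≤ m) (hb : b + 1 ≤ k) :
    schubert (grassmannianPerm (k + m) k (hookShape (a + 1) (b + 1)))
      = rename (Fin.castAdd m) (schur (hookShape (a + 1) (b + 1)) k) := by
  have hrow := rowLen_hookShape (s := a + 1) (t := b + 1) (by omega) (by omega)
  have hk : k ≤ k + m := Nat.le_add_right k m
  have hμ : (hookShape (a + 1) (b + 1)).rowLen 0 ≤ k + m - k := by
    rw [hrow, if_pos rfl]; omega
  set w := grassmannianPerm (k + m) k (hookShape (a + 1) (b + 1)) with hw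
  have hword : ∀ i < k, permWord w i
      = (hookShape (a + 1) (b + 1)).rowLen (k - 1 - i) + i := fun i hi => by
    rw [permWord_of_lt w (by omega)]
    exact grassmannianPerm_apply hk hμ ⟨i, hi⟩
  have hS := natSchubert_grassmannian hk w (fun i j hij hj => by
      rw [hword i (by omega), hword j hj]
      have := (hookShape (a + 1) (b + 1)).rowLen_anti (k - 1 - j) (k - 1 - i) (by omega)
      omega) (fun i j hi hij hj => by
      rw [permWord_of_lt w (by omega : i < k + m), permWord_of_lt w hj]
      exact Fin.lt_def.1 (grassmannianPerm_lt hk hμ (a := ⟨i, by omega⟩) (b := ⟨j, hj⟩) hi hij))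
  refine rename_injective _ (Fin.val_injective (n := k + m)) ?_
  change natSchubert w = _
  have hexp : powProd k (fun i => permWord w (k - 1 - i))
      = powProd k (hookExp k (a + 1) (b + 1)) := powProd_congr fun i hi => by
    rw [hword _ (by omega), hrow, hookExp]
    rw [show k - 1 - (k - 1 - i) = i by omega]
  rw [hS, hexp, sortDiff_hookExp (sortDiff_staircase k) a hb, schur_hookShape, rename_rename]
  have hmap : ∀ l : List (MvPolynomial (Fin k) ℂ), ∀ φ : MvPolynomial (Fin k) ℂ →+* MvPolynomial ℕ ℂ,
      φ (listHook l a b) = listHook (l.map φ) a b := by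
    intro l φ
    induction l with
    | nil => simp [listHook_nil]
    | cons x l ih =>
      simp only [listHook_cons, List.map_cons, map_add, map_mul, ih, map_listESymm, map_listHSymm]
  have := hmap ((List.finRange k).map X) (rename (Fin.val ∘ Fin.castAdd m)).toRingHom
  refine Eq.trans ?_ this.symm
  congr 1
  rw [firstVars, List.map_map, ← List.map_coe_finRange_eq_range, List.map_map]
  refine List.map_congr_left fun i _ => ?_
  simp

end Sorting

end FominKirillov

/-! ### Evaluation at the Dunkl elements and conclusion -/

namespace FominKirillov

open MvPolynomial

section Evaluation

variable {k m : ℕ}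

/-- The evaluation at the Dunkl elements `θ_1, …, θ_k`. -/
noncomputable def rowEval (k m : ℕ) : MvPolynomial (Fin k) ℂ →+* FKAlgebra (k + m) :=
  (dunklEval.comp (rename (Fin.castAdd m))).toRingHom

theorem rowEval_apply (f : MvPolynomial (Fin k) ℂ) :
    rowEval k m f = dunklEval (rename (Fin.castAdd m) f) := rfl

theorem map_rowEval_X : ((List.finRange k).map X).map (rowEval k m) = rowDunkls k m := by
  rw [List.map_map, rowDunkls]
  refine List.map_congr_left fun i _ => ?_
  rw [Function.comp_apply, rowEval_apply, rename_X, dunklEval_X]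

theorem rowEval_listESymm (r : ℕ) :
    rowEval k m (listESymm ((List.finRange k).map X) r) = listESymm (rowDunkls k m) r := by
  rw [map_listESymm, map_rowEval_X]

theorem rowEval_listHSymm (r : ℕ) :
    rowEval k m (listHSymm ((List.finRange k).map X) r) = listHSymm (rowDunkls k m) r := by
  rw [map_listHSymm, map_rowEval_X]

/-- Both sides satisfy the same recursion in the arm length, with right-hand side e_{b+1} h_{a+1}.
The recursion starts with the column shapes, where both sides are e_{b+1}. -/
theorem rowEval_schur_hookShape
    (rep : ∀ D : Finset (Fin k × Fin m), LabelingClass D → Labeling D)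
    (hrep : ∀ (D : Finset (Fin k × Fin m)) (c : LabelingClass D), (rep D c).toClass = c)
    (a b : ℕ) : rowEval k m (schur (hookShape (a + 1) (b + 1)) k) = hookSum rep (a + 1) (b + 1) := by
  induction a generalizing b with
  | zero =>
    have h := hookSum_add rep hrep 0 (Nat.succ_le_succ (Nat.zero_le b))
    rw [hookSum_zero, add_zero, listHSymm_zero, mul_one] at h
    rw [schur_hookShape, listHook_zero, rowEval_listESymm, h]
  | succ a ih =>
    have h := hookSum_add rep hrep (a + 1) (Nat.succ_le_succ (Nat.zero_le b))
    have h' := congrArg (rowEval k m) (listHook_add ((List.finRange k).map X) a b)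
    rw [map_add, map_mul, rowEval_listESymm, rowEval_listHSymm, ← h, ← schur_hookShape,
      ← schur_hookShape, ih (b + 1)] at h'
    exact add_right_cancel h'

end Evaluation

end FominKirillov

theorem theorem3p3 (k m s t : ℕ) (hs : 1 ≤ s) (ht : 1 ≤ t) (hsm : s ≤ m) (htk : t ≤ k)
    (rep : ∀ D : Finset (Fin k × Fin m),
      FominKirillov.LabelingClass D → FominKirillov.Labeling D)
    (hrep : ∀ (D : Finset (Fin k × Fin m)) (c : FominKirillov.LabelingClass D),
      (rep D c).toClass = c) :
    FominKirillov.dunklEval (FominKirillov.schubert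
        (FominKirillov.grassmannianPerm (k + m) k (FominKirillov.hookShape s t)))
      = FominKirillov.dunklEval (MvPolynomial.rename (Fin.castAdd m)
        (FominKirillov.schur (FominKirillov.hookShape s t) k)) ∧
    FominKirillov.dunklEval (MvPolynomial.rename (Fin.castAdd m)
        (FominKirillov.schur (FominKirillov.hookShape s t) k))
      = ∑ D ∈ FominKirillov.forests k m, FominKirillov.hookCoeff D s t •
          ∑ c ∈ FominKirillov.hookClasses D s t, (rep D c).monomial ∧
    FominKirillov.dunklEval (FominKirillov.schubert
        (FominKirillov.grassmannianPerm (k + m) k (FominKirillov.hookShape s t)))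
      ∈ FominKirillov.nonnegCone (k + m) := by
  obtain ⟨a, rfl⟩ := Nat.exists_eq_add_of_le' hs
  obtain ⟨b, rfl⟩ := Nat.exists_eq_add_of_le' ht
  have h1 := FominKirillov.schubert_grassmannianPerm_hookShape hsm htk
  have h2 := FominKirillov.rowEval_schur_hookShape rep hrep a b
  rw [FominKirillov.rowEval_apply] at h2
  rw [h1, h2]
  exact ⟨rfl, rfl, FominKirillov.hookSum_mem_nonnegCone rep (a + 1) (b + 1)⟩
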